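/- Let $(X,\mathcal B,\mu)$ be a standard probability space, i.e. a measure space isomorphic modulo null sets to $[0,1]$ with Lebesgue measure. For $0<q<\infty$ let $L^q$ be the set of measurable $h:X\to\mathbb R$ with $\int_X|h|^q\,d\mu<\infty$, let $L^\infty$ be the set of essentially bounded measurable $h:X\to\mathbb R$, and let $L^0$ be the set of all measurable $h:X\to\mathbb R$. Let $1\le p\le\infty$ (with $\infty-1=\infty$), and let $f\in L^p$ satisfy $\int_X f\,d\mu=0$. Then there exist an ergodic invertible measure-preserving transformation $T$ of $(X,\mathcal B,\mu)$ and a function $g\in L^{p-1}$ such that $$f(x)=g(x)-g(Tx)\qquad\text{for a.e. }x\in X.$$ -/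

import Mathlib

open MeasureTheory

/-- The measure spaces `(α, μ)` and `(β, ν)` are isomorphic modulo null sets: after removing a
measurable null set from each of them there is a bijection that is measurable and measure preserving
in both directions. -/
def IsoModZero {α β : Type*} [MeasurableSpace α] [MeasurableSpace β]
    (μ : Measure α) (ν : Measure β) : Prop :=
  ∃ (A : Set α) (B : Set β) (e : A ≃ᵐ B),
    MeasurableSet A ∧ MeasurableSet B ∧ μ Aᶜ = 0 ∧ ν Bᶜ = 0 ∧
      MeasurePreserving e (μ.comap Subtype.val) (ν.comap Subtype.val)

/-- A standard probability space: one that is isomorphic (modulo null sets) to `[0,1]` with Lebesgue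
measure. Both usual conventions are allowed for the σ-algebra of `[0,1]`: the Borel sets (first
alternative) and the Lebesgue measurable sets (second alternative). -/
def IsStandardProbabilitySpace {X : Type*} [MeasurableSpace X] (μ : Measure X) : Prop :=
  IsoModZero μ (volume : Measure (Set.Icc (0 : ℝ) 1)) ∨
    IsoModZero μ (volume : Measure (Set.Icc (0 : ℝ) 1)).completion

open Set Filter Topology


/-! It suffices to treat an atomless probability measure on the line. A `TowerState` decomposes the
line into cycles of a measure preserving map `T`; along each cycle `f` is a coboundary of `g`, up to
the sum `s` of `f` over the cycle, which is charged to the step returning to the base. Two families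
of cycles whose base sets have equal measure are joined by composing `T` with a swap of the base
sets (`exists_isSwap`, `glue`): the sums add, and `g` on the second cycle is shifted by the sum of
the first. The plan is to join cycles for ever so that the sums tend to zero, the shifts are
summable, and the limit map is ergodic.

The exponent drops by one only at the start (`exists_truncate`). A point `x` with large `f x`
absorbs points with values in `[-β, -c)` until the sum is at most a level `t`. Each absorption
lowers the sum by more than `c`, so there are at most `f x / c` of them, and at an absorbed point
`|g|` is at most `f x`. Hence `∫ |g| ^ q` is controlled by `c⁻¹ * ∫ |f| ^ (q + 1)`. The negative
tail is treated in the same way, and the remaining sums are bounded by some `σ`.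

From then on every operation costs a bounded shift of order `σ`. `exists_reduce` lowers the bound on
the sums by the factor `3 / 4`. `exists_mix` joins small pieces of the base on which the sum, the
length of the cycle and its number of visits to a set `A` are nearly constant, always adding a piece
whose sum has the sign opposite to the current total. Almost all mass ends up in cycles over one
piece, so every union of cycles is almost independent of `A`. Mixing and then reducing halves the
sums (`exists_chain`).

The functions `g` then converge uniformly off a null set, at geometric rate, to a bounded
perturbation of the first one. The maps change only where they return to a base, so they are
eventually constant almost everywhere once the measure of the bases tends to zero. A set invariant
under the limit is, up to a null set, a union of cycles at every stage, so it is independent of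
every half-line with rational endpoint and has measure zero or one. -/

/-- The distribution function of the restriction of `μ` to `A`. -/
noncomputable def setCdf (μ : Measure ℝ) (A : Set ℝ) (x : ℝ) : ℝ := μ.real (A ∩ Iic x)

/-! ### Cutting atomless measures on the line -/

section SetCdf

variable {μ : Measure ℝ}

theorem setCdf_nonneg (A : Set ℝ) (x : ℝ) : 0 ≤ setCdf μ A x := measureReal_nonneg

theorem setCdf_eq_restrict (A : Set ℝ) (x : ℝ) :
    setCdf μ A x = (μ.restrict A).real (Iic x) := by
  rw [setCdf, measureReal_restrict_apply measurableSet_Iic, inter_comm]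

variable [IsFiniteMeasure μ]

theorem setCdf_mono (A : Set ℝ) : Monotone (setCdf μ A) := fun _ _ h =>
  measureReal_mono (inter_subset_inter_right _ (Iic_subset_Iic.2 h))

theorem setCdf_le (A : Set ℝ) (x : ℝ) : setCdf μ A x ≤ μ.real A :=
  measureReal_mono inter_subset_left

theorem tendsto_setCdf_atTop (A : Set ℝ) :
    Tendsto (setCdf μ A) atTop (𝓝 (μ.real A)) := by
  have h := tendsto_measure_Iic_atTop (μ.restrict A)
  have h2 := (ENNReal.tendsto_toReal (measure_ne_top (μ.restrict A) univ)).comp h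
  simp only [Measure.restrict_apply_univ] at h2
  refine h2.congr fun x => ?_
  rw [setCdf_eq_restrict]; rfl

theorem exists_setCdf_lt (A : Set ℝ) {t : ℝ} (ht : 0 < t) : ∃ a, setCdf μ A a < t := by
  have h := tendsto_measure_iInter_atTop (μ := μ.restrict A) (s := fun n : ℕ => Iic (-(n : ℝ)))
    (fun n => measurableSet_Iic.nullMeasurableSet)
    (fun m n hmn => Iic_subset_Iic.2 (neg_le_neg (by exact_mod_cast hmn)))
    ⟨0, measure_ne_top _ _⟩
  have he : (⋂ n : ℕ, Iic (-(n : ℝ))) = ∅ := by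
    ext x
    simp only [mem_iInter, mem_Iic, mem_empty_iff_false, iff_false, not_forall, not_le]
    obtain ⟨n, hn⟩ := exists_nat_gt (-x)
    exact ⟨n, by linarith⟩
  rw [he, measure_empty] at h
  have h2 := (ENNReal.tendsto_toReal ENNReal.zero_ne_top).comp h
  simp only [ENNReal.toReal_zero] at h2
  obtain ⟨n, hn⟩ := (h2.eventually_lt_const ht).exists
  exact ⟨-(n : ℝ), by rw [setCdf_eq_restrict]; exact hn⟩

variable [NullSingletonClass μ]

theorem continuous_setCdf (A : Set ℝ) : Continuous (setCdf μ A) := by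
  have h := intervalIntegral.continuous_primitive (μ := μ.restrict A) (f := fun _ => (1 : ℝ))
    (fun a b => intervalIntegrable_const) 0
  have h2 : setCdf μ A = fun b => (∫ _ in (0 : ℝ)..b, (1 : ℝ) ∂(μ.restrict A)) + setCdf μ A 0 := by
    funext b
    rw [← intervalIntegral.integral_Iic_sub_Iic (integrable_const _).integrableOn
      (integrable_const _).integrableOn]
    simp [setCdf_eq_restrict]
  rw [h2]
  exact h.add continuous_const

theorem exists_setCdf_eq (A : Set ℝ) {t : ℝ} (h0 : 0 < t) (h1 : t < μ.real A) :
    ∃ x, setCdf μ A x = t := by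
  obtain ⟨a, ha⟩ := exists_setCdf_lt (μ := μ) A h0
  obtain ⟨b, hb⟩ := ((tendsto_setCdf_atTop (μ := μ) A).eventually_const_lt h1).exists
  exact mem_range_of_exists_le_of_exists_ge (continuous_setCdf A) ⟨a, ha.le⟩ ⟨b, hb.le⟩

/-- Without atoms the distribution function is continuous, so the intermediate value theorem gives a
half-line that cuts off the required mass. -/
theorem exists_subset_measureReal_eq {A : Set ℝ} (hA : MeasurableSet A) {t : ℝ} (h0 : 0 ≤ t)
    (h1 : t ≤ μ.real A) : ∃ F ⊆ A, MeasurableSet F ∧ μ.real F = t := by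
  rcases h0.eq_or_lt with rfl | h0
  · exact ⟨∅, empty_subset _, MeasurableSet.empty, by simp⟩
  rcases h1.eq_or_lt with rfl | h1
  · exact ⟨A, Subset.rfl, hA, rfl⟩
  obtain ⟨x, hx⟩ := exists_setCdf_eq (μ := μ) A h0 h1
  exact ⟨A ∩ Iic x, inter_subset_left, hA.inter measurableSet_Iic, hx⟩

theorem exists_between_measureReal_eq {A C : Set ℝ} (hA : MeasurableSet A) (hC : MeasurableSet C)
    (hAC : A ⊆ C) {t : ℝ} (h0 : μ.real A ≤ t) (h1 : t ≤ μ.real C) :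
    ∃ F, A ⊆ F ∧ F ⊆ C ∧ MeasurableSet F ∧ μ.real F = t := by
  obtain ⟨F, hF, hFm, hFt⟩ := exists_subset_measureReal_eq (μ := μ) (hC.diff hA)
    (t := t - μ.real A) (by linarith)
    (by rw [measureReal_sdiff hAC hA]; linarith)
  refine ⟨A ∪ F, subset_union_left, union_subset hAC (hF.trans sdiff_subset), hA.union hFm, ?_⟩
  rw [measureReal_union (disjoint_sdiff_right.mono_right hF) hFm]
  linarith

/-- A set can be split into a lower and an upper part of prescribed measure with respect to the
values of `s`. -/
theorem exists_threshold_split {A : Set ℝ} (hA : MeasurableSet A) {s : ℝ → ℝ} (hs : Measurable s)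
    {lo hi : ℝ} (hlh : lo ≤ hi) (hlo : ∀ x ∈ A, lo ≤ s x) (hhi : ∀ x ∈ A, s x ≤ hi)
    {t : ℝ} (h0 : 0 ≤ t) (h1 : t ≤ μ.real A) :
    ∃ F ⊆ A, ∃ θ ∈ Icc lo hi, MeasurableSet F ∧ μ.real F = t ∧ (∀ x ∈ F, s x ≤ θ) ∧
      ∀ x ∈ A \ F, θ ≤ s x := by
  -- The threshold is the least level whose sublevel set has mass at least `t`. Continuity of the
  -- measure from above and from below gives the two inequalities `hup` and `hlow`.
  set W : Set ℝ := {r | r ∈ Icc lo hi ∧ t ≤ μ.real (A ∩ {x | s x ≤ r})} with hW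
  have hhiW : hi ∈ W := by
    refine ⟨⟨hlh, le_rfl⟩, ?_⟩
    have : A ∩ {x | s x ≤ hi} = A := inter_eq_left.2 hhi
    rwa [this]
  have hbdd : BddBelow W := ⟨lo, fun r hr => hr.1.1⟩
  set θ := sInf W with hθ
  have hθlo : lo ≤ θ := le_csInf ⟨hi, hhiW⟩ fun r hr => hr.1.1
  have hθhi : θ ≤ hi := csInf_le hbdd hhiW
  have hms : ∀ r, MeasurableSet {x | s x ≤ r} := fun r => measurableSet_le hs measurable_const
  have hms' : MeasurableSet {x | s x < θ} := measurableSet_lt hs measurable_const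
  have hup : t ≤ μ.real (A ∩ {x | s x ≤ θ}) := by
    have hseq : Tendsto (fun n : ℕ => μ.real (A ∩ {x | s x ≤ θ + 1 / ((n : ℝ) + 1)})) atTop
        (𝓝 (μ.real (⋂ n : ℕ, A ∩ {x | s x ≤ θ + 1 / ((n : ℝ) + 1)}))) := by
      refine (ENNReal.tendsto_toReal (measure_ne_top μ _)).comp
        (tendsto_measure_iInter_atTop (fun n => (hA.inter (hms _)).nullMeasurableSet) ?_
          ⟨0, measure_ne_top μ _⟩)
      intro m n hmn x hx
      refine ⟨hx.1, (show s x ≤ _ from hx.2).trans ?_⟩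
      have : (1 : ℝ) / ((n : ℝ) + 1) ≤ 1 / ((m : ℝ) + 1) := by
        apply one_div_le_one_div_of_le (by positivity)
        have : (m : ℝ) ≤ n := by exact_mod_cast hmn
        linarith
      linarith
    have hset : (⋂ n : ℕ, A ∩ {x | s x ≤ θ + 1 / ((n : ℝ) + 1)}) = A ∩ {x | s x ≤ θ} := by
      ext x
      simp only [mem_iInter, mem_inter_iff, mem_ofPred_eq]
      constructor
      · intro h
        refine ⟨(h 0).1, ?_⟩
        have hl : Tendsto (fun n : ℕ => θ + 1 / ((n : ℝ) + 1)) atTop (𝓝 (θ + 0)) :=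
          tendsto_const_nhds.add tendsto_one_div_add_atTop_nhds_zero_nat
        rw [add_zero] at hl
        exact ge_of_tendsto' hl fun n => (h n).2
      · intro h n
        exact ⟨h.1, h.2.trans (by have : (0 : ℝ) ≤ 1 / ((n : ℝ) + 1) := by positivity
                                  linarith)⟩
    rw [hset] at hseq
    refine ge_of_tendsto' hseq fun n => ?_
    obtain ⟨r, hr, hrl⟩ := exists_lt_of_csInf_lt ⟨hi, hhiW⟩
      (show sInf W < θ + 1 / ((n : ℝ) + 1) by
        have : (0 : ℝ) < 1 / ((n : ℝ) + 1) := by positivity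
        linarith)
    exact hr.2.trans (measureReal_mono (inter_subset_inter_right _ fun x hx =>
      (show s x ≤ r from hx).trans hrl.le))
  have hlow : μ.real (A ∩ {x | s x < θ}) ≤ t := by
    have hseq : Tendsto (fun n : ℕ => μ.real (A ∩ {x | s x ≤ θ - 1 / ((n : ℝ) + 1)})) atTop
        (𝓝 (μ.real (⋃ n : ℕ, A ∩ {x | s x ≤ θ - 1 / ((n : ℝ) + 1)}))) := by
      refine (ENNReal.tendsto_toReal (measure_ne_top μ _)).comp
        (tendsto_measure_iUnion_atTop ?_)
      intro m n hmn x hx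
      refine ⟨hx.1, (show s x ≤ _ from hx.2).trans ?_⟩
      have : (1 : ℝ) / ((n : ℝ) + 1) ≤ 1 / ((m : ℝ) + 1) := by
        apply one_div_le_one_div_of_le (by positivity)
        have : (m : ℝ) ≤ n := by exact_mod_cast hmn
        linarith
      linarith
    have hset : (⋃ n : ℕ, A ∩ {x | s x ≤ θ - 1 / ((n : ℝ) + 1)}) = A ∩ {x | s x < θ} := by
      ext x
      simp only [mem_iUnion, mem_inter_iff, mem_ofPred_eq]
      constructor
      · rintro ⟨n, h, h'⟩
        refine ⟨h, lt_of_le_of_lt h' ?_⟩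
        have : (0 : ℝ) < 1 / ((n : ℝ) + 1) := by positivity
        linarith
      · rintro ⟨h, h'⟩
        obtain ⟨n, hn⟩ := exists_nat_one_div_lt (sub_pos.2 h')
        exact ⟨n, h, by linarith⟩
    rw [hset] at hseq
    refine le_of_tendsto' hseq fun n => ?_
    by_contra hcon
    push Not at hcon
    set r := θ - 1 / ((n : ℝ) + 1) with hr
    have hrθ : r < θ := by
      have : (0 : ℝ) < 1 / ((n : ℝ) + 1) := by positivity
      linarith
    have hne : (A ∩ {x | s x ≤ r}).Nonempty := by
      by_contra hemp
      rw [not_nonempty_iff_eq_empty] at hemp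
      rw [hemp] at hcon
      simp at hcon
      linarith
    obtain ⟨x, hx, hxr⟩ := hne
    have hmem : r ∈ W := ⟨⟨(hlo x hx).trans hxr, hrθ.le.trans hθhi⟩, hcon.le⟩
    exact absurd (csInf_le hbdd hmem) (not_le.2 hrθ)
  -- The level set `s = θ` may have positive mass, so `F` has to cut through it.
  obtain ⟨F, hF1, hF2, hFm, hFt⟩ := exists_between_measureReal_eq (μ := μ) (hA.inter hms')
    (hA.inter (hms θ)) (inter_subset_inter_right _ fun x (hx : s x < θ) => hx.le) hlow hup
  refine ⟨F, hF2.trans inter_subset_left, θ, ⟨hθlo, hθhi⟩, hFm, hFt, fun x hx => (hF2 hx).2, ?_⟩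
  rintro x ⟨hxA, hxF⟩
  by_contra hcon
  exact hxF (hF1 ⟨hxA, not_le.1 hcon⟩)

/-- By monotonicity and continuity the sublevel set is empty or a closed half-line, whose endpoint
is the last point where the distribution function is at most `t`. -/
theorem measureReal_inter_setCdf_le (A : Set ℝ) {t : ℝ}
    (h0 : 0 ≤ t) (h1 : t < μ.real A) : μ.real (A ∩ {x | setCdf μ A x ≤ t}) = t := by
  have hb : BddAbove {x | setCdf μ A x ≤ t} := by
    obtain ⟨b, hb⟩ := ((tendsto_setCdf_atTop (μ := μ) A).eventually_const_lt h1).exists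
    refine ⟨b, fun x hx => ?_⟩
    by_contra hcon
    exact absurd (setCdf_mono (μ := μ) A (not_le.1 hcon).le) (not_le.2 (lt_of_le_of_lt hx hb))
  have hcl : IsClosed {x | setCdf μ A x ≤ t} := isClosed_le (continuous_setCdf A) continuous_const
  rcases eq_empty_or_nonempty {x | setCdf μ A x ≤ t} with he | hne
  · rcases h0.eq_or_lt with rfl | h0
    · simp [he]
    · obtain ⟨x, hx⟩ := exists_setCdf_eq (μ := μ) A h0 h1
      exact absurd (show x ∈ {x | setCdf μ A x ≤ t} from hx.le) (by rw [he]; simp)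
  · have hmem := hcl.csSup_mem hne hb
    set y := sSup {x | setCdf μ A x ≤ t}
    have hIic : {x | setCdf μ A x ≤ t} = Iic y := by
      ext x
      exact ⟨fun hx => le_csSup hb hx, fun hx => (setCdf_mono A hx).trans hmem⟩
    rw [hIic]
    refine le_antisymm hmem ?_
    rcases h0.eq_or_lt with rfl | h0
    · exact measureReal_nonneg
    · obtain ⟨x, hx⟩ := exists_setCdf_eq (μ := μ) A h0 h1
      have : x ∈ Iic y := hIic ▸ hx.le
      rw [← hx]
      exact setCdf_mono A this

/-- This is the probability integral transform. The image depends on `A` only through its mass,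
which lets two sets of equal mass be matched. -/
theorem map_setCdf (A : Set ℝ) :
    (μ.restrict A).map (setCdf μ A) = volume.restrict (Icc 0 (μ.real A)) := by
  have hm : Measurable (setCdf μ A) := (setCdf_mono A).measurable
  refine Measure.ext_of_Iic _ _ fun t => ?_
  rw [Measure.map_apply hm measurableSet_Iic, Measure.restrict_apply (hm measurableSet_Iic),
    Measure.restrict_apply measurableSet_Iic, inter_comm _ A, inter_comm (Iic t),
    show Icc 0 (μ.real A) ∩ Iic t = Icc 0 (min (μ.real A) t) by ext; simp [and_assoc],
    Real.volume_Icc, sub_zero]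
  rcases lt_or_ge t 0 with ht | ht
  · have : A ∩ setCdf μ A ⁻¹' Iic t = ∅ := by
      ext x
      simp only [mem_inter_iff, mem_preimage, mem_Iic, mem_empty_iff_false, iff_false, not_and]
      intro _ h
      linarith [setCdf_nonneg (μ := μ) A x]
    rw [this, measure_empty, ENNReal.ofReal_of_nonpos]
    exact (min_le_right _ _).trans ht.le
  rcases lt_or_ge t (μ.real A) with ht' | ht'
  · rw [min_eq_right ht'.le, ← measureReal_inter_setCdf_le (μ := μ) A ht ht', ofReal_measureReal]
    rw [measureReal_inter_setCdf_le (μ := μ) A ht ht']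
    rfl
  · have : A ∩ setCdf μ A ⁻¹' Iic t = A :=
      inter_eq_left.2 fun x _ => (setCdf_le A x).trans ht'
    rw [this, min_eq_left ht', ofReal_measureReal]

/-- If the distribution function agrees at two points, it is constant between them and takes the
same value at a rational. Removing the fibres over the values at rationals restores injectivity;
they are null because single points are null for the image measure. -/
theorem exists_conull_injOn_setCdf (A : Set ℝ) (hA : MeasurableSet A) :
    ∃ A' ⊆ A, MeasurableSet A' ∧ μ (A \ A') = 0 ∧ InjOn (setCdf μ A) A' := by
  have hm : Measurable (setCdf μ A) := (setCdf_mono A).measurable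
  set Z : Set ℝ := ⋃ q : ℚ, setCdf μ A ⁻¹' {setCdf μ A q}
  have hZ : MeasurableSet Z := MeasurableSet.iUnion fun q => hm (measurableSet_singleton _)
  refine ⟨A \ Z, sdiff_subset, hA.diff hZ, ?_, ?_⟩
  · rw [sdiff_sdiff_right_self, inter_iUnion, measure_iUnion_null_iff]
    intro q
    have h : (μ.restrict A).map (setCdf μ A) {setCdf μ A q} = 0 := by
      rw [map_setCdf A]
      exact measure_singleton _
    rwa [Measure.map_apply hm (measurableSet_singleton _),
      Measure.restrict_apply (hm (measurableSet_singleton _)), inter_comm] at h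
  · have key : ∀ x y, x ∈ A \ Z → x < y → setCdf μ A x ≠ setCdf μ A y := by
      intro x y hx hxy heq
      obtain ⟨q, hq1, hq2⟩ := exists_rat_btwn hxy
      have h1 := setCdf_mono (μ := μ) A hq1.le
      have h2 := setCdf_mono (μ := μ) A hq2.le
      exact hx.2 (mem_iUnion.2 ⟨q, le_antisymm h1 (heq ▸ h2)⟩)
    intro x hx y hy hxy
    rcases lt_trichotomy x y with h | h | h
    · exact absurd hxy (key x y hx h)
    · exact h
    · exact absurd hxy.symm (key y x hy h)

end SetCdf

/-! ### Measure preserving swaps -/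

/-- `τ` is a measure preserving involution that exchanges `E` and `F` and fixes all other points. -/
structure IsSwap (μ : Measure ℝ) (τ : ℝ ≃ᵐ ℝ) (E F : Set ℝ) : Prop where
  mp : MeasurePreserving τ μ μ
  invol : ∀ x, τ (τ x) = x
  mapsE : ∀ x ∈ E, τ x ∈ F
  mapsF : ∀ x ∈ F, τ x ∈ E
  fix : ∀ x, x ∉ E → x ∉ F → τ x = x

/-- Points of `E` and `F` with the same value of their distribution functions are exchanged. Both
functions have the same law and are injective off null sets, so almost every point has exactly one
partner. -/
theorem exists_isSwap {μ : Measure ℝ} [IsFiniteMeasure μ] [NullSingletonClass μ] {E F : Set ℝ}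
    (hE : MeasurableSet E) (hF : MeasurableSet F) (hEF : Disjoint E F) (h : μ.real E = μ.real F) :
    ∃ E' ⊆ E, ∃ F' ⊆ F, ∃ τ : ℝ ≃ᵐ ℝ, MeasurableSet E' ∧ MeasurableSet F' ∧ μ (E \ E') = 0 ∧
      μ (F \ F') = 0 ∧ IsSwap μ τ E' F' := by
  classical
  obtain ⟨E₁, hE₁, hE₁m, hE₁0, hEinj⟩ := exists_conull_injOn_setCdf (μ := μ) E hE
  obtain ⟨F₁, hF₁, hF₁m, hF₁0, hFinj⟩ := exists_conull_injOn_setCdf (μ := μ) F hF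
  set c := setCdf μ E
  set d := setCdf μ F
  have hc : Measurable c := (setCdf_mono E).measurable
  have hd : Measurable d := (setCdf_mono F).measurable
  have hlaw : (μ.restrict E).map c = (μ.restrict F).map d := by
    rw [map_setCdf E, map_setCdf F, h]
  have hlaw' : ∀ S, MeasurableSet S → μ (E ∩ c ⁻¹' S) = μ (F ∩ d ⁻¹' S) := by
    intro S hS
    have := congrArg (fun ν => ν S) hlaw
    simpa only [Measure.map_apply hc hS, Measure.map_apply hd hS, Measure.restrict_apply (hc hS),
      Measure.restrict_apply (hd hS), inter_comm] using this
  have hcE : MeasurableSet (c '' E₁) := hE₁m.image_of_measurable_injOn hc hEinj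
  have hdF : MeasurableSet (d '' F₁) := hF₁m.image_of_measurable_injOn hd hFinj
  -- Only points that have a partner are kept; equality of the laws makes the rest null.
  set E' := E₁ ∩ c ⁻¹' (d '' F₁) with hE'
  set F' := F₁ ∩ d ⁻¹' (c '' E₁) with hF'
  have hE'm : MeasurableSet E' := hE₁m.inter (hc hdF)
  have hF'm : MeasurableSet F' := hF₁m.inter (hd hcE)
  have hE'0 : μ (E \ E') = 0 := by
    have h1 : μ (E ∩ c ⁻¹' (d '' F₁)ᶜ) = 0 := by
      rw [hlaw' _ hdF.compl]
      refine measure_mono_null ?_ hF₁0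
      rintro x ⟨hx, hx'⟩
      exact ⟨hx, fun hx₁ => hx' (mem_image_of_mem _ hx₁)⟩
    refine measure_mono_null ?_ (measure_union_null hE₁0 h1)
    rintro x ⟨hx, hx'⟩
    by_cases hx₁ : x ∈ E₁
    · exact Or.inr ⟨hx, fun h => hx' ⟨hx₁, h⟩⟩
    · exact Or.inl ⟨hx, hx₁⟩
  have hF'0 : μ (F \ F') = 0 := by
    have h1 : μ (F ∩ d ⁻¹' (c '' E₁)ᶜ) = 0 := by
      rw [← hlaw' _ hcE.compl]
      refine measure_mono_null ?_ hE₁0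
      rintro x ⟨hx, hx'⟩
      exact ⟨hx, fun hx₁ => hx' (mem_image_of_mem _ hx₁)⟩
    refine measure_mono_null ?_ (measure_union_null hF₁0 h1)
    rintro x ⟨hx, hx'⟩
    by_cases hx₁ : x ∈ F₁
    · exact Or.inr ⟨hx, fun h => hx' ⟨hx₁, h⟩⟩
    · exact Or.inl ⟨hx, hx₁⟩
  have hphi : ∀ x, ∃ y, x ∈ E' → y ∈ F' ∧ d y = c x := by
    intro x
    by_cases hx : x ∈ E'
    · obtain ⟨y, hy, hyx⟩ := hx.2
      exact ⟨y, fun _ => ⟨⟨hy, ⟨x, hx.1, hyx.symm⟩⟩, hyx⟩⟩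
    · exact ⟨0, fun h => absurd h hx⟩
  have hpsi : ∀ y, ∃ x, y ∈ F' → x ∈ E' ∧ c x = d y := by
    intro y
    by_cases hy : y ∈ F'
    · obtain ⟨x, hx, hxy⟩ := hy.2
      exact ⟨x, fun _ => ⟨⟨hx, ⟨y, hy.1, hxy.symm⟩⟩, hxy⟩⟩
    · exact ⟨0, fun h => absurd h hy⟩
  choose φ hφ using hphi
  choose ψ hψ using hpsi
  have hφψ : ∀ x ∈ E', ψ (φ x) = x := fun x hx =>
    hEinj (hψ _ (hφ x hx).1).1.1 hx.1 ((hψ _ (hφ x hx).1).2.trans (hφ x hx).2)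
  have hψφ : ∀ y ∈ F', φ (ψ y) = y := fun y hy =>
    hFinj (hφ _ (hψ y hy).1).1.1 hy.1 ((hφ _ (hψ y hy).1).2.trans (hψ y hy).2)
  have hdisj : ∀ x ∈ E', x ∉ F' := fun x hx hx' =>
    hEF.le_bot ⟨hE₁ hx.1, hF₁ hx'.1⟩
  set t : ℝ → ℝ := fun x => if x ∈ E' then φ x else if x ∈ F' then ψ x else x with ht
  have htE : ∀ x ∈ E', t x = φ x := fun x hx => by simp only [ht, if_pos hx]
  have htF : ∀ x ∈ F', t x = ψ x := fun x hx => by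
    simp only [ht, if_neg (fun h' => hdisj x h' hx), if_pos hx]
  have htO : ∀ x, x ∉ E' → x ∉ F' → t x = x := fun x hx hx' => by
    simp only [ht, if_neg hx, if_neg hx']
  have htt : ∀ x, t (t x) = x := by
    intro x
    by_cases hx : x ∈ E'
    · rw [htE x hx, htF _ (hφ x hx).1, hφψ x hx]
    by_cases hx' : x ∈ F'
    · rw [htF x hx', htE _ (hψ x hx').1, hψφ x hx']
    · rw [htO x hx hx', htO x hx hx']
  -- Preimages under `t` are written through images under `c` and `d`. Injective measurable images
  -- of Borel sets are Borel, which gives measurability of `t`.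
  have hpreE : ∀ S, E' ∩ t ⁻¹' S = E' ∩ c ⁻¹' (d '' (F₁ ∩ S)) := by
    intro S
    ext x
    constructor
    · rintro ⟨hx, hxS⟩
      rw [mem_preimage, htE x hx] at hxS
      exact ⟨hx, ⟨φ x, ⟨(hφ x hx).1.1, hxS⟩, (hφ x hx).2⟩⟩
    · rintro ⟨hx, y, ⟨hy, hyS⟩, hyx⟩
      refine ⟨hx, ?_⟩
      rw [mem_preimage, htE x hx, hFinj (hφ x hx).1.1 hy ((hφ x hx).2.trans hyx.symm)]
      exact hyS
  have hpreF : ∀ S, F' ∩ t ⁻¹' S = F' ∩ d ⁻¹' (c '' (E₁ ∩ S)) := by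
    intro S
    ext x
    constructor
    · rintro ⟨hx, hxS⟩
      rw [mem_preimage, htF x hx] at hxS
      exact ⟨hx, ⟨ψ x, ⟨(hψ x hx).1.1, hxS⟩, (hψ x hx).2⟩⟩
    · rintro ⟨hx, y, ⟨hy, hyS⟩, hyx⟩
      refine ⟨hx, ?_⟩
      rw [mem_preimage, htF x hx, hEinj (hψ x hx).1.1 hy ((hψ x hx).2.trans hyx.symm)]
      exact hyS
  have himF : ∀ S, MeasurableSet S → MeasurableSet (d '' (F₁ ∩ S)) := fun S hS =>
    (hF₁m.inter hS).image_of_measurable_injOn hd (hFinj.mono inter_subset_left)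
  have himE : ∀ S, MeasurableSet S → MeasurableSet (c '' (E₁ ∩ S)) := fun S hS =>
    (hE₁m.inter hS).image_of_measurable_injOn hc (hEinj.mono inter_subset_left)
  have hsplit : ∀ S, t ⁻¹' S =
      (E' ∩ t ⁻¹' S) ∪ ((F' ∩ t ⁻¹' S) ∪ (S \ (E' ∪ F'))) := by
    intro S
    ext x
    by_cases hx : x ∈ E'
    · simp [hx]
    by_cases hx' : x ∈ F'
    · simp [hx, hx']
    · simp [hx, hx', htO x hx hx']
  have htm : Measurable t := by
    intro S hS
    rw [hsplit S, hpreE, hpreF]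
    exact (hE'm.inter (hc (himF S hS))).union
      ((hF'm.inter (hd (himE S hS))).union (hS.diff (hE'm.union hF'm)))
  have hmE : ∀ S, MeasurableSet S → μ (E' ∩ t ⁻¹' S) = μ (F' ∩ S) := by
    intro S hS
    have h1 : μ (E' ∩ t ⁻¹' S) = μ (E ∩ c ⁻¹' (d '' (F₁ ∩ S))) := by
      rw [hpreE]
      refine measure_congr ((ae_le_set.2 ?_).antisymm (ae_le_set.2 ?_))
      · exact measure_mono_null (fun x hx => hx.2 ⟨hE₁ hx.1.1.1, hx.1.2⟩) measure_empty
      · refine measure_mono_null ?_ hE'0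
        exact fun x hx => ⟨hx.1.1, fun h' => hx.2 ⟨h', hx.1.2⟩⟩
    rw [h1, hlaw' _ (himF S hS)]
    refine measure_congr ((ae_le_set.2 ?_).antisymm (ae_le_set.2 ?_))
    · refine measure_mono_null ?_ hF'0
      rintro x ⟨⟨hx, y, hy, hyx⟩, hx'⟩
      refine ⟨hx, fun hxF => hx' ⟨hxF, ?_⟩⟩
      rw [hFinj hxF.1 hy.1 hyx.symm]
      exact hy.2
    · exact measure_mono_null
        (fun x hx => hx.2 ⟨hF₁ hx.1.1.1, ⟨x, ⟨hx.1.1.1, hx.1.2⟩, rfl⟩⟩)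
        measure_empty
  have hmF : ∀ S, MeasurableSet S → μ (F' ∩ t ⁻¹' S) = μ (E' ∩ S) := by
    intro S hS
    rw [← hmE _ (htm hS)]
    congr 1
    ext x
    simp [htt]
  have hmp : MeasurePreserving t μ μ := by
    refine ⟨htm, ?_⟩
    ext S hS
    have d1 : Disjoint (E' ∩ t ⁻¹' S) ((F' ∩ t ⁻¹' S) ∪ (S \ (E' ∪ F'))) := by
      rw [disjoint_left]
      rintro x ⟨hx, -⟩ (⟨hx', -⟩ | ⟨-, hx'⟩)
      · exact hdisj x hx hx'
      · exact hx' (Or.inl hx)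
    have d2 : Disjoint (F' ∩ t ⁻¹' S) (S \ (E' ∪ F')) := by
      rw [disjoint_left]
      rintro x ⟨hx, -⟩ ⟨-, hx'⟩
      exact hx' (Or.inr hx)
    have e1 : Disjoint (F' ∩ S) ((E' ∩ S) ∪ (S \ (E' ∪ F'))) := by
      rw [disjoint_left]
      rintro x ⟨hx, -⟩ (⟨hx', -⟩ | ⟨-, hx'⟩)
      · exact hdisj x hx' hx
      · exact hx' (Or.inr hx)
    have e2 : Disjoint (E' ∩ S) (S \ (E' ∪ F')) := by
      rw [disjoint_left]
      rintro x ⟨hx, -⟩ ⟨-, hx'⟩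
      exact hx' (Or.inl hx)
    have hR := hS.diff (hE'm.union hF'm)
    have hS' : S = (F' ∩ S) ∪ ((E' ∩ S) ∪ (S \ (E' ∪ F'))) := by
      ext x
      by_cases hx : x ∈ E' <;> by_cases hx' : x ∈ F' <;> simp [hx, hx']
    rw [Measure.map_apply htm hS, hsplit S, measure_union d1 ((hF'm.inter (htm hS)).union hR),
      measure_union d2 hR, hmE S hS, hmF S hS, ← measure_union e2 hR,
      ← measure_union e1 ((hE'm.inter hS).union hR), ← hS']
  refine ⟨E', inter_subset_left.trans hE₁, F', inter_subset_left.trans hF₁,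
    ⟨⟨t, t, htt, htt⟩, htm, htm⟩, hE'm, hF'm, hE'0, hF'0, hmp, htt, ?_, ?_, htO⟩
  · intro x hx
    change t x ∈ F'
    rw [htE x hx]
    exact (hφ x hx).1
  · intro x hx
    change t x ∈ E'
    rw [htF x hx]
    exact (hψ x hx).1

/-! ### Limits of eventually constant automorphisms -/

/-- The points of `S` whose images under all words of length at most `k` in the maps `T n` and their
inverses lie in `S`. -/
def wordCore (T : ℕ → ℝ ≃ᵐ ℝ) (S : Set ℝ) : ℕ → Set ℝ
  | 0 => S
  | k + 1 => wordCore T S k ∩ ⋂ n, (T n ⁻¹' wordCore T S k ∩ (T n).symm ⁻¹' wordCore T S k)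

theorem wordCore_univ (T : ℕ → ℝ ≃ᵐ ℝ) (k : ℕ) : wordCore T univ k = univ := by
  induction k with
  | zero => rfl
  | succ k ih => simp [wordCore, ih]

theorem measurableSet_wordCore (T : ℕ → ℝ ≃ᵐ ℝ) {S : Set ℝ} (hS : MeasurableSet S) (k : ℕ) :
    MeasurableSet (wordCore T S k) := by
  induction k with
  | zero => exact hS
  | succ k ih =>
    exact ih.inter (MeasurableSet.iInter fun n =>
      ((T n).measurable ih).inter ((T n).symm.measurable ih))

theorem measure_compl_wordCore {μ : Measure ℝ} (T : ℕ → ℝ ≃ᵐ ℝ)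
    (hT : ∀ n, MeasurePreserving (T n) μ μ) {S : Set ℝ} (hS : MeasurableSet S)
    (hS0 : μ Sᶜ = 0) (k : ℕ) : μ (wordCore T S k)ᶜ = 0 := by
  induction k with
  | zero => exact hS0
  | succ k ih =>
    have hm := (measurableSet_wordCore T hS k).compl.nullMeasurableSet (μ := μ)
    simp only [wordCore, compl_inter, compl_iInter]
    refine measure_union_null ih (measure_iUnion_null fun n => measure_union_null ?_ ?_)
    · rw [← preimage_compl, (hT n).measure_preimage hm, ih]
    · rw [← preimage_compl, ((hT n).symm (T n)).measure_preimage hm, ih]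

/-- A sequence of measure preserving equivalences that is eventually constant at almost every point,
together with the inverses, converges to a measure preserving equivalence. -/
theorem exists_limit_equiv {μ : Measure ℝ} [IsFiniteMeasure μ] (T : ℕ → ℝ ≃ᵐ ℝ)
    (hT : ∀ n, MeasurePreserving (T n) μ μ)
    {S : Set ℝ} (hS : MeasurableSet S) (hS0 : μ Sᶜ = 0)
    (h1 : ∀ x ∈ S, ∃ y, ∀ᶠ n in atTop, T n x = y)
    (h2 : ∀ x ∈ S, ∃ y, ∀ᶠ n in atTop, (T n).symm x = y) :
    ∃ (G : Set ℝ) (L : ℝ ≃ᵐ ℝ), G ⊆ S ∧ (S = univ → G = univ) ∧ MeasurableSet G ∧ μ Gᶜ = 0 ∧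
      MeasurePreserving L μ μ ∧ (∀ n x, T n x ∈ G ↔ x ∈ G) ∧
      (∀ x ∈ G, ∀ᶠ n in atTop, T n x = L x) ∧ ∀ x ∈ G, ∀ᶠ n in atTop, (T n).symm x = L.symm x := by
  classical
  -- `G` is invariant under all `T n` and their inverses, so the pointwise limits `L` and `R` map
  -- `G` to itself. Both are set to be the identity off `G`, which makes them inverse to each other
  -- everywhere.
  set G : Set ℝ := ⋂ k, wordCore T S k with hG
  have hGm : MeasurableSet G := MeasurableSet.iInter fun k => measurableSet_wordCore T hS k
  have hGS : G ⊆ S := iInter_subset (wordCore T S) 0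
  have hG0 : μ Gᶜ = 0 := by
    rw [hG, compl_iInter]
    exact measure_iUnion_null fun k => measure_compl_wordCore T hT hS hS0 k
  have hGT : ∀ n x, x ∈ G → T n x ∈ G := fun n x hx => mem_iInter.2 fun k =>
    (mem_iInter.1 (mem_iInter.1 hx (k + 1)).2 n).1
  have hGT' : ∀ n x, x ∈ G → (T n).symm x ∈ G := fun n x hx => mem_iInter.2 fun k =>
    (mem_iInter.1 (mem_iInter.1 hx (k + 1)).2 n).2
  have hGiff : ∀ n x, T n x ∈ G ↔ x ∈ G := fun n x =>
    ⟨fun h => by simpa using hGT' n _ h, hGT n x⟩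
  have h1' : ∀ x, ∃ y, (x ∈ G → ∀ᶠ n in atTop, T n x = y) ∧ (x ∉ G → y = x) := by
    intro x
    by_cases hx : x ∈ G
    · obtain ⟨y, hy⟩ := h1 x (hGS hx)
      exact ⟨y, fun _ => hy, fun h => absurd hx h⟩
    · exact ⟨x, fun h => absurd h hx, fun _ => rfl⟩
  have h2' : ∀ x, ∃ y, (x ∈ G → ∀ᶠ n in atTop, (T n).symm x = y) ∧ (x ∉ G → y = x) := by
    intro x
    by_cases hx : x ∈ G
    · obtain ⟨y, hy⟩ := h2 x (hGS hx)
      exact ⟨y, fun _ => hy, fun h => absurd hx h⟩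
    · exact ⟨x, fun h => absurd h hx, fun _ => rfl⟩
  choose L hL hL' using h1'
  choose R hR hR' using h2'
  have hLG : ∀ x ∈ G, L x ∈ G := fun x hx => by
    obtain ⟨n, hn⟩ := (hL x hx).exists
    exact hn ▸ hGT n x hx
  have hRG : ∀ x ∈ G, R x ∈ G := fun x hx => by
    obtain ⟨n, hn⟩ := (hR x hx).exists
    exact hn ▸ hGT' n x hx
  have hRL : ∀ x, R (L x) = x := by
    intro x
    by_cases hx : x ∈ G
    · obtain ⟨n, hn1, hn2⟩ := ((hL x hx).and (hR _ (hLG x hx))).exists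
      rw [← hn2, ← hn1, MeasurableEquiv.symm_apply_apply]
    · rw [hL' x hx, hR' x hx]
  have hLR : ∀ x, L (R x) = x := by
    intro x
    by_cases hx : x ∈ G
    · obtain ⟨n, hn1, hn2⟩ := ((hR x hx).and (hL _ (hRG x hx))).exists
      rw [← hn2, ← hn1, MeasurableEquiv.apply_symm_apply]
    · rw [hR' x hx, hL' x hx]
  have hLm : Measurable L := by
    refine measurable_of_tendsto_metrizable
      (f := fun n x => if x ∈ G then T n x else x)
      (fun n => (T n).measurable.ite hGm measurable_id) (tendsto_pi_nhds.2 fun x => ?_)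
    by_cases hx : x ∈ G
    · simp only [if_pos hx]
      exact tendsto_const_nhds.congr' ((hL x hx).mono fun n hn => hn.symm)
    · simp only [if_neg hx, hL' x hx]
      exact tendsto_const_nhds
  have hRm : Measurable R := by
    refine measurable_of_tendsto_metrizable
      (f := fun n x => if x ∈ G then (T n).symm x else x)
      (fun n => (T n).symm.measurable.ite hGm measurable_id) (tendsto_pi_nhds.2 fun x => ?_)
    by_cases hx : x ∈ G
    · simp only [if_pos hx]
      exact tendsto_const_nhds.congr' ((hR x hx).mono fun n hn => hn.symm)
    · simp only [if_neg hx, hR' x hx]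
      exact tendsto_const_nhds
  have hmp : MeasurePreserving L μ μ := by
    refine ⟨hLm, ?_⟩
    ext A hA
    rw [Measure.map_apply hLm hA]
    -- Eventual equality makes the indicators of the preimages of `A` converge pointwise almost
    -- everywhere, even though `A` has no topological regularity.
    have hlim : Tendsto (fun n => ∫⁻ x, A.indicator 1 (T n x) ∂μ) atTop
        (𝓝 (∫⁻ x, A.indicator 1 (L x) ∂μ)) := by
      refine tendsto_lintegral_of_dominated_convergence (fun _ => 1)
        (fun n => (measurable_one.indicator hA).comp (T n).measurable) (fun n => ?_) (by simp) ?_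
      · exact Eventually.of_forall fun x => indicator_le_self' (fun _ _ => zero_le_one) _
      · have : ∀ᵐ x ∂μ, x ∈ G := by
          rw [ae_iff]
          exact hG0
        filter_upwards [this] with x hx
        exact tendsto_const_nhds.congr' ((hL x hx).mono fun n hn => by simp only [hn])
    have hc : ∀ n, ∫⁻ x, A.indicator 1 (T n x) ∂μ = μ A := fun n => by
      rw [(hT n).lintegral_comp (measurable_one.indicator hA), lintegral_indicator_one hA]
    simp only [hc] at hlim
    have hc' : ∫⁻ x, A.indicator 1 (L x) ∂μ = μ (L ⁻¹' A) := by
      rw [← lintegral_indicator_one (hLm hA)]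
      rfl
    rw [hc'] at hlim
    exact (tendsto_nhds_unique hlim tendsto_const_nhds)
  refine ⟨G, ⟨⟨L, R, hRL, hLR⟩, hLm, hRm⟩, hGS, ?_, hGm, hG0, hmp, hGiff, hL, hR⟩
  intro hSu
  rw [hG, hSu]
  simp [wordCore_univ]

theorem IsSwap.preimage_right {μ : Measure ℝ} {τ : ℝ ≃ᵐ ℝ} {E F : Set ℝ} (h : IsSwap μ τ E F) :
    τ ⁻¹' F = E := by
  ext x
  exact ⟨fun hx => h.invol x ▸ h.mapsF _ hx, h.mapsE x⟩

theorem IsSwap.preimage_left {μ : Measure ℝ} {τ : ℝ ≃ᵐ ℝ} {E F : Set ℝ} (h : IsSwap μ τ E F) :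
    τ ⁻¹' E = F := by
  ext x
  exact ⟨fun hx => h.invol x ▸ h.mapsE _ hx, h.mapsF x⟩

/-! ### Decompositions into cycles and the joining of cycles -/

/-- A decomposition of the line into cycles of a measure preserving map `T`. Every cycle has one base
point, in the set `B`; `b x` is the base point of the cycle of `x`. The value of `s` at a base point is
the sum of `f` over its cycle, and `g` vanishes on `B` and solves the cohomological equation for `f`
along each cycle, except for the step that returns to the base point. -/
structure TowerState (μ : Measure ℝ) (f : ℝ → ℝ) where
  T : ℝ ≃ᵐ ℝ
  mp : MeasurePreserving T μ μ
  B : Set ℝ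
  measB : MeasurableSet B
  b : ℝ → ℝ
  qmp : Measure.QuasiMeasurePreserving b μ μ
  b_mem : ∀ x, b x ∈ B
  b_of_mem : ∀ x ∈ B, b x = x
  b_T : ∀ x, b (T x) = b x
  s : ℝ → ℝ
  meas_s : Measurable s
  s_of_notMem : ∀ x, x ∉ B → s x = 0
  integrable_s : Integrable s μ
  integral_s : ∫ x, s x ∂μ = 0
  g : ℝ → ℝ
  meas_g : Measurable g
  g_of_mem : ∀ x ∈ B, g x = 0
  eq : ∀ x, f x - s (T x) = g x - g (T x)
  -- This expresses that each point is connected to its base point by steps of `T` that do not enter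
  -- `B`, without mentioning lengths of cycles. It is what turns invariance under a later map into
  -- invariance under `b`.
  saturated : ∀ J : Set ℝ, (∀ y, T y ∉ B → (y ∈ J ↔ T y ∈ J)) → ∀ x, x ∈ J ↔ b x ∈ J

namespace TowerState

variable {μ : Measure ℝ} {f : ℝ → ℝ}

theorem b_b (S : TowerState μ f) (x : ℝ) : S.b (S.b x) = S.b x := S.b_of_mem _ (S.b_mem x)

/-- The decomposition into single points. -/
def discrete (hf : Measurable f) (hi : Integrable f μ) (h0 : ∫ x, f x ∂μ = 0) : TowerState μ f where
  T := MeasurableEquiv.refl ℝ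
  mp := MeasurePreserving.id μ
  B := univ
  measB := MeasurableSet.univ
  b := id
  qmp := Measure.QuasiMeasurePreserving.id μ
  b_mem := fun _ => mem_univ _
  b_of_mem := fun _ _ => rfl
  b_T := fun _ => rfl
  s := f
  meas_s := hf
  s_of_notMem := fun x hx => absurd (mem_univ x) hx
  integrable_s := hi
  integral_s := h0
  g := 0
  meas_g := measurable_zero
  g_of_mem := fun _ _ => rfl
  eq := fun x => by simp
  saturated := fun _ _ _ => Iff.rfl

/-- The same cycles for the function `-f`. -/
def neg (S : TowerState μ f) : TowerState μ (-f) where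
  T := S.T
  mp := S.mp
  B := S.B
  measB := S.measB
  b := S.b
  qmp := S.qmp
  b_mem := S.b_mem
  b_of_mem := S.b_of_mem
  b_T := S.b_T
  s := -S.s
  meas_s := S.meas_s.neg
  s_of_notMem := fun x hx => by simp [S.s_of_notMem x hx]
  integrable_s := S.integrable_s.neg
  integral_s := by
    simp only [Pi.neg_apply, integral_neg, S.integral_s, neg_zero]
  g := -S.g
  meas_g := S.meas_g.neg
  g_of_mem := fun x hx => by simp [S.g_of_mem x hx]
  eq := fun x => by
    have := S.eq x
    simp only [Pi.neg_apply]
    linarith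
  saturated := S.saturated

/-- `S'` arises from `S` by joining cycles. -/
structure Le (S S' : TowerState μ f) : Prop where
  subset : S'.B ⊆ S.B
  -- Joining redirects only the steps that return to a base point.
  T_eq : ∀ y, S.T y ∉ S.B → S'.T y = S.T y
  b_eq : ∀ y, S'.b (S.b y) = S'.b y
  -- Along an old cycle `g` changes by a constant, namely its new value at the old base point.
  g_eq : ∀ y, S'.g y = S.g y + S'.g (S.b y)

theorem Le.refl (S : TowerState μ f) : Le S S :=
  ⟨Subset.rfl, fun _ _ => rfl, fun y => S.b_b y, fun y => by rw [S.g_of_mem _ (S.b_mem y), add_zero]⟩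

theorem Le.trans {S S' S'' : TowerState μ f} (h : Le S S') (h' : Le S' S'') : Le S S'' where
  subset := h'.subset.trans h.subset
  T_eq := fun y hy => by
    rw [h'.T_eq y, h.T_eq y hy]
    rw [h.T_eq y hy]
    exact fun hc => hy (h.subset hc)
  b_eq := fun y => by rw [← h'.b_eq, h.b_eq, h'.b_eq]
  g_eq := fun y => by
    rw [h'.g_eq y, h.g_eq y, h'.g_eq (S.b y), h.b_eq]
    ring

theorem Le.symm_eq {S S' : TowerState μ f} (h : Le S S') {z : ℝ} (hz : z ∉ S.B) :
    S'.T.symm z = S.T.symm z := by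
  rw [MeasurableEquiv.symm_apply_eq, h.T_eq _ (by simpa using hz), MeasurableEquiv.apply_symm_apply]

/-- This makes one-sided constructions symmetric: they are applied to `-f` and brought back. As `-
-f` and `f` are not syntactically equal, the state is transported along that equality. -/
theorem Le.neg {S : TowerState μ f} {S' : TowerState μ (-f)} (h : Le S.neg S') :
    ∃ S'' : TowerState μ f, Le S S'' ∧ S''.B = S'.B ∧ S''.s = -S'.s ∧ S''.b = S'.b ∧
      S''.g = -S'.g := by
  have hff : -(-f) = f := neg_neg f
  refine ⟨hff ▸ S'.neg, ?_⟩
  have key : ∀ (f' : ℝ → ℝ) (e : -(-f) = f'), (e ▸ S'.neg : TowerState μ f').B = S'.B ∧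
      (e ▸ S'.neg : TowerState μ f').s = -S'.s ∧ (e ▸ S'.neg : TowerState μ f').b = S'.b ∧
      (e ▸ S'.neg : TowerState μ f').g = -S'.g ∧ (e ▸ S'.neg : TowerState μ f').T = S'.T := by
    intro f' e
    subst e
    exact ⟨rfl, rfl, rfl, rfl, rfl⟩
  obtain ⟨k1, k2, k3, k4, k5⟩ := key f hff
  refine ⟨⟨?_, ?_, ?_, ?_⟩, k1, k2, k3, k4⟩
  · rw [k1]
    exact h.subset
  · rw [k5]
    exact h.T_eq
  · rw [k3]
    exact h.b_eq
  · rw [k4]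
    intro y
    have := h.g_eq y
    change S'.g y = -S.g y + S'.g (S.b y) at this
    simp only [Pi.neg_apply, this]
    ring

open Classical in
/-- Join each cycle based at a point `x ∈ E` with the cycle based at `τ x ∈ F`, which comes second. -/
noncomputable def glue (S : TowerState μ f) {E F : Set ℝ} {τ : ℝ ≃ᵐ ℝ} (hτ : IsSwap μ τ E F)
    (hFm : MeasurableSet F) (hE : E ⊆ S.B) (hF : F ⊆ S.B) (hEF : Disjoint E F) :
    TowerState μ f where
  -- The last point of the cycle based at `x ∈ E` is now sent to `τ x`, and the last point of the
  -- cycle based at `τ x` returns to `x`.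
  T := S.T.trans τ
  mp := hτ.mp.comp S.mp
  B := S.B \ F
  measB := S.measB.diff hFm
  b := fun x => if S.b x ∈ F then τ (S.b x) else S.b x
  qmp := by
    have hm : Measurable fun x => if x ∈ F then τ x else x :=
      τ.measurable.ite hFm measurable_id
    have hq : Measure.QuasiMeasurePreserving (fun x => if x ∈ F then τ x else x) μ μ := by
      refine ⟨hm, Measure.AbsolutelyContinuous.mk fun A hA hA0 => ?_⟩
      rw [Measure.map_apply hm hA]
      refine measure_mono_null (t := A ∪ τ ⁻¹' A) ?_ (measure_union_null hA0 ?_)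
      · intro x hx
        by_cases hxF : x ∈ F
        · rw [mem_preimage, if_pos hxF] at hx
          exact Or.inr hx
        · rw [mem_preimage, if_neg hxF] at hx
          exact Or.inl hx
      · rw [hτ.mp.measure_preimage hA.nullMeasurableSet, hA0]
    exact hq.comp S.qmp
  b_mem := fun x => by
    by_cases hx : S.b x ∈ F
    · rw [if_pos hx]
      exact ⟨hE (hτ.mapsF _ hx), disjoint_left.1 hEF (hτ.mapsF _ hx)⟩
    · rw [if_neg hx]
      exact ⟨S.b_mem x, hx⟩
  b_of_mem := fun x hx => by rw [S.b_of_mem x hx.1, if_neg hx.2]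
  b_T := fun x => by
    change (if S.b (τ (S.T x)) ∈ F then τ (S.b (τ (S.T x))) else S.b (τ (S.T x))) = _
    by_cases hE' : S.T x ∈ E
    · have h1 := hτ.mapsE _ hE'
      have h2 : S.b x = S.T x := by rw [← S.b_T, S.b_of_mem _ (hE hE')]
      rw [S.b_of_mem _ (hF h1), if_pos h1, hτ.invol, h2, if_neg (disjoint_left.1 hEF hE')]
    by_cases hF' : S.T x ∈ F
    · have h1 := hτ.mapsF _ hF'
      have h2 : S.b x = S.T x := by rw [← S.b_T, S.b_of_mem _ (hF hF')]
      rw [S.b_of_mem _ (hE h1), if_neg (disjoint_left.1 hEF h1), h2, if_pos hF']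
    · rw [hτ.fix _ hE' hF', S.b_T]
  s := fun x => S.s x + F.indicator S.s (τ x) - F.indicator S.s x
  meas_s := (S.meas_s.add ((S.meas_s.indicator hFm).comp τ.measurable)).sub
    (S.meas_s.indicator hFm)
  s_of_notMem := fun x hx => by
    by_cases hxB : x ∈ S.B
    · have hxF : x ∈ F := by
        by_contra h
        exact hx ⟨hxB, h⟩
      rw [indicator_of_mem hxF, indicator_of_notMem (disjoint_left.1 hEF (hτ.mapsF _ hxF))]
      ring
    · have h1 : x ∉ E := fun h => hxB (hE h)
      have h2 : x ∉ F := fun h => hxB (hF h)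
      rw [hτ.fix x h1 h2, indicator_of_notMem h2, S.s_of_notMem x hxB]
      ring
  integrable_s := (S.integrable_s.add (hτ.mp.integrable_comp_of_integrable
    (S.integrable_s.indicator hFm))).sub (S.integrable_s.indicator hFm)
  integral_s := by
    have hi := S.integrable_s.indicator hFm
    have hi' : Integrable (fun x => F.indicator S.s (τ x)) μ := hτ.mp.integrable_comp_of_integrable hi
    have h1 := integral_sub (S.integrable_s.add hi') hi
    have h2 := integral_add S.integrable_s hi'
    simp only [Pi.add_apply] at h1
    rw [h1, h2, hτ.mp.integral_comp τ.measurableEmbedding, S.integral_s]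
    ring
  -- At the end of the first cycle `g` has to continue instead of restarting at zero. For a point of
  -- the second cycle, `τ (S.b x)` is the base of the first one, whose sum is subtracted.
  g := fun x => if S.b x ∈ F then S.g x - S.s (τ (S.b x)) else S.g x
  meas_g := (S.meas_g.sub (S.meas_s.comp (τ.measurable.comp S.qmp.measurable))).ite
    (S.qmp.measurable hFm) S.meas_g
  g_of_mem := fun x hx => by rw [S.b_of_mem x hx.1, if_neg hx.2, S.g_of_mem x hx.1]
  eq := fun x => by
    have key := S.eq x
    change f x - (S.s (τ (S.T x)) + F.indicator S.s (τ (τ (S.T x))) - F.indicator S.s (τ (S.T x))) =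
      (if S.b x ∈ F then S.g x - S.s (τ (S.b x)) else S.g x) -
      (if S.b (τ (S.T x)) ∈ F then S.g (τ (S.T x)) - S.s (τ (S.b (τ (S.T x))))
        else S.g (τ (S.T x)))
    rw [hτ.invol]
    by_cases hE' : S.T x ∈ E
    · have h1 := hτ.mapsE _ hE'
      have h2 : S.b x = S.T x := by rw [← S.b_T, S.b_of_mem _ (hE hE')]
      have h3 := disjoint_left.1 hEF hE'
      rw [S.b_of_mem _ (hF h1), if_pos h1, hτ.invol, h2, if_neg h3, indicator_of_mem h1,
        indicator_of_notMem h3, S.g_of_mem _ (hF h1)]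
      rw [S.g_of_mem _ (hE hE')] at key
      linarith
    by_cases hF' : S.T x ∈ F
    · have h1 := hτ.mapsF _ hF'
      have h2 : S.b x = S.T x := by rw [← S.b_T, S.b_of_mem _ (hF hF')]
      have h3 := disjoint_left.1 hEF h1
      rw [S.b_of_mem _ (hE h1), if_neg h3, h2, if_pos hF', indicator_of_mem hF',
        indicator_of_notMem h3, S.g_of_mem _ (hE h1)]
      rw [S.g_of_mem _ (hF hF')] at key
      linarith
    · rw [hτ.fix _ hE' hF', S.b_T, indicator_of_notMem hF']
      split_ifs <;> linarith
  saturated := fun J hJ => by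
    change ∀ y, τ (S.T y) ∉ S.B \ F → (y ∈ J ↔ τ (S.T y) ∈ J) at hJ
    have h1 : ∀ x, x ∈ J ↔ S.b x ∈ J := by
      refine S.saturated J fun y hy => ?_
      have h2 : τ (S.T y) = S.T y := hτ.fix _ (fun h => hy (hE h)) (fun h => hy (hF h))
      have := hJ y (by rw [h2]; exact fun h => hy h.1)
      rwa [h2] at this
    intro x
    by_cases hx : S.b x ∈ F
    · rw [if_pos hx, h1 x]
      have h2 : τ (S.b x) ∈ E := hτ.mapsF _ hx
      -- The two old cycles are linked through the last point of the first one, whose new image is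
      -- the old base `S.b x` of the second.
      have h3 := hJ (S.T.symm (τ (S.b x)))
      rw [MeasurableEquiv.apply_symm_apply, hτ.invol] at h3
      rw [← h3 (fun h => h.2 hx), h1, ← S.b_T, MeasurableEquiv.apply_symm_apply,
        S.b_of_mem _ (hE h2)]
    · rw [if_neg hx, h1 x]

section glue

variable (S : TowerState μ f) {E F : Set ℝ} {τ : ℝ ≃ᵐ ℝ} (hτ : IsSwap μ τ E F)
    (hFm : MeasurableSet F) (hE : E ⊆ S.B) (hF : F ⊆ S.B) (hEF : Disjoint E F)

theorem le_glue : Le S (S.glue hτ hFm hE hF hEF) where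
  subset := sdiff_subset
  T_eq := fun y hy => hτ.fix _ (fun h => hy (hE h)) (fun h => hy (hF h))
  b_eq := fun y => by
    unfold glue
    dsimp only
    rw [S.b_b]
  g_eq := fun y => by
    unfold glue
    dsimp only
    rw [S.b_b, S.g_of_mem _ (S.b_mem y)]
    split_ifs <;> ring

theorem glue_T (x : ℝ) : (S.glue hτ hFm hE hF hEF).T x = τ (S.T x) := rfl

theorem glue_T_symm (x : ℝ) : (S.glue hτ hFm hE hF hEF).T.symm x = S.T.symm (τ x) := by
  rw [MeasurableEquiv.symm_apply_eq, glue_T, MeasurableEquiv.apply_symm_apply, hτ.invol]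

theorem glue_B : (S.glue hτ hFm hE hF hEF).B = S.B \ F := rfl

theorem glue_b_of_mem {x : ℝ} (hx : S.b x ∈ F) :
    (S.glue hτ hFm hE hF hEF).b x = τ (S.b x) := if_pos hx

theorem glue_b_of_notMem {x : ℝ} (hx : S.b x ∉ F) :
    (S.glue hτ hFm hE hF hEF).b x = S.b x := if_neg hx

theorem glue_s_of_mem_left {x : ℝ} (hx : x ∈ E) :
    (S.glue hτ hFm hE hF hEF).s x = S.s x + S.s (τ x) := by
  simp only [glue]
  rw [indicator_of_mem (hτ.mapsE x hx), indicator_of_notMem (disjoint_left.1 hEF hx), sub_zero]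

theorem glue_s_of_mem_right {x : ℝ} (hx : x ∈ F) :
    (S.glue hτ hFm hE hF hEF).s x = 0 := by
  simp only [glue]
  rw [indicator_of_mem hx, indicator_of_notMem (disjoint_left.1 hEF (hτ.mapsF x hx))]
  ring

theorem glue_s_of_notMem {x : ℝ} (hx : x ∉ E) (hx' : x ∉ F) :
    (S.glue hτ hFm hE hF hEF).s x = S.s x := by
  simp only [glue]
  rw [hτ.fix x hx hx', indicator_of_notMem hx']
  ring

theorem glue_g_of_mem {x : ℝ} (hx : S.b x ∈ F) :
    (S.glue hτ hFm hE hF hEF).g x = S.g x - S.s (τ (S.b x)) := if_pos hx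

theorem glue_g_of_notMem {x : ℝ} (hx : S.b x ∉ F) :
    (S.glue hτ hFm hE hF hEF).g x = S.g x := if_neg hx

end glue

/-- The limit of a sequence of states all of whose data are eventually constant at every point. -/
theorem exists_limit [IsFiniteMeasure μ] (S : ℕ → TowerState μ f) (hle : ∀ n, Le (S n) (S (n + 1)))
    (hT : ∀ x, ∃ y, ∀ᶠ n in atTop, (S n).T x = y)
    (hT' : ∀ x, ∃ y, ∀ᶠ n in atTop, (S n).T.symm x = y)
    (hb : ∀ x, ∃ y, ∀ᶠ n in atTop, (S n).b x = y)
    (hs : ∀ x, ∃ y, ∀ᶠ n in atTop, (S n).s x = y)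
    (hg : ∀ x, ∃ y, ∀ᶠ n in atTop, (S n).g x = y)
    (hbd : ∀ n x, |(S n).s x| ≤ |(S 0).s x|) :
    ∃ S' : TowerState μ f, (∀ n, Le (S n) S') ∧ S'.B = ⋂ n, (S n).B ∧
      (∀ x, ∀ᶠ n in atTop, (S n).b x = S'.b x) ∧ (∀ x, ∀ᶠ n in atTop, (S n).s x = S'.s x) ∧
      (∀ x, ∀ᶠ n in atTop, (S n).g x = S'.g x) := by
  have hle' : ∀ m n, m ≤ n → Le (S m) (S n) := by
    intro m n hmn
    induction n, hmn using Nat.le_induction with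
    | base => exact Le.refl _
    | succ n _ ih => exact ih.trans (hle n)
  obtain ⟨G, L, -, hGu, -, -, hLmp, -, hL, hL'⟩ := exists_limit_equiv (μ := μ) (fun n => (S n).T)
    (fun n => (S n).mp) MeasurableSet.univ (by simp) (fun x _ => hT x) (fun x _ => hT' x)
  rw [hGu rfl] at hL hL'
  replace hL := fun x => hL x (mem_univ x)
  choose b hb using hb
  choose s hs using hs
  choose g hg using hg
  have hev : ∀ (u : ℕ → ℝ → ℝ) (v : ℝ → ℝ), (∀ n, Measurable (u n)) →
      (∀ x, ∀ᶠ n in atTop, u n x = v x) → Measurable v := fun u v hu huv =>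
    measurable_of_tendsto_metrizable hu (tendsto_pi_nhds.2 fun x =>
      tendsto_const_nhds.congr' ((huv x).mono fun n hn => hn.symm))
  have hbm : Measurable b := hev _ _ (fun n => (S n).qmp.measurable) hb
  have hsm : Measurable s := hev _ _ (fun n => (S n).meas_s) hs
  have hgm : Measurable g := hev _ _ (fun n => (S n).meas_g) hg
  have hbB : ∀ x, b x ∈ ⋂ n, (S n).B := by
    refine fun x => mem_iInter.2 fun m => ?_
    obtain ⟨n, hn, hmn⟩ := ((hb x).and (eventually_ge_atTop m)).exists
    exact (hle' m n hmn).subset (hn ▸ (S n).b_mem x)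
  have hnB : ∀ x, x ∉ ⋂ n, (S n).B → ∀ᶠ n in atTop, x ∉ (S n).B := by
    intro x hx
    simp only [mem_iInter, not_forall] at hx
    obtain ⟨m, hm⟩ := hx
    filter_upwards [eventually_ge_atTop m] with n hn h
    exact hm ((hle' m n hn).subset h)
  have hTL : ∀ n y, (S n).T y ∉ (S n).B → L y = (S n).T y := by
    intro n y hy
    obtain ⟨m, hm, hmn⟩ := ((hL y).and (eventually_ge_atTop n)).exists
    rw [← hm, (hle' n m hmn).T_eq y hy]
  -- The bound by the initial sums gives domination, so the limit sum also has integral zero.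
  have hdom : Tendsto (fun n => ∫ x, (S n).s x ∂μ) atTop (𝓝 (∫ x, s x ∂μ)) := by
    refine tendsto_integral_of_dominated_convergence (fun x => |(S 0).s x|)
      (fun n => (S n).meas_s.aestronglyMeasurable) (S 0).integrable_s.abs
      (fun n => Eventually.of_forall fun x => hbd n x) (Eventually.of_forall fun x => ?_)
    exact tendsto_const_nhds.congr' ((hs x).mono fun n hn => hn.symm)
  let S' : TowerState μ f :=
    { T := L
      mp := hLmp
      B := ⋂ n, (S n).B
      measB := MeasurableSet.iInter fun n => (S n).measB
      b := b
      qmp := by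
        refine ⟨hbm, Measure.AbsolutelyContinuous.mk fun A hA hA0 => ?_⟩
        rw [Measure.map_apply hbm hA]
        refine measure_mono_null (t := ⋃ n, (S n).b ⁻¹' A) ?_
          (measure_iUnion_null fun n => (S n).qmp.preimage_null hA0)
        intro x hx
        obtain ⟨n, hn⟩ := (hb x).exists
        exact mem_iUnion.2 ⟨n, by rw [mem_preimage, hn]; exact hx⟩
      b_mem := hbB
      b_of_mem := fun x hx => by
        obtain ⟨n, hn⟩ := (hb x).exists
        rw [← hn, (S n).b_of_mem x (mem_iInter.1 hx n)]
      b_T := fun x => by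
        obtain ⟨n, ⟨hn1, hn2⟩, hn3⟩ := (((hb x).and (hb (L x))).and (hL x)).exists
        rw [← hn2, ← hn3, (S n).b_T, hn1]
      s := s
      meas_s := hsm
      s_of_notMem := fun x hx => by
        obtain ⟨n, hn1, hn2⟩ := ((hs x).and (hnB x hx)).exists
        rw [← hn1, (S n).s_of_notMem x hn2]
      integrable_s := by
        refine (S 0).integrable_s.mono hsm.aestronglyMeasurable (Eventually.of_forall fun x => ?_)
        obtain ⟨n, hn⟩ := (hs x).exists
        rw [← hn]
        exact hbd n x
      integral_s := by
        refine tendsto_nhds_unique hdom ?_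
        simp only [(S _).integral_s]
        exact tendsto_const_nhds
      g := g
      meas_g := hgm
      g_of_mem := fun x hx => by
        obtain ⟨n, hn⟩ := (hg x).exists
        rw [← hn, (S n).g_of_mem x (mem_iInter.1 hx n)]
      eq := fun x => by
        obtain ⟨n, ⟨⟨hn1, hn2⟩, hn3⟩, hn4⟩ :=
          ((((hs (L x)).and (hg x)).and (hg (L x))).and (hL x)).exists
        have := (S n).eq x
        rw [hn4] at this
        rw [hn1, hn2, hn3] at this
        exact this
      saturated := fun J hJ x => by
        obtain ⟨n, hn⟩ := (hb x).exists
        rw [← hn]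
        refine (S n).saturated J (fun y hy => ?_) x
        have := hJ y (by
          rw [hTL n y hy]
          exact fun h => hy (mem_iInter.1 h n))
        rwa [hTL n y hy] at this }
  refine ⟨S', fun n => ⟨iInter_subset _ n, hTL n, fun y => ?_, fun y => ?_⟩, rfl, hb, hs, hg⟩
  · obtain ⟨m, ⟨hm1, hm2⟩, hm⟩ :=
      (((hb y).and (hb ((S n).b y))).and (eventually_ge_atTop n)).exists
    change b ((S n).b y) = b y
    rw [← hm1, ← hm2, (hle' n m hm).b_eq]
  · obtain ⟨m, ⟨hm1, hm2⟩, hm⟩ :=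
      (((hg y).and (hg ((S n).b y))).and (eventually_ge_atTop n)).exists
    change g y = (S n).g y + g ((S n).b y)
    rw [← hm1, ← hm2, (hle' n m hm).g_eq]

end TowerState

/-! ### Absorption of negative cycles by large positive ones -/

theorem exists_eventually_eq_of_succ {α : Type*} {u : ℕ → α} (h : ∀ᶠ n in atTop, u (n + 1) = u n) :
    ∃ y, ∀ᶠ n in atTop, u n = y := by
  obtain ⟨m, hm⟩ := eventually_atTop.1 h
  refine ⟨u m, eventually_atTop.2 ⟨m, fun n hn => ?_⟩⟩
  induction n, hn using Nat.le_induction with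
  | base => rfl
  | succ n hn ih => rw [hm n hn, ih]

/-- Two disjoint sets contain, up to null sets, exchangeable subsets one of which is everything. -/
theorem exists_isSwap_subset {μ : Measure ℝ} [IsFiniteMeasure μ] [NullSingletonClass μ] {P N : Set ℝ}
    (hP : MeasurableSet P) (hN : MeasurableSet N) (hPN : Disjoint P N) :
    ∃ E ⊆ P, ∃ F ⊆ N, ∃ τ : ℝ ≃ᵐ ℝ, MeasurableSet E ∧ MeasurableSet F ∧
      (μ (P \ E) = 0 ∨ μ (N \ F) = 0) ∧ IsSwap μ τ E F := by
  rcases le_total (μ.real P) (μ.real N) with h | h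
  · obtain ⟨N', hN', hN'm, hN'e⟩ := exists_subset_measureReal_eq (μ := μ) hN measureReal_nonneg h
    obtain ⟨E, hE, F, hF, τ, hEm, hFm, h0, -, hτ⟩ :=
      exists_isSwap (μ := μ) hP hN'm (hPN.mono_right hN') hN'e.symm
    exact ⟨E, hE, F, hF.trans hN', τ, hEm, hFm, Or.inl h0, hτ⟩
  · obtain ⟨P', hP', hP'm, hP'e⟩ := exists_subset_measureReal_eq (μ := μ) hP measureReal_nonneg h
    obtain ⟨E, hE, F, hF, τ, hEm, hFm, -, h0, hτ⟩ :=
      exists_isSwap (μ := μ) hP'm hN (hPN.mono_left hP') hP'e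
    exact ⟨E, hE.trans hP', F, hF, τ, hEm, hFm, Or.inr h0, hτ⟩

namespace TowerState

variable {μ : Measure ℝ} {f : ℝ → ℝ}

/-- The cycles with sum above `t`. -/
def above (S : TowerState μ f) (t : ℝ) : Set ℝ := {x | t < S.s x}

/-- The cycles with sum in `[-β, -c)`. -/
def between (S : TowerState μ f) (c β : ℝ) : Set ℝ := {x | -β ≤ S.s x ∧ S.s x < -c}

theorem measurableSet_above (S : TowerState μ f) (t : ℝ) : MeasurableSet (S.above t) :=
  measurableSet_lt measurable_const S.meas_s

theorem measurableSet_between (S : TowerState μ f) (c β : ℝ) : MeasurableSet (S.between c β) :=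
  (measurableSet_le measurable_const S.meas_s).inter (measurableSet_lt S.meas_s measurable_const)

theorem above_subset (S : TowerState μ f) {t : ℝ} (ht : 0 ≤ t) : S.above t ⊆ S.B := by
  intro x hx
  by_contra h
  have h1 : t < S.s x := hx
  rw [S.s_of_notMem x h] at h1
  linarith

theorem between_subset (S : TowerState μ f) {c : ℝ} (hc : 0 < c) (β : ℝ) :
    S.between c β ⊆ S.B := by
  intro x hx
  by_contra h
  have h1 : S.s x < -c := hx.2
  rw [S.s_of_notMem x h] at h1
  linarith

theorem disjoint_above_between (S : TowerState μ f) {c t : ℝ} (hc : 0 < c) (ht : 0 ≤ t) (β : ℝ) :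
    Disjoint (S.above t) (S.between c β) := by
  rw [disjoint_left]
  intro x (hx : t < S.s x) hx'
  have h1 : S.s x < -c := hx'.2
  linarith

variable [IsFiniteMeasure μ] [NullSingletonClass μ]

theorem exists_absorb_step (S : TowerState μ f) {c t : ℝ} (hc : 0 < c) (ht : 0 ≤ t) (β : ℝ) :
    ∃ (E F : Set ℝ) (τ : ℝ ≃ᵐ ℝ), E ⊆ S.above t ∧ F ⊆ S.between c β ∧ MeasurableSet E ∧
      MeasurableSet F ∧ (μ (S.above t \ E) = 0 ∨ μ (S.between c β \ F) = 0) ∧ IsSwap μ τ E F := by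
  obtain ⟨E, hE, F, hF, τ, h⟩ := exists_isSwap_subset (μ := μ) (S.measurableSet_above t)
    (S.measurableSet_between c β) (S.disjoint_above_between hc ht β)
  exact ⟨E, F, τ, hE, hF, h⟩

/-- Cycles with sum above `t` absorb cycles with sum in `[-β, -c)` until their sum is at most `t`. -/
theorem exists_absorb (S : TowerState μ f) {c β γ t : ℝ} (hc : 0 < c) (hβ : 0 < β) (hγ : 0 ≤ γ)
    (hβt : β ≤ t - γ)
    (hD : ∫ x in S.above t, (S.s x - γ) ∂μ ≤ ∫ x in S.between c β, -S.s x ∂μ) :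
    ∃ S' : TowerState μ f, Le S S' ∧ (∀ᵐ x ∂μ, S'.s x ≤ t) ∧
      (∀ x, x ∉ S.above t → x ∉ S.between c β → S'.s x = S.s x) ∧
      (∀ x ∈ S.above t, t - β ≤ S'.s x ∧ S'.s x ≤ S.s x) ∧
      (∀ x ∈ S.between c β, S'.s x = S.s x ∨ S'.s x = 0) ∧
      (∀ x ∈ S.B, (S'.b x = x ∧ S'.g x = 0) ∨ (x ∈ S.between c β ∧ x ∉ S'.B ∧
        S'.b x ∈ S.above t ∧ |S'.g x| ≤ S.s (S'.b x))) ∧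
      (∀ u : ℝ → ENNReal, Measurable u → ∫⁻ x in S.between c β \ S'.B, u (S'.b x) ∂μ ≤
        ∫⁻ x in S.above t, u x * ENNReal.ofReal (S.s x / c) ∂μ) := by
  have ht : 0 ≤ t := by linarith
  choose E F τ hEP hFN hEm hFm hEF0 hτ using
    fun S : TowerState μ f => S.exists_absorb_step hc ht β
  have hEB : ∀ S, E S ⊆ S.B := fun S => (hEP S).trans (S.above_subset ht)
  have hFB : ∀ S, F S ⊆ S.B := fun S => (hFN S).trans (S.between_subset hc β)
  have hEFd : ∀ S, Disjoint (E S) (F S) := fun S =>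
    (S.disjoint_above_between hc ht β).mono (hEP S) (hFN S)
  -- The greedy step is iterated. In each round one of the two sides is used up to a null set.
  obtain ⟨Sq, hSq0, hSq⟩ : ∃ Sq : ℕ → TowerState μ f, Sq 0 = S ∧ ∀ n, Sq (n + 1) =
      (Sq n).glue (hτ (Sq n)) (hFm (Sq n)) (hEB (Sq n)) (hFB (Sq n)) (hEFd (Sq n)) :=
    ⟨fun n => Nat.rec S (fun _ R => R.glue (hτ R) (hFm R) (hEB R) (hFB R) (hEFd R)) n, rfl,
      fun _ => rfl⟩
  have hle : ∀ n, Le (Sq n) (Sq (n + 1)) := fun n => by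
    rw [hSq]
    exact le_glue _ _ _ _ _ _
  set P := S.above t with hP
  set N := S.between c β with hN
  have hPN : Disjoint P N := S.disjoint_above_between hc ht β
  have hPB : P ⊆ S.B := S.above_subset ht
  -- the values of `s` along the sequence
  have hinv : ∀ n, (∀ x, x ∉ P → x ∉ N → (Sq n).s x = S.s x) ∧
      (∀ x ∈ N, ((Sq n).s x = S.s x ∧ x ∈ (Sq n).B) ∨ ((Sq n).s x = 0 ∧ x ∉ (Sq n).B)) ∧
      (∀ x ∈ P, x ∈ (Sq n).B ∧ t - β ≤ (Sq n).s x ∧ (Sq n).s x ≤ S.s x) ∧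
      (Sq n).above t ⊆ P ∧ (Sq n).between c β ⊆ N := by
    intro n
    induction n with
    | zero =>
      rw [hSq0]
      refine ⟨fun _ _ _ => rfl, fun x hx => Or.inl ⟨rfl, S.between_subset hc β hx⟩, fun x hx =>
        ⟨hPB hx, ?_, le_rfl⟩, Subset.rfl, Subset.rfl⟩
      have h1 : t < S.s x := hx
      linarith
    | succ n ih =>
      obtain ⟨i1, i2, i3, i4, i5⟩ := ih
      have hE' : E (Sq n) ⊆ P := (hEP _).trans i4
      have hF' : F (Sq n) ⊆ N := (hFN _).trans i5
      have j1 : ∀ x, x ∉ P → x ∉ N → (Sq (n + 1)).s x = S.s x := fun x hx hx' => by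
        rw [hSq, glue_s_of_notMem _ _ _ _ _ _ (fun h => hx (hE' h)) (fun h => hx' (hF' h)),
          i1 x hx hx']
      have j2 : ∀ x ∈ N, ((Sq (n + 1)).s x = S.s x ∧ x ∈ (Sq (n + 1)).B) ∨
          ((Sq (n + 1)).s x = 0 ∧ x ∉ (Sq (n + 1)).B) := fun x hx => by
        by_cases hxF : x ∈ F (Sq n)
        · right
          exact ⟨by rw [hSq, glue_s_of_mem_right _ _ _ _ _ _ hxF],
            by rw [hSq, glue_B]; exact fun h => h.2 hxF⟩
        · have hxE : x ∉ E (Sq n) := fun h => disjoint_left.1 hPN (hE' h) hx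
          rw [hSq, glue_s_of_notMem _ _ _ _ _ _ hxE hxF, glue_B]
          rcases i2 x hx with h | h
          · exact Or.inl ⟨h.1, h.2, hxF⟩
          · exact Or.inr ⟨h.1, fun h' => h.2 h'.1⟩
      have j3 : ∀ x ∈ P, x ∈ (Sq (n + 1)).B ∧ t - β ≤ (Sq (n + 1)).s x ∧
          (Sq (n + 1)).s x ≤ S.s x := fun x hx => by
        have hxF : x ∉ F (Sq n) := fun h => disjoint_left.1 hPN hx (hF' h)
        obtain ⟨k1, k2, k3⟩ := i3 x hx
        refine ⟨by rw [hSq, glue_B]; exact ⟨k1, hxF⟩, ?_⟩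
        by_cases hxE : x ∈ E (Sq n)
        · rw [hSq, glue_s_of_mem_left _ _ _ _ _ _ hxE]
          have h1 : t < (Sq n).s x := hEP _ hxE
          have h2 := hFN _ ((hτ (Sq n)).mapsE x hxE)
          have h3 : -β ≤ (Sq n).s (τ (Sq n) x) := h2.1
          have h4 : (Sq n).s (τ (Sq n) x) < -c := h2.2
          constructor <;> linarith
        · rw [hSq, glue_s_of_notMem _ _ _ _ _ _ hxE hxF]
          exact ⟨k2, k3⟩
      refine ⟨j1, j2, j3, ?_, ?_⟩
      · intro x (hx : t < (Sq (n + 1)).s x)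
        by_contra hxP
        by_cases hxN : x ∈ N
        · have h1 : S.s x < -c := hxN.2
          rcases j2 x hxN with h | h
          · rw [h.1] at hx
            linarith
          · rw [h.1] at hx
            linarith
        · rw [j1 x hxP hxN] at hx
          exact hxP hx
      · intro x hx
        have h1 : -β ≤ (Sq (n + 1)).s x := hx.1
        have h2 : (Sq (n + 1)).s x < -c := hx.2
        by_contra hxN
        by_cases hxP : x ∈ P
        · have := (j3 x hxP).2.1
          linarith
        · rw [j1 x hxP hxN] at h1 h2
          exact hxN ⟨h1, h2⟩
  have hEP' : ∀ n, E (Sq n) ⊆ P := fun n => (hEP _).trans (hinv n).2.2.2.1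
  have hFN' : ∀ n, F (Sq n) ⊆ N := fun n => (hFN _).trans (hinv n).2.2.2.2
  have hPF : ∀ n x, x ∈ P → x ∉ F (Sq n) := fun n x hx h => disjoint_left.1 hPN hx (hFN' n h)
  have hstep : ∀ n x, x ∈ E (Sq n) → (Sq (n + 1)).s x ≤ (Sq n).s x - c := by
    intro n x hx
    rw [hSq, glue_s_of_mem_left _ _ _ _ _ _ hx]
    have h4 : (Sq n).s (τ (Sq n) x) < -c := (hFN _ ((hτ (Sq n)).mapsE x hx)).2
    linarith
  have hanti : ∀ n x, x ∈ P → (Sq (n + 1)).s x ≤ (Sq n).s x := by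
    intro n x hx
    by_cases hxE : x ∈ E (Sq n)
    · linarith [hstep n x hxE]
    · rw [hSq, glue_s_of_notMem _ _ _ _ _ _ hxE (hPF n x hx)]
  -- The sum at `x` is nonincreasing and bounded below by `t - β`, and drops by at least `c`
  -- whenever `x` absorbs a cycle. So this happens only finitely often.
  have hevE : ∀ x, ∀ᶠ n in atTop, x ∉ E (Sq n) := by
    intro x
    by_cases hx : x ∈ P
    · have hmono : Antitone fun n => (Sq n).s x := antitone_nat_of_succ_le fun n => hanti n x hx
      have hbdd : BddBelow (range fun n => (Sq n).s x) :=
        ⟨t - β, by rintro _ ⟨n, rfl⟩; exact ((hinv n).2.2.1 x hx).2.1⟩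
      have hlim := tendsto_atTop_ciInf hmono hbdd
      have hlim2 := hlim.sub (hlim.comp (tendsto_add_atTop_nat 1))
      rw [sub_self] at hlim2
      filter_upwards [hlim2.eventually_lt_const hc] with n hn hxE
      have := hstep n x hxE
      simp only [Function.comp_apply] at hn
      linarith
    · exact Eventually.of_forall fun n h => hx (hEP' n h)
  have hB : ∀ m n, m ≤ n → (Sq n).B ⊆ (Sq m).B := by
    intro m n hmn
    induction n, hmn using Nat.le_induction with
    | base => exact Subset.rfl
    | succ n _ ih => exact (hle n).subset.trans ih
  -- An absorbed base point leaves the base set for good.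
  have hevF : ∀ x, ∀ᶠ n in atTop, x ∉ F (Sq n) := by
    intro x
    by_cases hx : ∃ n, x ∈ F (Sq n)
    · obtain ⟨m, hm⟩ := hx
      filter_upwards [eventually_ge_atTop (m + 1)] with n hn h
      have := hB (m + 1) n hn (hFB _ h)
      rw [hSq, glue_B] at this
      exact this.2 hm
    · push Not at hx
      exact Eventually.of_forall hx
  have hcT' : ∀ x, ∃ y, ∀ᶠ n in atTop, (Sq n).T.symm x = y := by
    refine fun x => exists_eventually_eq_of_succ ?_
    filter_upwards [hevE x, hevF x] with n h1 h2
    rw [hSq, glue_T_symm, (hτ (Sq n)).fix x h1 h2]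
  have hcs : ∀ x, ∃ y, ∀ᶠ n in atTop, (Sq n).s x = y := by
    refine fun x => exists_eventually_eq_of_succ ?_
    filter_upwards [hevE x, hevF x] with n h1 h2
    rw [hSq, glue_s_of_notMem _ _ _ _ _ _ h1 h2]
  -- Once `T x` leaves the base it is frozen. If it never leaves, it never lies in `E`, since the
  -- swap would send it to `F` and out of the base; and a visit to `F` moves it into `P`, away from
  -- all later sets `F`.
  have hcT : ∀ x, ∃ y, ∀ᶠ n in atTop, (Sq n).T x = y := by
    refine fun x => exists_eventually_eq_of_succ ?_
    by_cases h : ∃ n, (Sq n).T x ∉ (Sq n).B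
    · obtain ⟨m, hm⟩ := h
      have : ∀ n, m ≤ n → (Sq n).T x ∉ (Sq n).B := by
        intro n hn
        induction n, hn using Nat.le_induction with
        | base => exact hm
        | succ n _ ih =>
          rw [(hle n).T_eq x ih]
          exact fun h => ih ((hle n).subset h)
      filter_upwards [eventually_ge_atTop m] with n hn
      exact (hle n).T_eq x (this n hn)
    · push Not at h
      have hnE : ∀ n, (Sq n).T x ∉ E (Sq n) := by
        intro n hn
        have h1 := h (n + 1)
        rw [hSq, glue_T, glue_B] at h1
        exact h1.2 ((hτ (Sq n)).mapsE _ hn)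
      by_cases h' : ∃ n, (Sq n).T x ∈ F (Sq n)
      · obtain ⟨m, hm⟩ := h'
        have : ∀ n, m + 1 ≤ n → (Sq n).T x ∈ P := by
          intro n hn
          induction n, hn using Nat.le_induction with
          | base =>
            rw [hSq, glue_T]
            exact hEP' m ((hτ (Sq m)).mapsF _ hm)
          | succ n _ ih =>
            rw [hSq, glue_T, (hτ (Sq n)).fix _ (hnE n) (hPF n _ ih)]
            exact ih
        filter_upwards [eventually_ge_atTop (m + 1)] with n hn
        rw [hSq, glue_T, (hτ (Sq n)).fix _ (hnE n) (hPF n _ (this n hn))]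
      · push Not at h'
        refine Eventually.of_forall fun n => ?_
        rw [hSq, glue_T, (hτ (Sq n)).fix _ (hnE n) (h' n)]
  have hevb : ∀ x, ∀ᶠ n in atTop, (Sq n).b x ∉ F (Sq n) := by
    intro x
    by_cases h' : ∃ n, (Sq n).b x ∈ F (Sq n)
    · obtain ⟨m, hm⟩ := h'
      have : ∀ n, m + 1 ≤ n → (Sq n).b x ∈ P := by
        intro n hn
        induction n, hn using Nat.le_induction with
        | base =>
          rw [hSq, glue_b_of_mem _ _ _ _ _ _ hm]
          exact hEP' m ((hτ (Sq m)).mapsF _ hm)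
        | succ n _ ih =>
          rw [hSq, glue_b_of_notMem _ _ _ _ _ _ (hPF n _ ih)]
          exact ih
      filter_upwards [eventually_ge_atTop (m + 1)] with n hn
      exact hPF n _ (this n hn)
    · push Not at h'
      exact Eventually.of_forall h'
  have hcb : ∀ x, ∃ y, ∀ᶠ n in atTop, (Sq n).b x = y := by
    refine fun x => exists_eventually_eq_of_succ ?_
    filter_upwards [hevb x] with n hn
    rw [hSq, glue_b_of_notMem _ _ _ _ _ _ hn]
  have hcg : ∀ x, ∃ y, ∀ᶠ n in atTop, (Sq n).g x = y := by
    refine fun x => exists_eventually_eq_of_succ ?_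
    filter_upwards [hevb x] with n hn
    rw [hSq, glue_g_of_notMem _ _ _ _ _ _ hn]
  have hbd : ∀ n x, |(Sq n).s x| ≤ |(Sq 0).s x| := by
    intro n x
    rw [hSq0]
    by_cases hxP : x ∈ P
    · have h1 := (hinv n).2.2.1 x hxP
      rw [abs_of_nonneg (by linarith), abs_of_nonneg (by linarith)]
      exact h1.2.2
    by_cases hxN : x ∈ N
    · rcases (hinv n).2.1 x hxN with h | h
      · rw [h.1]
      · rw [h.1, abs_zero]
        exact abs_nonneg _
    · rw [(hinv n).1 x hxP hxN]
  obtain ⟨S', hSS', hS'B, hS'b, hS's, hS'g⟩ := exists_limit Sq hle hcT hcT' hcb hcs hcg hbd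
  have hkey : ∀ n, ∀ x ∈ S.B, ((Sq n).b x = x ∧ (Sq n).g x = 0) ∨ (x ∈ N ∧ x ∉ (Sq n).B ∧
      (Sq n).b x ∈ P ∧ |(Sq n).g x| ≤ S.s ((Sq n).b x)) := by
    intro n x hx
    induction n with
    | zero =>
      rw [hSq0]
      exact Or.inl ⟨S.b_of_mem x hx, S.g_of_mem x hx⟩
    | succ n ih =>
      by_cases hxF : (Sq n).b x ∈ F (Sq n)
      · right
        rcases ih with ⟨h1, h2⟩ | ⟨h1, h2, h3, h4⟩
        · rw [hSq, glue_b_of_mem _ _ _ _ _ _ hxF, glue_g_of_mem _ _ _ _ _ _ hxF, glue_B, h1, h2]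
          rw [h1] at hxF
          have h3 := (hτ (Sq n)).mapsF _ hxF
          refine ⟨hFN' n hxF, fun h => h.2 hxF, hEP' n h3, ?_⟩
          have h4 : t < (Sq n).s (τ (Sq n) x) := hEP _ h3
          rw [zero_sub, abs_neg, abs_of_nonneg (by linarith)]
          exact ((hinv n).2.2.1 _ (hEP' n h3)).2.2
        · exact absurd hxF (hPF n _ h3)
      · rw [hSq, glue_b_of_notMem _ _ _ _ _ _ hxF, glue_g_of_notMem _ _ _ _ _ _ hxF, glue_B]
        rcases ih with h | ⟨h1, h2, h3, h4⟩
        · exact Or.inl h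
        · exact Or.inr ⟨h1, fun h => h2 h.1, h3, h4⟩
  refine ⟨S', hSq0 ▸ hSS' 0, ?_, ?_, ?_, ?_, ?_, ?_⟩
  · -- no cycle with sum above `t` is left
    have hDn : ∀ n, ∫ x, ((Sq n).above t).indicator (fun x => (Sq n).s x - γ) x ∂μ ≤
        ∫ x, ((Sq n).between c β).indicator (fun x => -(Sq n).s x) x ∂μ := by
      intro n
      induction n with
      | zero =>
        rw [hSq0, integral_indicator (measurableSet_above _ _), integral_indicator
          (measurableSet_between _ _ _)]
        exact hD
      | succ n ih =>
        have iu : ∀ n, Integrable (((Sq n).above t).indicator (fun x => (Sq n).s x - γ)) μ :=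
          fun n => ((Sq n).integrable_s.sub (integrable_const _)).indicator (measurableSet_above _ _)
        have iv : ∀ n, Integrable (((Sq n).between c β).indicator (fun x => -(Sq n).s x)) μ :=
          fun n => (Sq n).integrable_s.neg.indicator (measurableSet_between _ _ _)
        have iF := (Sq n).integrable_s.indicator (hFm (Sq n))
        have iF' : Integrable (fun x => (F (Sq n)).indicator (Sq n).s (τ (Sq n) x)) μ :=
          (hτ (Sq n)).mp.integrable_comp_of_integrable iF
        have hF' : ∫ x, (F (Sq n)).indicator (Sq n).s (τ (Sq n) x) ∂μ =
            ∫ x, (F (Sq n)).indicator (Sq n).s x ∂μ :=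
          (hτ (Sq n)).mp.integral_comp (τ (Sq n)).measurableEmbedding _
        -- An absorbed value `v` lowers the excess on the left by at least `|v|`. If the cycle stays
        -- above `t` it loses exactly that; otherwise it loses more than `t - γ`, which is at least
        -- `β` and hence at least `|v|`. The supply on the right falls by exactly the total of the
        -- `|v|`, so the inequality persists.
        have h1 : ∫ x, ((Sq (n + 1)).above t).indicator (fun x => (Sq (n + 1)).s x - γ) x ∂μ ≤
            ∫ x, (((Sq n).above t).indicator (fun x => (Sq n).s x - γ) x +
              (F (Sq n)).indicator (Sq n).s (τ (Sq n) x)) ∂μ := by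
          refine integral_mono (iu _) ((iu n).add iF') fun x => ?_
          by_cases hxE : x ∈ E (Sq n)
          · have h2 := (hτ (Sq n)).mapsE x hxE
            have h3 : -β ≤ (Sq n).s (τ (Sq n) x) := (hFN _ h2).1
            have h4 : t < (Sq n).s x := hEP _ hxE
            simp only
            rw [indicator_of_mem (hEP _ hxE), indicator_of_mem h2]
            by_cases h5 : x ∈ (Sq (n + 1)).above t
            · rw [indicator_of_mem h5, hSq, glue_s_of_mem_left _ _ _ _ _ _ hxE]
              linarith
            · rw [indicator_of_notMem h5]
              linarith
          · have h2 : τ (Sq n) x ∉ F (Sq n) := fun h => hxE ((hτ (Sq n)).preimage_right ▸ h)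
            simp only
            rw [indicator_of_notMem h2, add_zero]
            by_cases hxF : x ∈ F (Sq n)
            · have h3 : x ∉ (Sq (n + 1)).above t := fun h =>
                hPF n x ((hinv (n + 1)).2.2.2.1 h) hxF
              have h4 : x ∉ (Sq n).above t := fun h => hPF n x ((hinv n).2.2.2.1 h) hxF
              rw [indicator_of_notMem h3, indicator_of_notMem h4]
            · have h3 : (Sq (n + 1)).s x = (Sq n).s x := by
                rw [hSq, glue_s_of_notMem _ _ _ _ _ _ hxE hxF]
              have h4 : x ∈ (Sq (n + 1)).above t ↔ x ∈ (Sq n).above t := by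
                change t < _ ↔ t < _
                rw [h3]
              by_cases h5 : x ∈ (Sq n).above t
              · rw [indicator_of_mem h5, indicator_of_mem (h4.2 h5), h3]
              · rw [indicator_of_notMem h5, indicator_of_notMem (fun h => h5 (h4.1 h))]
        have h2 : ∫ x, ((Sq (n + 1)).between c β).indicator (fun x => -(Sq (n + 1)).s x) x ∂μ =
            ∫ x, (((Sq n).between c β).indicator (fun x => -(Sq n).s x) x +
              (F (Sq n)).indicator (Sq n).s x) ∂μ := by
          congr 1
          funext x
          by_cases hxF : x ∈ F (Sq n)
          · rw [indicator_of_mem (hFN _ hxF), indicator_of_mem hxF, indicator_of_notMem]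
            · ring
            · intro h
              have h1 : (Sq (n + 1)).s x < -c := h.2
              rw [hSq, glue_s_of_mem_right _ _ _ _ _ _ hxF] at h1
              linarith
          · rw [indicator_of_notMem hxF, add_zero]
            by_cases hxE : x ∈ E (Sq n)
            · have h3 : x ∉ (Sq (n + 1)).between c β := fun h =>
                disjoint_left.1 hPN (hEP' n hxE) ((hinv (n + 1)).2.2.2.2 h)
              have h4 : x ∉ (Sq n).between c β := fun h =>
                disjoint_left.1 hPN (hEP' n hxE) ((hinv n).2.2.2.2 h)
              rw [indicator_of_notMem h3, indicator_of_notMem h4]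
            · have h3 : (Sq (n + 1)).s x = (Sq n).s x := by
                rw [hSq, glue_s_of_notMem _ _ _ _ _ _ hxE hxF]
              have h4 : x ∈ (Sq (n + 1)).between c β ↔ x ∈ (Sq n).between c β := by
                change _ ∧ _ ↔ _ ∧ _
                rw [h3]
              by_cases h5 : x ∈ (Sq n).between c β
              · rw [indicator_of_mem h5, indicator_of_mem (h4.2 h5), h3]
              · rw [indicator_of_notMem h5, indicator_of_notMem (fun h => h5 (h4.1 h))]
        rw [integral_add (iu n) iF', hF'] at h1
        rw [integral_add (iv n) iF] at h2
        linarith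
    have hdec : ∀ n, S'.above t ⊆ (Sq n).above t := by
      intro n x (hx : t < S'.s x)
      obtain ⟨m, hm, hmn⟩ := ((hS's x).and (eventually_ge_atTop n)).exists
      have hxP : x ∈ P := (hinv m).2.2.2.1 (show t < (Sq m).s x by rw [hm]; exact hx)
      have : Antitone fun n => (Sq n).s x := antitone_nat_of_succ_le fun n => hanti n x hxP
      have h1 : (Sq m).s x ≤ (Sq n).s x := this hmn
      change t < (Sq n).s x
      rw [← hm] at hx
      linarith
    -- If cycles above `t` survived on a set of positive measure, at some stage the supply would
    -- have been the side that ran out. The invariant `hDn` would then bound the excess by zero,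
    -- although each surviving cycle contributes more than `t - γ > 0`.
    have hnull : μ (S'.above t) = 0 := by
      by_contra hne
      have hex : ∃ n, μ ((Sq n).above t \ E (Sq n)) ≠ 0 := by
        by_contra hcon
        push Not at hcon
        refine hne (measure_mono_null (t := ⋃ n, (Sq n).above t \ E (Sq n)) ?_
          (measure_iUnion_null hcon))
        intro x hx
        obtain ⟨n, hn⟩ := (hevE x).exists
        exact mem_iUnion.2 ⟨n, hdec n hx, hn⟩
      obtain ⟨n, hn⟩ := hex
      have hN0 : μ ((Sq n).between c β \ F (Sq n)) = 0 := (hEF0 (Sq n)).resolve_left hn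
      have hN1 : μ ((Sq (n + 1)).between c β) = 0 := by
        refine measure_mono_null ?_ hN0
        intro x hx
        have h1 : -β ≤ (Sq (n + 1)).s x := hx.1
        have h2 : (Sq (n + 1)).s x < -c := hx.2
        have hxF : x ∉ F (Sq n) := by
          intro h
          rw [hSq, glue_s_of_mem_right _ _ _ _ _ _ h] at h2
          linarith
        have hxE : x ∉ E (Sq n) := fun h =>
          disjoint_left.1 hPN (hEP' n h) ((hinv (n + 1)).2.2.2.2 hx)
        rw [hSq, glue_s_of_notMem _ _ _ _ _ _ hxE hxF] at h1 h2
        exact ⟨⟨h1, h2⟩, hxF⟩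
      have h1 := hDn (n + 1)
      rw [integral_indicator (measurableSet_above _ _), integral_indicator
        (measurableSet_between _ _ _), Measure.restrict_eq_zero.2 hN1, integral_zero_measure] at h1
      have h2 : μ.real ((Sq (n + 1)).above t) * (t - γ) ≤
          ∫ x in (Sq (n + 1)).above t, ((Sq (n + 1)).s x - γ) ∂μ := by
        have : ∫ x in (Sq (n + 1)).above t, (t - γ) ∂μ =
            μ.real ((Sq (n + 1)).above t) * (t - γ) := by
          rw [setIntegral_const, smul_eq_mul]
        rw [← this]
        refine setIntegral_mono_on (integrable_const _).integrableOn
          ((Sq (n + 1)).integrable_s.sub (integrable_const _)).integrableOn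
          (measurableSet_above _ _) fun x (hx : t < _) => by linarith
      have h3 : μ.real ((Sq (n + 1)).above t) = 0 := by
        have h4 : 0 ≤ μ.real ((Sq (n + 1)).above t) := measureReal_nonneg
        nlinarith
      rw [measureReal_eq_zero_iff] at h3
      exact hne (measure_mono_null (hdec (n + 1)) h3)
    rw [ae_iff]
    refine measure_mono_null (fun x hx => ?_) hnull
    exact not_le.1 hx
  · intro x hx hx'
    obtain ⟨n, hn⟩ := (hS's x).exists
    rw [← hn, (hinv n).1 x hx hx']
  · intro x hx
    obtain ⟨n, hn⟩ := (hS's x).exists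
    rw [← hn]
    exact ((hinv n).2.2.1 x hx).2
  · intro x hx
    obtain ⟨n, hn⟩ := (hS's x).exists
    rw [← hn]
    rcases (hinv n).2.1 x hx with h | h
    · exact Or.inl h.1
    · exact Or.inr h.1
  · intro x hx
    obtain ⟨n, hn1, hn2⟩ := ((hS'b x).and (hS'g x)).exists
    rw [← hn1, ← hn2]
    rcases hkey n x hx with h | ⟨h1, h2, h3, h4⟩
    · exact Or.inl h
    · exact Or.inr ⟨h1, fun h => h2 (mem_iInter.1 (hS'B ▸ h) n), h3, h4⟩
  · -- the number of absorbed cycles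
    intro u hu
    have hNm : MeasurableSet N := measurableSet_between _ _ _
    -- The quantity `s / c` is a potential: each absorption lowers it by at least one, which pays
    -- for the newly absorbed point weighted by `u` at its base. The swap carries the integral over
    -- `F` to one over `E`.
    have hcount : ∀ n, (∫⁻ x in N \ (Sq n).B, u ((Sq n).b x) ∂μ) +
        ∫⁻ x in P, u x * ENNReal.ofReal ((Sq n).s x / c) ∂μ ≤
        ∫⁻ x in P, u x * ENNReal.ofReal (S.s x / c) ∂μ := by
      intro n
      induction n with
      | zero =>
        have : N \ S.B = ∅ := sdiff_eq_empty.2 (S.between_subset hc β)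
        rw [hSq0, this]
        simp only [Measure.restrict_empty, lintegral_zero_measure, zero_add]
        exact le_rfl
      | succ n ih =>
        refine le_trans ?_ ih
        have hset : N \ (Sq (n + 1)).B = (N \ (Sq n).B) ∪ F (Sq n) := by
          rw [hSq, glue_B]
          ext x
          constructor
          · rintro ⟨h1, h2⟩
            by_cases hxB : x ∈ (Sq n).B
            · right
              by_contra h3
              exact h2 ⟨hxB, h3⟩
            · exact Or.inl ⟨h1, hxB⟩
          · rintro (⟨h1, h2⟩ | h)
            · exact ⟨h1, fun h => h2 h.1⟩
            · exact ⟨hFN' n h, fun h' => h'.2 h⟩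
        have hdisj : Disjoint (N \ (Sq n).B) (F (Sq n)) := by
          rw [disjoint_left]
          exact fun x hx hx' => hx.2 (hFB _ hx')
        have hold : ∫⁻ x in N \ (Sq n).B, u ((Sq (n + 1)).b x) ∂μ =
            ∫⁻ x in N \ (Sq n).B, u ((Sq n).b x) ∂μ := by
          refine setLIntegral_congr_fun (hNm.diff (Sq n).measB) fun x hx => ?_
          have h1 : (Sq n).b x ∉ F (Sq n) := by
            rcases hkey n x (S.between_subset hc β hx.1) with h | h
            · exact absurd (h.1 ▸ (Sq n).b_mem x) hx.2
            · exact hPF n _ h.2.2.1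
          rw [hSq, glue_b_of_notMem _ _ _ _ _ _ h1]
        have hnew : ∫⁻ x in F (Sq n), u ((Sq (n + 1)).b x) ∂μ = ∫⁻ x in E (Sq n), u x ∂μ := by
          have h1 : ∫⁻ x in F (Sq n), u ((Sq (n + 1)).b x) ∂μ =
              ∫⁻ x in F (Sq n), u (τ (Sq n) x) ∂μ := by
            refine setLIntegral_congr_fun (hFm _) fun x hx => ?_
            have h2 : (Sq n).b x = x := (Sq n).b_of_mem x (hFB _ hx)
            rw [hSq, glue_b_of_mem _ _ _ _ _ _ (by rw [h2]; exact hx), h2]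
          rw [h1]
          have := (hτ (Sq n)).mp.setLIntegral_comp_preimage (hEm (Sq n)) hu
          rwa [(hτ (Sq n)).preimage_left] at this
        rw [hset, lintegral_union (hFm _) hdisj, hold, hnew, add_assoc]
        refine add_le_add le_rfl ?_
        have h1 : ∫⁻ x in E (Sq n), u x ∂μ = ∫⁻ x in P, (E (Sq n)).indicator u x ∂μ := by
          rw [lintegral_indicator (hEm _), Measure.restrict_restrict (hEm _),
            inter_eq_left.2 (hEP' n)]
        rw [h1, ← lintegral_add_left (hu.indicator (hEm _))]
        refine setLIntegral_mono' (measurableSet_above _ _) fun x hx => ?_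
        have h0 : ∀ n, 0 ≤ (Sq n).s x / c := fun n => by
          have := ((hinv n).2.2.1 x hx).2.1
          exact div_nonneg (by linarith) hc.le
        by_cases hxE : x ∈ E (Sq n)
        · rw [indicator_of_mem hxE]
          have h2 : (Sq (n + 1)).s x / c + 1 ≤ (Sq n).s x / c := by
            rw [div_add_one hc.ne']
            exact div_le_div_of_nonneg_right (by linarith [hstep n x hxE]) hc.le
          calc u x + u x * ENNReal.ofReal ((Sq (n + 1)).s x / c)
              = u x * ENNReal.ofReal ((Sq (n + 1)).s x / c + 1) := by
                rw [ENNReal.ofReal_add (h0 (n + 1)) zero_le_one, ENNReal.ofReal_one]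
                ring
            _ ≤ _ := by gcongr
        · rw [indicator_of_notMem hxE, zero_add]
          gcongr
          exact hanti n x hx
    have hun : N \ S'.B = ⋃ n, N \ (Sq n).B := by
      rw [hS'B, sdiff_iInter]
    rw [hun, setLIntegral_iUnion_of_directed]
    · refine iSup_le fun n => le_trans (le_of_eq ?_) (le_self_add.trans (hcount n))
      refine setLIntegral_congr_fun (hNm.diff (Sq n).measB) fun x hx => ?_
      have h1 : (Sq n).b x ∈ P := by
        rcases hkey n x (S.between_subset hc β hx.1) with h | h
        · exact absurd (h.1 ▸ (Sq n).b_mem x) hx.2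
        · exact h.2.2.1
      have h2 : S'.b x = (Sq n).b x := by
        rw [← (hSS' n).b_eq, S'.b_of_mem]
        rw [hS'B]
        exact mem_iInter.2 fun m => ((hinv m).2.2.1 _ h1).1
      simp only [h2]
    · exact directed_of_isDirected_le fun m n hmn => sdiff_subset_sdiff_right (hB m n hmn)

end TowerState

/-! ### Reduction of bounded sums at bounded cost -/

namespace TowerState

variable {μ : Measure ℝ} {f : ℝ → ℝ}

/-- By `Le.g_eq` the change of `g` at `x` is the new value at the old base point. Null sets pull
back to null sets under `b`, so a bound on the old base suffices. -/
theorem Le.ae_abs_sub_le {S S' : TowerState μ f} (h : Le S S') {C : ℝ}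
    (hC : ∀ᵐ x ∂μ, x ∈ S.B → |S'.g x| ≤ C) : ∀ᵐ x ∂μ, |S'.g x - S.g x| ≤ C := by
  filter_upwards [S.qmp.ae hC] with x hx
  rw [h.g_eq x, add_sub_cancel_left]
  exact hx (S.b_mem x)

variable [IsFiniteMeasure μ] [NullSingletonClass μ]

/-- Cycles with sum above `3 / 4 * σ` absorb negative ones. Since each negative sum is at least `-(σ
/ 2)`, an absorbing cycle ends with a sum in `[σ / 4, 3 / 4 * σ]`, and mean zero guarantees enough
negative mass. -/
theorem exists_reduce_of_neg_half_le (S : TowerState μ f) {σ : ℝ} (hσ : 0 < σ)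
    (h1 : ∀ᵐ x ∂μ, S.s x ≤ σ) (h2 : ∀ᵐ x ∂μ, -(σ / 2) ≤ S.s x) :
    ∃ S', Le S S' ∧ (∀ᵐ x ∂μ, |S'.s x| ≤ 3 / 4 * σ) ∧ ∀ᵐ x ∂μ, |S'.g x - S.g x| ≤ σ := by
  set t := 3 / 4 * σ with ht
  by_cases hP0 : μ (S.above t) = 0
  · refine ⟨S, Le.refl S, ?_, Eventually.of_forall fun x => by simp [hσ.le]⟩
    have : ∀ᵐ x ∂μ, x ∉ S.above t := measure_eq_zero_iff_ae_notMem.1 hP0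
    filter_upwards [h2, this] with x hx hx'
    rw [abs_le]
    exact ⟨by linarith, not_lt.1 hx'⟩
  have hi := S.integrable_s
  have hmono : Monotone fun n : ℕ => S.between (1 / ((n : ℝ) + 1)) (σ / 2) := by
    intro m n hmn x hx
    refine ⟨hx.1, lt_of_lt_of_le hx.2 (neg_le_neg ?_)⟩
    apply one_div_le_one_div_of_le (by positivity)
    have : (m : ℝ) ≤ n := by exact_mod_cast hmn
    linarith
  have hlim := tendsto_setIntegral_of_monotone (μ := μ) (f := fun x => -S.s x)
    (fun n : ℕ => S.measurableSet_between (1 / ((n : ℝ) + 1)) (σ / 2)) hmono hi.neg.integrableOn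
  have hneg : MeasurableSet {x | S.s x < 0} := measurableSet_lt S.meas_s measurable_const
  have hV : (⋃ n : ℕ, S.between (1 / ((n : ℝ) + 1)) (σ / 2)) =ᵐ[μ] {x | S.s x < 0} := by
    filter_upwards [h2] with x hx
    refine propext ⟨fun h => ?_, fun h => ?_⟩
    · obtain ⟨n, hn⟩ := mem_iUnion.1 h
      have h3 : S.s x < -(1 / ((n : ℝ) + 1)) := hn.2
      have h4 : (0 : ℝ) < 1 / ((n : ℝ) + 1) := by positivity
      change S.s x < 0
      linarith
    · have h' : 0 < -S.s x := neg_pos.2 h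
      obtain ⟨n, hn⟩ := exists_nat_one_div_lt h'
      exact mem_iUnion.2 ⟨n, hx, by linarith⟩
  rw [setIntegral_congr_set hV] at hlim
  have hsplit : ∫ x in {x | S.s x < 0}, -S.s x ∂μ = ∫ x in {x | S.s x < 0}ᶜ, S.s x ∂μ := by
    have := integral_add_compl hneg hi
    rw [S.integral_s] at this
    rw [integral_neg]
    linarith
  have hPsub : S.above t ⊆ {x | S.s x < 0}ᶜ := by
    intro x (hx : t < S.s x) (hx' : S.s x < 0)
    linarith
  have hge : ∫ x in S.above t, S.s x ∂μ ≤ ∫ x in {x | S.s x < 0}ᶜ, S.s x ∂μ := by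
    refine setIntegral_mono_set hi.integrableOn ?_ (Eventually.of_forall hPsub)
    refine (ae_restrict_iff' hneg.compl).2 (Eventually.of_forall fun x hx => ?_)
    exact not_lt.1 hx
  -- Subtracting `σ / 4` makes the inequality strict. This leaves room to discard the negative sums
  -- close to zero, as absorption terminates only if every absorbed sum is below some `-c < 0`.
  have hlt : ∫ x in S.above t, (S.s x - σ / 4) ∂μ < ∫ x in {x | S.s x < 0}, -S.s x ∂μ := by
    rw [integral_sub hi.integrableOn (integrable_const _).integrableOn, setIntegral_const,
      smul_eq_mul, hsplit]
    have : 0 < μ.real (S.above t) := by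
      rw [measureReal_def]
      exact ENNReal.toReal_pos hP0 (measure_ne_top _ _)
    have : 0 < μ.real (S.above t) * (σ / 4) := by positivity
    linarith
  obtain ⟨n, hn⟩ := (hlim.eventually_const_lt hlt).exists
  set c : ℝ := 1 / ((n : ℝ) + 1) with hc
  have hc0 : 0 < c := by positivity
  -- Here `β = σ / 2` and `γ = σ / 4`, so the requirement `β ≤ t - γ` holds with equality.
  obtain ⟨S', hle, a1, a2, a3, a4, a5, -⟩ := S.exists_absorb hc0 (half_pos hσ)
    (γ := σ / 4) (t := t) (by positivity) (by rw [ht]; linarith) hn.le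
  refine ⟨S', hle, ?_, hle.ae_abs_sub_le ?_⟩
  · filter_upwards [a1, h2] with x hx hx2
    refine abs_le.2 ⟨?_, hx⟩
    by_cases hxP : x ∈ S.above t
    · have := (a3 x hxP).1
      linarith
    by_cases hxN : x ∈ S.between c (σ / 2)
    · rcases a4 x hxN with h | h <;> rw [h] <;> linarith
    · rw [a2 x hxP hxN]
      linarith
  · filter_upwards [S'.qmp.ae h1] with x hx hxB
    rcases a5 x hxB with h | h
    · rw [h.2, abs_zero]
      exact hσ.le
    · exact h.2.2.2.trans hx

theorem exists_reduce_of_le_half (S : TowerState μ f) {σ : ℝ} (hσ : 0 < σ)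
    (h1 : ∀ᵐ x ∂μ, -σ ≤ S.s x) (h2 : ∀ᵐ x ∂μ, S.s x ≤ σ / 2) :
    ∃ S', Le S S' ∧ (∀ᵐ x ∂μ, |S'.s x| ≤ 3 / 4 * σ) ∧ ∀ᵐ x ∂μ, |S'.g x - S.g x| ≤ σ := by
  obtain ⟨S', hle, hs, hg⟩ := S.neg.exists_reduce_of_neg_half_le hσ
    (h1.mono fun x hx => by change -S.s x ≤ σ; linarith)
    (h2.mono fun x hx => by change -(σ / 2) ≤ -S.s x; linarith)
  obtain ⟨S'', hle', -, hs', -, hg'⟩ := hle.neg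
  refine ⟨S'', hle', ?_, ?_⟩
  · filter_upwards [hs] with x hx
    rw [hs', Pi.neg_apply, abs_neg]
    exact hx
  · filter_upwards [hg] with x hx
    have h3 : S'.g x - S.neg.g x = -(S''.g x - S.g x) := by
      rw [hg']
      change S'.g x - -S.g x = -(-S'.g x - S.g x)
      ring
    rwa [h3, abs_neg] at hx

/-- Sums above `σ / 2` are first paired with sums below `-(σ / 2)`; each pair has a sum of absolute
value at most `σ / 2`. One of the two sides is exhausted, and a one-sided reduction finishes. Each
of the two stages shifts `g` by at most `σ`. -/
theorem exists_reduce (S : TowerState μ f) {σ : ℝ} (hσ : 0 < σ) (h : ∀ᵐ x ∂μ, |S.s x| ≤ σ) :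
    ∃ S', Le S S' ∧ (∀ᵐ x ∂μ, |S'.s x| ≤ 3 / 4 * σ) ∧ ∀ᵐ x ∂μ, |S'.g x - S.g x| ≤ 2 * σ := by
  have hPm := S.measurableSet_above (σ / 2)
  have hNm := S.neg.measurableSet_above (σ / 2)
  have hd : Disjoint (S.above (σ / 2)) (S.neg.above (σ / 2)) := by
    rw [disjoint_left]
    intro x (hx : σ / 2 < S.s x) (hx' : σ / 2 < -S.s x)
    linarith
  have hσ2 : 0 ≤ σ / 2 := by linarith
  obtain ⟨E, hEP, F, hFN, τ, hEm, hFm, h0, hτ⟩ := exists_isSwap_subset (μ := μ) hPm hNm hd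
  have hEB : E ⊆ S.B := hEP.trans (S.above_subset hσ2)
  have hFB : F ⊆ S.B := hFN.trans (S.neg.above_subset hσ2)
  have hEF : Disjoint E F := hd.mono hEP hFN
  set S₁ := S.glue hτ hFm hEB hFB hEF with hS₁
  have hτae : ∀ᵐ x ∂μ, |S.s (τ x)| ≤ σ := hτ.mp.quasiMeasurePreserving.ae h
  have hE1 : ∀ᵐ x ∂μ, x ∈ E → |S₁.s x| ≤ σ / 2 := by
    filter_upwards [h, hτae] with x hx hx' hxE
    rw [hS₁, glue_s_of_mem_left _ _ _ _ _ _ hxE]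
    have h1 : σ / 2 < S.s x := hEP hxE
    have h2 : σ / 2 < -S.s (τ x) := hFN (hτ.mapsE x hxE)
    rw [abs_le] at hx hx' ⊢
    constructor <;> linarith
  have hF1 : ∀ x ∈ F, S₁.s x = 0 := fun x hx => by rw [hS₁, glue_s_of_mem_right _ _ _ _ _ _ hx]
  have hO1 : ∀ x, x ∉ E → x ∉ F → S₁.s x = S.s x := fun x hx hx' => by
    rw [hS₁, glue_s_of_notMem _ _ _ _ _ _ hx hx']
  have hs1 : ∀ᵐ x ∂μ, |S₁.s x| ≤ σ := by
    filter_upwards [h, hE1] with x hx hx'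
    by_cases hxE : x ∈ E
    · linarith [hx' hxE]
    by_cases hxF : x ∈ F
    · rw [hF1 x hxF, abs_zero]
      exact hσ.le
    · rw [hO1 x hxE hxF]
      exact hx
  have hg1 : ∀ᵐ x ∂μ, |S₁.g x - S.g x| ≤ σ := by
    filter_upwards [S.qmp.ae hτae] with x hx
    by_cases hxF : S.b x ∈ F
    · rw [hS₁, glue_g_of_mem _ _ _ _ _ _ hxF, sub_sub_cancel_left, abs_neg]
      exact hx
    · rw [hS₁, glue_g_of_notMem _ _ _ _ _ _ hxF, sub_self, abs_zero]
      exact hσ.le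
  have hfin : (∃ S', Le S₁ S' ∧ (∀ᵐ x ∂μ, |S'.s x| ≤ 3 / 4 * σ) ∧
      ∀ᵐ x ∂μ, |S'.g x - S₁.g x| ≤ σ) := by
    rcases h0 with h0 | h0
    · refine S₁.exists_reduce_of_le_half hσ (hs1.mono fun x hx => (abs_le.1 hx).1) ?_
      filter_upwards [hE1, measure_eq_zero_iff_ae_notMem.1 h0] with x hx hx'
      by_cases hxE : x ∈ E
      · exact (abs_le.1 (hx hxE)).2
      by_cases hxF : x ∈ F
      · rw [hF1 x hxF]
        exact hσ2
      · rw [hO1 x hxE hxF]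
        by_contra hcon
        exact hx' ⟨not_le.1 hcon, hxE⟩
    · refine S₁.exists_reduce_of_neg_half_le hσ (hs1.mono fun x hx => (abs_le.1 hx).2) ?_
      filter_upwards [hE1, measure_eq_zero_iff_ae_notMem.1 h0] with x hx hx'
      by_cases hxE : x ∈ E
      · exact (abs_le.1 (hx hxE)).1
      by_cases hxF : x ∈ F
      · rw [hF1 x hxF]
        linarith
      · rw [hO1 x hxE hxF]
        by_contra hcon
        refine hx' ⟨?_, hxF⟩
        change σ / 2 < -S.s x
        linarith [not_le.1 hcon]
  obtain ⟨S', hle, hs, hg⟩ := hfin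
  refine ⟨S', (le_glue S hτ hFm hEB hFB hEF).trans hle, hs, ?_⟩
  filter_upwards [hg, hg1] with x hx hx'
  calc |S'.g x - S.g x| = |(S'.g x - S₁.g x) + (S₁.g x - S.g x)| := by ring_nf
    _ ≤ |S'.g x - S₁.g x| + |S₁.g x - S.g x| := abs_add_le _ _
    _ ≤ 2 * σ := by linarith

/-- The shifts form a geometric series: `2 * σ * (3 / 4) ^ k` summed over `k < n`. -/
theorem exists_reduce_pow (S : TowerState μ f) {σ : ℝ} (hσ : 0 < σ) (h : ∀ᵐ x ∂μ, |S.s x| ≤ σ)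
    (n : ℕ) : ∃ S', Le S S' ∧ (∀ᵐ x ∂μ, |S'.s x| ≤ (3 / 4) ^ n * σ) ∧
      ∀ᵐ x ∂μ, |S'.g x - S.g x| ≤ 8 * σ * (1 - (3 / 4) ^ n) := by
  induction n with
  | zero => exact ⟨S, Le.refl S, by simpa using h, by simp⟩
  | succ n ih =>
    obtain ⟨S₁, hle, hs, hg⟩ := ih
    obtain ⟨S₂, hle', hs', hg'⟩ := S₁.exists_reduce (by positivity) hs
    refine ⟨S₂, hle.trans hle', ?_, ?_⟩
    · filter_upwards [hs'] with x hx
      calc _ ≤ _ := hx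
        _ = _ := by ring
    · filter_upwards [hg, hg'] with x hx hx'
      calc |S₂.g x - S.g x| = |(S₂.g x - S₁.g x) + (S₁.g x - S.g x)| := by ring_nf
        _ ≤ |S₂.g x - S₁.g x| + |S₁.g x - S.g x| := abs_add_le _ _
        _ ≤ 8 * σ * (1 - (3 / 4) ^ (n + 1)) := by
          have : 8 * σ * (1 - (3 / 4 : ℝ) ^ (n + 1)) =
            8 * σ * (1 - (3 / 4) ^ n) + 2 * ((3 / 4) ^ n * σ) := by ring
          linarith

end TowerState

/-! ### Mixing: joining small pieces to equidistribute a set -/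

/-- Almost all of a set can be cut into finitely many pieces of the same small measure on each of which
`q` is constant. -/
theorem exists_pieces {μ : Measure ℝ} [IsFiniteMeasure μ] [NullSingletonClass μ] {ι : Type*}
    [Countable ι] {q : ℝ → ι} (hq : ∀ i, MeasurableSet (q ⁻¹' {i})) {B : Set ℝ}
    (hB : MeasurableSet B) {δ : ℝ} (hδ : 0 < δ) :
    ∃ ω > 0, ω ≤ δ ∧ ∃ Q : Finset (Set ℝ), (∀ A ∈ Q, MeasurableSet A ∧ A ⊆ B ∧ μ.real A = ω ∧
      ∃ i, A ⊆ q ⁻¹' {i}) ∧ (Q : Set (Set ℝ)).PairwiseDisjoint id ∧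
      μ.real (B \ ⋃ A ∈ Q, A) ≤ δ := by
  classical
  have hdisj : Pairwise (Function.onFun Disjoint fun i => B ∩ q ⁻¹' {i}) := by
    intro i j hij
    rw [Function.onFun, disjoint_left]
    rintro x ⟨-, hx⟩ ⟨-, hx'⟩
    exact hij (hx.symm.trans hx')
  have hm : ∀ i, MeasurableSet (B ∩ q ⁻¹' {i}) := fun i => hB.inter (hq i)
  have hun : (⋃ i, B ∩ q ⁻¹' {i}) = B := by
    ext x
    simp
  have hsum : HasSum (fun i => μ.real (B ∩ q ⁻¹' {i})) (μ.real B) := by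
    have h := measure_iUnion (μ := μ) hdisj hm
    rw [hun] at h
    have h2 := ENNReal.hasSum_toReal (h ▸ measure_ne_top μ B)
    rwa [← ENNReal.tsum_toReal_eq fun _ => measure_ne_top μ _, ← h] at h2
  obtain ⟨I, hI⟩ := (hsum.eventually_const_lt (show μ.real B - δ / 2 < μ.real B by linarith)).exists
  have hIm : MeasurableSet (⋃ i ∈ I, B ∩ q ⁻¹' {i}) := I.measurableSet_biUnion fun i _ => hm i
  have hIr : μ.real (B \ ⋃ i ∈ I, B ∩ q ⁻¹' {i}) ≤ δ / 2 := by
    rw [measureReal_sdiff (iUnion₂_subset fun i _ => inter_subset_left) hIm,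
      measureReal_biUnion_finset (fun i _ j _ hij => hdisj hij) fun i _ => hm i]
    linarith
  -- Finitely many classes `I` carry all but `δ / 2` of the mass. When no class has room for another
  -- piece, each leaves less than `ω`, together at most another `δ / 2`.
  set ω := δ / (2 * (I.card + 1)) with hω
  have hω0 : 0 < ω := by positivity
  have hωI : I.card * ω ≤ δ / 2 := by
    rw [hω]
    have : (0 : ℝ) < I.card + 1 := by positivity
    field_simp
    linarith
  have hωδ : ω ≤ δ := by
    rw [hω]
    apply div_le_self hδ.le
    have : (0 : ℝ) ≤ I.card := by positivity
    linarith
  refine ⟨ω, hω0, hωδ, ?_⟩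
  by_contra hcon
  -- If no family were good enough, a further piece could always be added, giving disjoint pieces of
  -- arbitrarily large total mass.
  have hall : ∀ n : ℕ, ∃ Q : Finset (Set ℝ), (∀ A ∈ Q, MeasurableSet A ∧ A ⊆ B ∧ μ.real A = ω ∧
      ∃ i, A ⊆ q ⁻¹' {i}) ∧ (Q : Set (Set ℝ)).PairwiseDisjoint id ∧ Q.card = n := by
    intro n
    induction n with
    | zero => exact ⟨∅, by simp, by simp, rfl⟩
    | succ n ih =>
      obtain ⟨Q, h1, h2, h3⟩ := ih
      have hUm : MeasurableSet (⋃ A ∈ Q, A) := Q.measurableSet_biUnion fun A hA => (h1 A hA).1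
      have hex : ∃ i ∈ I, ω ≤ μ.real ((B ∩ q ⁻¹' {i}) \ ⋃ A ∈ Q, A) := by
        by_contra hno
        push Not at hno
        refine hcon ⟨Q, h1, h2, ?_⟩
        have hsub : B \ (⋃ A ∈ Q, A) ⊆ (B \ ⋃ i ∈ I, B ∩ q ⁻¹' {i}) ∪
            ⋃ i ∈ I, ((B ∩ q ⁻¹' {i}) \ ⋃ A ∈ Q, A) := by
          rintro x ⟨hx, hx'⟩
          by_cases hxI : x ∈ ⋃ i ∈ I, B ∩ q ⁻¹' {i}
          · right
            simp only [mem_iUnion] at hxI ⊢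
            obtain ⟨i, hi, hxi⟩ := hxI
            exact ⟨i, hi, hxi, hx'⟩
          · exact Or.inl ⟨hx, hxI⟩
        calc μ.real (B \ ⋃ A ∈ Q, A) ≤ _ := measureReal_mono hsub
          _ ≤ _ := measureReal_union_le _ _
          _ ≤ δ / 2 + ∑ i ∈ I, μ.real ((B ∩ q ⁻¹' {i}) \ ⋃ A ∈ Q, A) :=
            add_le_add hIr (measureReal_biUnion_finset_le _ _)
          _ ≤ δ / 2 + ∑ i ∈ I, ω := by
            gcongr with i hi
            exact (hno i hi).le
          _ ≤ δ := by
            rw [Finset.sum_const, nsmul_eq_mul]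
            linarith
      obtain ⟨i, -, hi⟩ := hex
      obtain ⟨A, hA, hAm, hAω⟩ := exists_subset_measureReal_eq (μ := μ) ((hm i).diff hUm) hω0.le hi
      have hAne : A.Nonempty := by
        rw [nonempty_iff_ne_empty]
        rintro rfl
        simp at hAω
        linarith
      have hAd : ∀ A' ∈ Q, Disjoint A A' := fun A' hA' => by
        rw [disjoint_left]
        intro x hx hx'
        exact (hA hx).2 (mem_biUnion hA' hx')
      have hAQ : A ∉ Q := fun h => hAne.ne_empty (disjoint_self.1 (hAd A h))
      refine ⟨insert A Q, ?_, ?_, by rw [Finset.card_insert_of_notMem hAQ, h3]⟩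
      · intro A' hA'
        rcases Finset.mem_insert.1 hA' with rfl | h
        · exact ⟨hAm, fun x hx => (hA hx).1.1, hAω, i, fun x hx => (hA hx).1.2⟩
        · exact h1 A' h
      · rw [Finset.coe_insert]
        exact h2.insert fun A' hA' _ => hAd A' hA'
  obtain ⟨n, hn⟩ := exists_nat_gt (μ.real B / ω)
  obtain ⟨Q, h1, h2, h3⟩ := hall n
  have h4 : μ.real (⋃ A ∈ Q, A) = n * ω := by
    have := measureReal_biUnion_finset (μ := μ) (s := Q) (f := id) h2 fun A hA => (h1 A hA).1
    simp only [id] at this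
    rw [this, Finset.sum_congr rfl fun A hA => (h1 A hA).2.2.1, Finset.sum_const, h3, nsmul_eq_mul]
  have h5 : μ.real (⋃ A ∈ Q, A) ≤ μ.real B :=
    measureReal_mono (iUnion₂_subset fun A hA => (h1 A hA).2.1)
  rw [div_lt_iff₀ hω0] at hn
  linarith

/-- If `J` meets all pieces in the same proportion `ρ` and `k` is almost constant on the pieces, then
`J` carries about the proportion `ρ` of the integral of `k`. -/
theorem abs_setIntegral_inter_sub_le {μ : Measure ℝ} [IsProbabilityMeasure μ] {k : ℝ → ℝ}
    (hk : Integrable k μ) (hk0 : ∀ x, 0 ≤ k x) {B J : Set ℝ} (hB : MeasurableSet B)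
    (hJ : MeasurableSet J) {u : Finset (Set ℝ)} {ω ρ η ε : ℝ} (hω : 0 < ω) (hη : 0 ≤ η)
    (hρ0 : 0 ≤ ρ) (hρ1 : ρ ≤ 1)
    (hu : ∀ A ∈ u, MeasurableSet A ∧ A ⊆ B ∧ μ.real A = ω)
    (hud : (u : Set (Set ℝ)).PairwiseDisjoint id)
    (hosc : ∀ A ∈ u, ∀ x ∈ A, ∀ y ∈ A, |k x - k y| ≤ η)
    (hJA : ∀ A ∈ u, μ.real (J ∩ A) = ρ * ω)
    (hrest : ∫ x in B \ ⋃ A ∈ u, A, k x ∂μ ≤ ε) :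
    |(∫ x in J ∩ B, k x ∂μ) - ρ * ∫ x in B, k x ∂μ| ≤ 2 * η + ε := by
  set M := ⋃ A ∈ u, A with hM
  have hMm : MeasurableSet M := u.measurableSet_biUnion fun A hA => (hu A hA).1
  have hMB : M ⊆ B := iUnion₂_subset fun A hA => (hu A hA).2.1
  have hsplit : ∫ x in B, k x ∂μ = (∑ A ∈ u, ∫ x in A, k x ∂μ) + ∫ x in B \ M, k x ∂μ := by
    rw [← integral_biUnion_finset u (fun A hA => (hu A hA).1) hud fun A _ => hk.integrableOn,
      ← setIntegral_union disjoint_sdiff_right (hB.diff hMm) hk.integrableOn hk.integrableOn,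
      union_sdiff_cancel hMB]
  have hsplitJ : ∫ x in J ∩ B, k x ∂μ =
      (∑ A ∈ u, ∫ x in J ∩ A, k x ∂μ) + ∫ x in J ∩ (B \ M), k x ∂μ := by
    have hd' : (u : Set (Set ℝ)).PairwiseDisjoint fun A => J ∩ A := fun A hA A' hA' h =>
      (hud hA hA' h).mono inter_subset_right inter_subset_right
    rw [← integral_biUnion_finset u (fun A hA => hJ.inter (hu A hA).1) hd'
      fun A _ => hk.integrableOn, ← inter_iUnion₂,
      ← setIntegral_union (disjoint_sdiff_right.mono inter_subset_right inter_subset_right)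
        (hJ.inter (hB.diff hMm)) hk.integrableOn hk.integrableOn, ← inter_union_distrib_left,
      union_sdiff_cancel hMB]
  have hpiece : ∀ A ∈ u, |(∫ x in J ∩ A, k x ∂μ) - ρ * ∫ x in A, k x ∂μ| ≤ 2 * η * ω := by
    intro A hA
    obtain ⟨hAm, -, hAω⟩ := hu A hA
    have hAne : A.Nonempty := by
      rw [nonempty_iff_ne_empty]
      rintro rfl
      simp at hAω
      linarith
    obtain ⟨x₀, hx₀⟩ := hAne
    -- On a piece `k` is compared with its value at one point `x₀`. The comparison is made for `A`
    -- and for `J ∩ A`, whence the factor two.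
    have hbound : ∀ C ⊆ A, MeasurableSet C →
        |(∫ x in C, k x ∂μ) - μ.real C * k x₀| ≤ η * μ.real C := by
      intro C hC hCm
      have h1 : (∫ x in C, k x ∂μ) - μ.real C * k x₀ = ∫ x in C, (k x - k x₀) ∂μ := by
        rw [integral_sub hk.integrableOn (integrable_const _).integrableOn, setIntegral_const,
          smul_eq_mul]
      rw [h1, ← Real.norm_eq_abs]
      exact norm_setIntegral_le_of_norm_le_const (measure_lt_top _ _)
        fun x hx => hosc A hA x (hC hx) x₀ hx₀
    have b1 := hbound (J ∩ A) inter_subset_right (hJ.inter hAm)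
    have b2 := hbound A Subset.rfl hAm
    rw [hJA A hA] at b1
    rw [hAω] at b2
    have e : (∫ x in J ∩ A, k x ∂μ) - ρ * ∫ x in A, k x ∂μ =
        ((∫ x in J ∩ A, k x ∂μ) - ρ * ω * k x₀) - ρ * ((∫ x in A, k x ∂μ) - ω * k x₀) := by ring
    rw [e]
    have h1 : η * (ρ * ω) ≤ η * ω := by
      have : ρ * ω ≤ 1 * ω := mul_le_mul_of_nonneg_right hρ1 hω.le
      nlinarith
    have h2 : |ρ * ((∫ x in A, k x ∂μ) - ω * k x₀)| ≤ η * ω := by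
      rw [abs_mul, abs_of_nonneg hρ0]
      calc _ ≤ 1 * (η * ω) := mul_le_mul hρ1 b2 (abs_nonneg _) zero_le_one
        _ = _ := one_mul _
    calc _ ≤ |(∫ x in J ∩ A, k x ∂μ) - ρ * ω * k x₀| + |ρ * ((∫ x in A, k x ∂μ) - ω * k x₀)| :=
          abs_sub _ _
      _ ≤ 2 * η * ω := by linarith
  have hcard : u.card * ω ≤ 1 := by
    have := measureReal_biUnion_finset (μ := μ) (s := u) (f := id) hud fun A hA => (hu A hA).1
    simp only [id] at this
    rw [Finset.sum_congr rfl fun A hA => (hu A hA).2.2, Finset.sum_const, nsmul_eq_mul] at this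
    rw [← this]
    exact measureReal_le_one
  have hr0 : 0 ≤ ∫ x in J ∩ (B \ M), k x ∂μ := integral_nonneg hk0
  have hr1 : ∫ x in J ∩ (B \ M), k x ∂μ ≤ ∫ x in B \ M, k x ∂μ :=
    setIntegral_mono_set hk.integrableOn (Eventually.of_forall hk0)
      (Eventually.of_forall inter_subset_right)
  have hr2 : |(∫ x in J ∩ (B \ M), k x ∂μ) - ρ * ∫ x in B \ M, k x ∂μ| ≤ ε := by
    have h3 : 0 ≤ ρ * ∫ x in B \ M, k x ∂μ := mul_nonneg hρ0 (hr0.trans hr1)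
    have h4 : ρ * ∫ x in B \ M, k x ∂μ ≤ 1 * ∫ x in B \ M, k x ∂μ :=
      mul_le_mul_of_nonneg_right hρ1 (hr0.trans hr1)
    rw [abs_le]
    constructor <;> linarith
  have e : (∫ x in J ∩ B, k x ∂μ) - ρ * ∫ x in B, k x ∂μ =
      (∑ A ∈ u, ((∫ x in J ∩ A, k x ∂μ) - ρ * ∫ x in A, k x ∂μ)) +
      ((∫ x in J ∩ (B \ M), k x ∂μ) - ρ * ∫ x in B \ M, k x ∂μ) := by
    rw [hsplit, hsplitJ, Finset.sum_sub_distrib, ← Finset.mul_sum]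
    ring
  rw [e]
  calc _ ≤ |∑ A ∈ u, ((∫ x in J ∩ A, k x ∂μ) - ρ * ∫ x in A, k x ∂μ)| + ε :=
        (abs_add_le _ _).trans (add_le_add le_rfl hr2)
    _ ≤ (∑ A ∈ u, |(∫ x in J ∩ A, k x ∂μ) - ρ * ∫ x in A, k x ∂μ|) + ε :=
        add_le_add (Finset.abs_sum_le_sum_abs _ _) le_rfl
    _ ≤ (∑ A ∈ u, 2 * η * ω) + ε := add_le_add (Finset.sum_le_sum hpiece) le_rfl
    _ = 2 * η * (u.card * ω) + ε := by
        rw [Finset.sum_const, nsmul_eq_mul]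
        ring
    _ ≤ 2 * η + ε := by nlinarith

namespace TowerState

variable {μ : Measure ℝ} {f : ℝ → ℝ}

/-- Unions of later cycles are unions of earlier ones, so equidistribution survives any further
joining. -/
theorem Le.saturated {S S' : TowerState μ f} (h : Le S S') {J : Set ℝ}
    (hJ : ∀ x, x ∈ J ↔ S'.b x ∈ J) (x : ℝ) : x ∈ J ↔ S.b x ∈ J := by
  rw [hJ x, hJ (S.b x), h.b_eq]

/-- The number of points of `A` in a cycle, as a density. -/
theorem exists_density [IsFiniteMeasure μ] (S : TowerState μ f) (A : Set ℝ) :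
    ∃ k : ℝ → ℝ, Measurable k ∧ (∀ x, 0 ≤ k x) ∧ Integrable k μ ∧
      ∀ J, MeasurableSet J → (∀ x, x ∈ J ↔ S.b x ∈ J) →
        μ.real (J ∩ A) = ∫ x in J ∩ S.B, k x ∂μ := by
  -- All mass of `A` is moved to the base points. The image is absolutely continuous because `b` is
  -- quasi measure preserving, and the density is its Radon–Nikodym derivative.
  set ν := (μ.restrict A).map S.b with hν
  have hbm := S.qmp.measurable
  have hac : ν ≪ μ :=
    (Measure.AbsolutelyContinuous.map Measure.restrict_le_self.absolutelyContinuous hbm).trans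
      S.qmp.absolutelyContinuous
  refine ⟨fun x => (ν.rnDeriv μ x).toReal, (Measure.measurable_rnDeriv _ _).ennreal_toReal,
    fun x => ENNReal.toReal_nonneg, Measure.integrable_toReal_rnDeriv, fun J hJ hsat => ?_⟩
  rw [Measure.setIntegral_toReal_rnDeriv hac, measureReal_def, measureReal_def, hν,
    Measure.map_apply hbm (hJ.inter S.measB),
    Measure.restrict_apply (hbm (hJ.inter S.measB))]
  congr 3
  ext x
  simp only [mem_preimage, mem_inter_iff, ← hsat x, S.b_mem x, and_true]

variable [IsFiniteMeasure μ] [NullSingletonClass μ]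

/-- This hides the null sets lost in the swap. A union of the joined cycles contains a point of `A`
exactly when it contains its partner in `E`, up to null sets, whence equal measures. -/
theorem exists_glue (S : TowerState μ f) {E A : Set ℝ} (hEm : MeasurableSet E)
    (hAm : MeasurableSet A) (hE : E ⊆ S.B) (hA : A ⊆ S.B) (hEA : Disjoint E A)
    (h : μ.real E = μ.real A) :
    ∃ (S' : TowerState μ f) (τ : ℝ ≃ᵐ ℝ), Le S S' ∧ MeasurePreserving τ μ μ ∧ S.B \ A ⊆ S'.B ∧
      μ (A ∩ S'.B) = 0 ∧ (∀ᵐ x ∂μ, x ∈ E → τ x ∈ A ∧ S'.s x = S.s x + S.s (τ x)) ∧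
      (∀ x, x ∉ E → x ∉ A → S'.s x = S.s x) ∧
      (∀ J, MeasurableSet J → (∀ x, x ∈ J ↔ S'.b x ∈ J) → μ (J ∩ A) = μ (J ∩ E)) ∧
      (∀ x ∈ S.B, (S'.b x = x ∧ S'.g x = 0) ∨
        (τ x ∈ E ∧ S'.b x = τ x ∧ S'.g x = -S.s (τ x))) := by
  obtain ⟨E', hE', F, hF, τ, hE'm, hFm, h0, h1, hτ⟩ := exists_isSwap (μ := μ) hEm hAm hEA h
  have hEB := hE'.trans hE
  have hFB := hF.trans hA
  have hd := hEA.mono hE' hF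
  refine ⟨S.glue hτ hFm hEB hFB hd, τ, le_glue _ _ _ _ _ _, hτ.mp, ?_, ?_, ?_, ?_, ?_, ?_⟩
  · rw [glue_B]
    exact sdiff_subset_sdiff_right hF
  · rw [glue_B]
    refine measure_mono_null ?_ h1
    exact fun x hx => ⟨hx.1, hx.2.2⟩
  · filter_upwards [measure_eq_zero_iff_ae_notMem.1 h0] with x hx hxE
    have hxE' : x ∈ E' := by
      by_contra hc
      exact hx ⟨hxE, hc⟩
    exact ⟨hF (hτ.mapsE x hxE'), glue_s_of_mem_left _ _ _ _ _ _ hxE'⟩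
  · exact fun x hx hx' => glue_s_of_notMem _ _ _ _ _ _ (fun h => hx (hE' h)) (fun h => hx' (hF h))
  · intro J hJ hsat
    have e1 : μ (J ∩ A) = μ (J ∩ F) := by
      refine measure_congr ((ae_le_set.2 ?_).antisymm (ae_le_set.2 ?_))
      · refine measure_mono_null ?_ h1
        exact fun x hx => ⟨hx.1.2, fun h => hx.2 ⟨hx.1.1, h⟩⟩
      · exact measure_mono_null (fun x hx => hx.2 ⟨hx.1.1, hF hx.1.2⟩) measure_empty
    have e2 : μ (J ∩ E) = μ (J ∩ E') := by
      refine measure_congr ((ae_le_set.2 ?_).antisymm (ae_le_set.2 ?_))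
      · refine measure_mono_null ?_ h0
        exact fun x hx => ⟨hx.1.2, fun h => hx.2 ⟨hx.1.1, h⟩⟩
      · exact measure_mono_null (fun x hx => hx.2 ⟨hx.1.1, hE' hx.1.2⟩) measure_empty
    have e3 : J ∩ F = τ ⁻¹' (J ∩ E') := by
      ext x
      rw [mem_preimage]
      have key : x ∈ F → (x ∈ J ↔ τ x ∈ J) := fun hx => by
        have hb : S.b x = x := S.b_of_mem x (hFB hx)
        rw [hsat x, glue_b_of_mem _ _ _ _ _ _ (by rw [hb]; exact hx), hb]
      constructor
      · rintro ⟨h1, h2⟩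
        exact ⟨(key h2).1 h1, hτ.mapsF x h2⟩
      · rintro ⟨h1, h2⟩
        have h3 : x ∈ F := hτ.invol x ▸ hτ.mapsE _ h2
        exact ⟨(key h3).2 h1, h3⟩
    rw [e1, e2, e3, hτ.mp.measure_preimage (hJ.inter hE'm).nullMeasurableSet]
  · intro x hx
    have hb : S.b x = x := S.b_of_mem x hx
    by_cases hxF : x ∈ F
    · right
      rw [glue_b_of_mem _ _ _ _ _ _ (by rw [hb]; exact hxF),
        glue_g_of_mem _ _ _ _ _ _ (by rw [hb]; exact hxF), hb, S.g_of_mem x hx, zero_sub]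
      exact ⟨hE' (hτ.mapsF x hxF), rfl, rfl⟩
    · left
      rw [glue_b_of_notMem _ _ _ _ _ _ (by rw [hb]; exact hxF),
        glue_g_of_notMem _ _ _ _ _ _ (by rw [hb]; exact hxF), hb, S.g_of_mem x hx]
      exact ⟨rfl, rfl⟩

/-- Join the cycles based in `E` with those based in `A` in such a way that the sums over the joined
cycles do not spread over an interval of length more than `2 * η`. -/
theorem exists_glue_of_spread (S : TowerState μ f) {E A : Set ℝ} (hEm : MeasurableSet E)
    (hAm : MeasurableSet A) (hE : E ⊆ S.B) (hA : A ⊆ S.B) (hEA : Disjoint E A)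
    (h : μ.real E = μ.real A) {m η lo hi C : ℝ} (hη : 0 ≤ η)
    (hm : ∀ᵐ x ∂μ, x ∈ E → m ≤ S.s x ∧ S.s x ≤ m + 2 * η) (hC : |m| + 2 * η ≤ C)
    (hlh : lo ≤ hi) (hlη : hi ≤ lo + η) (hs : ∀ x ∈ A, lo ≤ S.s x ∧ S.s x ≤ hi) :
    ∃ (S' : TowerState μ f) (θ : ℝ), θ ∈ Icc lo hi ∧ Le S S' ∧
      (∀ᵐ x ∂μ, x ∈ E → m + θ ≤ S'.s x ∧ S'.s x ≤ m + θ + 2 * η) ∧ S.B \ A ⊆ S'.B ∧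
      μ (A ∩ S'.B) = 0 ∧ (∀ x, x ∉ E → x ∉ A → S'.s x = S.s x) ∧
      (∀ J, MeasurableSet J → (∀ x, x ∈ J ↔ S'.b x ∈ J) → μ (J ∩ A) = μ (J ∩ E)) ∧
      (∀ x ∈ S.B, (S'.b x = x ∧ S'.g x = 0) ∨ S'.b x ∈ E) ∧
      (∀ᵐ x ∂μ, x ∈ S.B → |S'.g x| ≤ C) := by
  -- The upper part of `E` is joined with the lower part of `A`, and conversely. Upper sums in `[m +
  -- η, m + 2 * η]` meet values in `[θ - η, θ]`, lower ones in `[m, m + η)` meet values in `[θ, θ +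
  -- η]`; either way the total lies in `[m + θ, m + θ + 2 * η]`, so the spread does not grow.
  set E₁ := E ∩ {x | m + η ≤ S.s x} with hE₁
  have hE₁m : MeasurableSet E₁ := hEm.inter (measurableSet_le measurable_const S.meas_s)
  set E₂ := E \ E₁ with hE₂
  have hE₂m : MeasurableSet E₂ := hEm.diff hE₁m
  have hE₁E : E₁ ⊆ E := inter_subset_left
  have hE₂E : E₂ ⊆ E := sdiff_subset
  obtain ⟨A₁, hA₁A, θ, hθ, hA₁m, hA₁e, hA₁s, hA₂s⟩ := exists_threshold_split (μ := μ) hAm S.meas_s hlh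
    (fun x hx => (hs x hx).1) (fun x hx => (hs x hx).2) (t := μ.real E₁) measureReal_nonneg
    (h ▸ measureReal_mono hE₁E)
  set A₂ := A \ A₁ with hA₂
  have hA₂m : MeasurableSet A₂ := hAm.diff hA₁m
  have hA₂A : A₂ ⊆ A := sdiff_subset
  have hA₂e : μ.real E₂ = μ.real A₂ := by
    rw [hE₂, hA₂, measureReal_sdiff hE₁E hE₁m, measureReal_sdiff hA₁A hA₁m, h, hA₁e]
  obtain ⟨S₁, τ₁, hle₁, hτ₁, hB₁, hn₁, hs₁, ho₁, hJ₁, hb₁⟩ := S.exists_glue hE₁m hA₁m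
    (hE₁E.trans hE) (hA₁A.trans hA) (hEA.mono hE₁E hA₁A) hA₁e.symm
  have hE₂A₁ : ∀ x ∈ E₂, x ∉ A₁ := fun x hx hx' => disjoint_left.1 hEA (hE₂E hx) (hA₁A hx')
  have hA₂E₁ : ∀ x ∈ A₂, x ∉ E₁ := fun x hx hx' => disjoint_left.1 hEA (hE₁E hx') (hA₂A hx)
  obtain ⟨S₂, τ₂, hle₂, hτ₂, hB₂, hn₂, hs₂, ho₂, hJ₂, hb₂⟩ := S₁.exists_glue hE₂m hA₂m
    (fun x hx => hB₁ ⟨hE (hE₂E hx), hE₂A₁ x hx⟩) (fun x hx => hB₁ ⟨hA (hA₂A hx), hx.2⟩)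
    (hEA.mono hE₂E hA₂A) hA₂e
  have hsE₂ : ∀ x ∈ E₂, S₁.s x = S.s x := fun x hx => ho₁ x hx.2 (hE₂A₁ x hx)
  have hsA₂ : ∀ x ∈ A₂, S₁.s x = S.s x := fun x hx => ho₁ x (hA₂E₁ x hx) hx.2
  have hEB₂ : S.B \ A ⊆ S₂.B := fun x hx =>
    hB₂ ⟨hB₁ ⟨hx.1, fun h => hx.2 (hA₁A h)⟩, fun h => hx.2 (hA₂A h)⟩
  have hEA' : ∀ x ∈ E, x ∉ A := fun x hx => disjoint_left.1 hEA hx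
  have hEabs : ∀ᵐ x ∂μ, x ∈ E → |S.s x| ≤ C := by
    filter_upwards [hm] with x hx hxE
    have h1 := hx hxE
    have h2 := abs_le.1 (le_refl |m|)
    rw [abs_le]
    constructor <;> linarith
  refine ⟨S₂, θ, hθ, hle₁.trans hle₂, ?_, hEB₂, ?_, ?_, ?_, ?_, ?_⟩
  · filter_upwards [hm, hs₁, hs₂] with x hx hx1 hx2 hxE
    have h1 := hx hxE
    by_cases hxE₁ : x ∈ E₁
    · obtain ⟨h2, h3⟩ := hx1 hxE₁
      have h4 : m + η ≤ S.s x := hxE₁.2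
      have h5 := hA₁s _ h2
      have h6 := hs _ (hA₁A h2)
      rw [ho₂ x (fun h => h.2 hxE₁) (fun h => hEA' x hxE (hA₂A h)), h3]
      constructor <;> linarith [hθ.1, hθ.2]
    · obtain ⟨h2, h3⟩ := hx2 ⟨hxE, hxE₁⟩
      have h4 : S.s x < m + η := by
        by_contra hc
        exact hxE₁ ⟨hxE, not_lt.1 hc⟩
      have h5 := hA₂s _ h2
      have h6 := hs _ (hA₂A h2)
      rw [hsE₂ x ⟨hxE, hxE₁⟩, hsA₂ _ h2] at h3
      rw [h3]
      constructor <;> linarith [hθ.1, hθ.2]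
  · refine measure_mono_null ?_ (measure_union_null hn₁ hn₂)
    rintro x ⟨hx, hx'⟩
    by_cases hxA : x ∈ A₁
    · exact Or.inl ⟨hxA, hle₂.subset hx'⟩
    · exact Or.inr ⟨⟨hx, hxA⟩, hx'⟩
  · intro x hx hx'
    rw [ho₂ x (fun h => hx (hE₂E h)) (fun h => hx' (hA₂A h)),
      ho₁ x (fun h => hx (hE₁E h)) (fun h => hx' (hA₁A h))]
  · intro J hJ hsat
    have e1 := hJ₁ J hJ (hle₂.saturated hsat)
    have e2 := hJ₂ J hJ hsat
    have u1 : J ∩ A = (J ∩ A₁) ∪ (J ∩ A₂) := by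
      rw [← inter_union_distrib_left, hA₂, union_sdiff_cancel hA₁A]
    have u2 : J ∩ E = (J ∩ E₁) ∪ (J ∩ E₂) := by
      rw [← inter_union_distrib_left, hE₂, union_sdiff_cancel hE₁E]
    rw [u1, u2, measure_union (disjoint_sdiff_right.mono inter_subset_right inter_subset_right)
      (hJ.inter hA₂m), measure_union
      (disjoint_sdiff_right.mono inter_subset_right inter_subset_right) (hJ.inter hE₂m), e1, e2]
  · intro x hx
    rcases hb₁ x hx with ⟨h1, h2⟩ | ⟨h1, h2, h3⟩
    · have hxB : x ∈ S₁.B := h1 ▸ S₁.b_mem x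
      rcases hb₂ x hxB with h | h
      · exact Or.inl h
      · right
        rw [h.2.1]
        exact hE₂E h.1
    · right
      have h4 : τ₁ x ∈ S₂.B := hEB₂ ⟨hE (hE₁E h1), hEA' _ (hE₁E h1)⟩
      rw [← hle₂.b_eq, h2, S₂.b_of_mem _ h4]
      exact hE₁E h1
  · filter_upwards [hτ₁.quasiMeasurePreserving.ae hEabs, hτ₂.quasiMeasurePreserving.ae hEabs]
      with x hx1 hx2 hxB
    have hC0 : 0 ≤ C := by linarith [abs_nonneg m]
    rcases hb₁ x hxB with ⟨h1, h2⟩ | ⟨h1, h2, h3⟩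
    · have hxB : x ∈ S₁.B := h1 ▸ S₁.b_mem x
      rcases hb₂ x hxB with h | h
      · rw [h.2, abs_zero]
        exact hC0
      · rw [h.2.2, abs_neg, hsE₂ _ h.1]
        exact hx2 (hE₂E h.1)
    · have h4 : τ₁ x ∈ S₂.B := hEB₂ ⟨hE (hE₁E h1), hEA' _ (hE₁E h1)⟩
      rw [hle₂.g_eq, h2, S₂.g_of_mem _ h4, add_zero, h3, abs_neg]
      exact hx1 (hE₁E h1)

end TowerState

/-- Absolute continuity of the integral, in quantitative form. -/
theorem exists_setIntegral_le_of_measureReal_le {μ : Measure ℝ} [IsFiniteMeasure μ] {k : ℝ → ℝ}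
    (hk : Integrable k μ) {ε : ℝ} (hε : 0 < ε) :
    ∃ δ > 0, ∀ Z : Set ℝ, μ.real Z ≤ δ → ∫ x in Z, k x ∂μ ≤ ε := by
  have h := hk.tendsto_setIntegral_nhds_zero (l := comap μ (𝓝 0)) (s := id) tendsto_comap
  have h2 := h.eventually_lt_const hε
  rw [eventually_comap, ENNReal.nhds_zero_basis_Iic.eventually_iff] at h2
  obtain ⟨d, hd0, hd⟩ := h2
  have hd1 : min d 1 ≠ ⊤ := ne_top_of_le_ne_top ENNReal.one_ne_top (min_le_right _ _)
  refine ⟨(min d 1).toReal, ENNReal.toReal_pos (lt_min hd0 one_pos).ne' hd1, fun Z hZ => ?_⟩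
  refine (hd (x := μ Z) ?_ Z rfl).le
  rw [measureReal_def, ENNReal.toReal_le_toReal (measure_ne_top _ _) hd1] at hZ
  exact hZ.trans (min_le_left _ _)

namespace TowerState

variable {μ : Measure ℝ} {f : ℝ → ℝ} [IsProbabilityMeasure μ]

/-- The cycles based in the pieces from `u` have been joined to cycles based in `E ∈ u`, with
sums within `2 * η` of `m`. -/
structure Joined (S₀ S : TowerState μ f) (E : Set ℝ) (u : Finset (Set ℝ)) (m η C : ℝ) : Prop where
  le : Le S₀ S
  spread : ∀ᵐ x ∂μ, x ∈ E → m ≤ S.s x ∧ S.s x ≤ m + 2 * η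
  subset_B : E ⊆ S.B
  sdiff_subset_B : S₀.B \ (⋃ A ∈ u, A) ⊆ S.B
  s_eq : ∀ x, x ∉ (⋃ A ∈ u, A) → S.s x = S₀.s x
  null : ∀ A ∈ u, A ≠ E → μ (A ∩ S.B) = 0
  proportion : ∀ J, MeasurableSet J → (∀ x, x ∈ J ↔ S.b x ∈ J) → ∀ A ∈ u, μ (J ∩ A) = μ (J ∩ E)
  base : ∀ x ∈ S₀.B, (S.b x = x ∧ S.g x = 0) ∨ S.b x ∈ E
  shift : ∀ᵐ x ∂μ, x ∈ S₀.B → |S.g x| ≤ C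

/-- The joined cycles keep their bases in `E`, so a further piece is attached behind the existing
cycles. Values of `g` at bases joined earlier do not change. -/
theorem Joined.insert [NullSingletonClass μ]
    [DecidableEq (Set ℝ)] {S₀ S : TowerState μ f} {E : Set ℝ} {u : Finset (Set ℝ)}
    {m η C : ℝ}
    (h : Joined S₀ S E u m η C) (hEm : MeasurableSet E) (hEu : E ∈ u) {A : Set ℝ}
    (hAm : MeasurableSet A) (hA : A ⊆ S₀.B) (hAu : ∀ A' ∈ u, Disjoint A A')
    (hEA : μ.real E = μ.real A) (hη : 0 ≤ η) (hC : |m| + 2 * η ≤ C) {lo hi : ℝ}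
    (hlh : lo ≤ hi) (hlη : hi ≤ lo + η) (hs : ∀ x ∈ A, lo ≤ S₀.s x ∧ S₀.s x ≤ hi) :
    ∃ S', ∃ θ ∈ Icc lo hi, Joined S₀ S' E (insert A u) (m + θ) η C := by
  have hAU : ∀ x ∈ A, x ∉ ⋃ A ∈ u, A := by
    intro x hx hx'
    simp only [mem_iUnion] at hx'
    obtain ⟨A', hA', hxA'⟩ := hx'
    exact disjoint_left.1 (hAu A' hA') hx hxA'
  have hAB : A ⊆ S.B := fun x hx => h.sdiff_subset_B ⟨hA hx, hAU x hx⟩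
  obtain ⟨S', θ, hθ, hle, hsp, hB, hn, ho, hJ, hb, hg⟩ := S.exists_glue_of_spread hEm hAm h.subset_B hAB
    (hAu E hEu).symm hEA hη h.spread hC hlh hlη (fun x hx => by
      rw [h.s_eq x (hAU x hx)]
      exact hs x hx)
  have hUE : E ⊆ ⋃ A ∈ u, A := fun x hx => mem_biUnion hEu hx
  have hEB : E ⊆ S'.B := fun x hx => hB ⟨h.subset_B hx, disjoint_left.1 (hAu E hEu).symm hx⟩
  refine ⟨S', θ, hθ, h.le.trans hle, hsp, hEB, ?_, ?_, ?_, ?_, ?_, ?_⟩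
  · rintro x ⟨hx, hx'⟩
    rw [Finset.set_biUnion_insert, mem_union, not_or] at hx'
    exact hB ⟨h.sdiff_subset_B ⟨hx, hx'.2⟩, hx'.1⟩
  · intro x hx
    rw [Finset.set_biUnion_insert, mem_union, not_or] at hx
    rw [ho x (fun hE => hx.2 (hUE hE)) hx.1, h.s_eq x hx.2]
  · intro A' hA' hne
    rcases Finset.mem_insert.1 hA' with rfl | hA'
    · exact hn
    · exact measure_mono_null (inter_subset_inter_right _ hle.subset) (h.null A' hA' hne)
  · intro J hJm hsat A' hA'
    rcases Finset.mem_insert.1 hA' with rfl | hA'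
    · exact hJ J hJm hsat
    · exact h.proportion J hJm (hle.saturated hsat) A' hA'
  · intro x hx
    rcases h.base x hx with ⟨h1, h2⟩ | h1
    · have hxB : x ∈ S.B := h1 ▸ S.b_mem x
      rcases hb x hxB with h3 | h3
      · exact Or.inl h3
      · exact Or.inr h3
    · right
      rw [← hle.b_eq, S'.b_of_mem _ (hEB h1)]
      exact h1
  · filter_upwards [h.shift, hg] with x hx hx' hxB
    rcases h.base x hxB with ⟨h1, h2⟩ | h1
    · exact hx' (h1 ▸ S.b_mem x)
    · rw [hle.g_eq, S'.g_of_mem _ (hEB h1), add_zero]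
      exact hx hxB

/-- Join pieces greedily until all remaining pieces have sums of the same sign. -/
theorem exists_joined [NullSingletonClass μ]
    (S₀ : TowerState μ f) {Q : Finset (Set ℝ)} {ω η K : ℝ} {lo hi : Set ℝ → ℝ}
    (hη : 0 ≤ η) (hQ : ∀ A ∈ Q, MeasurableSet A ∧ A ⊆ S₀.B ∧ μ.real A = ω)
    (hd : (Q : Set (Set ℝ)).PairwiseDisjoint id)
    (hlo : ∀ A ∈ Q, lo A ≤ hi A ∧ hi A ≤ lo A + η ∧ -K ≤ lo A ∧ hi A ≤ K ∧ (0 ≤ lo A ∨ hi A ≤ 0))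
    (hs : ∀ A ∈ Q, ∀ x ∈ A, lo A ≤ S₀.s x ∧ S₀.s x ≤ hi A) {E : Set ℝ} (hE : E ∈ Q) :
    ∃ u ⊆ Q, E ∈ u ∧ ∃ S m, Joined S₀ S E u m η (K + 2 * η) ∧ |m| ≤ K ∧
      ((∀ A ∈ Q, A ∉ u → ¬ hi A ≤ 0) ∨ ∀ A ∈ Q, A ∉ u → ¬ 0 ≤ lo A) := by
  classical
  set R : Finset (Set ℝ) → Prop := fun u => E ∈ u ∧ ∃ S m, Joined S₀ S E u m η (K + 2 * η) ∧ |m| ≤ K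
    with hR
  have hK : 0 ≤ K := by
    have := hlo E hE
    linarith
  have hR0 : R {E} := by
    refine ⟨Finset.mem_singleton_self E, S₀, lo E, ⟨Le.refl _, ?_, (hQ E hE).2.1, sdiff_subset, fun _ _ => rfl,
      ?_, ?_, fun x hx => Or.inl ⟨S₀.b_of_mem x hx, S₀.g_of_mem x hx⟩, ?_⟩, ?_⟩
    · refine Eventually.of_forall fun x hx => ?_
      have h1 := hs E hE x hx
      have h2 := hlo E hE
      constructor <;> linarith
    · intro A hA hne
      exact absurd (Finset.mem_singleton.1 hA) hne
    · intro J _ _ A hA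
      rw [Finset.mem_singleton.1 hA]
    · refine Eventually.of_forall fun x hx => ?_
      rw [S₀.g_of_mem x hx, abs_zero]
      linarith
    · rw [abs_le]
      have h2 := hlo E hE
      constructor <;> linarith
  -- A family of maximal cardinality with `|m| ≤ K` is taken. A remaining piece of sign opposite to
  -- `m` could be added without violating this bound, so all remaining pieces share one sign.
  obtain ⟨u, hu, hmax⟩ := Finset.exists_max_image (Q.powerset.filter R) Finset.card
    ⟨{E}, Finset.mem_filter.2 ⟨Finset.mem_powerset.2 (Finset.singleton_subset_iff.2 hE), hR0⟩⟩
  obtain ⟨huQ, hEu, S, m, hj, hm⟩ := Finset.mem_filter.1 hu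
  rw [Finset.mem_powerset] at huQ
  refine ⟨u, huQ, hEu, S, m, hj, hm, ?_⟩
  have key : ∀ A ∈ Q, A ∉ u → ¬ ((0 ≤ m ∧ hi A ≤ 0) ∨ (m ≤ 0 ∧ 0 ≤ lo A)) := by
    intro A hA hAu hcon
    obtain ⟨l1, l2, l3, l4, -⟩ := hlo A hA
    obtain ⟨S', θ, hθ, hj'⟩ := hj.insert (hQ E hE).1 hEu (hQ A hA).1 (hQ A hA).2.1
      (fun A' hA' => hd hA (huQ hA') (fun h => hAu (h ▸ hA')))
      ((hQ E hE).2.2.trans (hQ A hA).2.2.symm) hη (by linarith) l1 l2 (hs A hA)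
    have hm' : |m + θ| ≤ K := by
      rw [abs_le] at hm ⊢
      rcases hcon with h | h
      · constructor <;> linarith [hθ.1, hθ.2]
      · constructor <;> linarith [hθ.1, hθ.2]
    have := hmax (insert A u) (Finset.mem_filter.2 ⟨Finset.mem_powerset.2
      (Finset.insert_subset hA huQ), Finset.mem_insert_of_mem hEu, S', m + θ, hj', hm'⟩)
    rw [Finset.card_insert_of_notMem hAu] at this
    omega
  rcases le_total 0 m with h | h
  · exact Or.inl fun A hA hAu h' => key A hA hAu (Or.inl ⟨h, h'⟩)
  · exact Or.inr fun A hA hAu h' => key A hA hAu (Or.inr ⟨h, h'⟩)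

/-- The pieces that are left over carry a small part of the integral of the sums. -/
theorem Joined.integral_abs_le {S₀ S : TowerState μ f} {E : Set ℝ} {u Q : Finset (Set ℝ)}
    {m η C C' ω σ : ℝ} (h : Joined S₀ S E u m η C) (hEu : E ∈ u) (huQ : u ⊆ Q)
    (hQ : ∀ A ∈ Q, MeasurableSet A ∧ A ⊆ S₀.B ∧ μ.real A = ω)
    (hσ : ∀ᵐ x ∂μ, |S₀.s x| ≤ σ) (hC' : |m| + 2 * η ≤ C')
    (hsign : (∀ A ∈ Q, A ∉ u → ∀ x ∈ A, 0 < S₀.s x) ∨ ∀ A ∈ Q, A ∉ u → ∀ x ∈ A, S₀.s x < 0) :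
    ∫ x in (⋃ A ∈ Q, A) \ ⋃ A ∈ u, A, |S₀.s x| ∂μ ≤ C' * ω + σ * μ.real (S₀.B \ ⋃ A ∈ Q, A) := by
  set M := ⋃ A ∈ u, A with hM
  set W := ⋃ A ∈ Q, A with hW
  set L := W \ M with hL
  set U := S₀.B \ W with hU
  have hMm : MeasurableSet M := u.measurableSet_biUnion fun A hA => (hQ A (huQ hA)).1
  have hWm : MeasurableSet W := Q.measurableSet_biUnion fun A hA => (hQ A hA).1
  have hLm : MeasurableSet L := hWm.diff hMm
  have hUm : MeasurableSet U := S₀.measB.diff hWm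
  have hMW : M ⊆ W := fun x hx => by
    simp only [hM, hW, mem_iUnion] at hx ⊢
    obtain ⟨A, hA, hx⟩ := hx
    exact ⟨A, huQ hA, hx⟩
  have hWB : W ⊆ S₀.B := iUnion₂_subset fun A hA => (hQ A hA).2.1
  have hEM : E ⊆ M := fun x hx => mem_biUnion hEu hx
  obtain ⟨hEm, -, hEω⟩ := hQ E (huQ hEu)
  have hnull : ∀ᵐ x ∂μ, ∀ A ∈ u, A ≠ E → x ∉ A ∩ S.B := by
    rw [Finset.eventually_all]
    intro A hA
    by_cases hAE : A = E
    · exact Eventually.of_forall fun x hne => absurd hAE hne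
    · filter_upwards [measure_eq_zero_iff_ae_notMem.1 (h.null A hA hAE)] with x hx _
      exact hx
  -- After joining, the sums live on the uncut part `U`, the leftover pieces `L` and `E`. The total
  -- integral is zero and the sign on `L` is constant, so the integral of `|S₀.s|` over `L` is
  -- bounded by the other two contributions.
  have hdec : S.s =ᵐ[μ] fun x => U.indicator S₀.s x + L.indicator S₀.s x + E.indicator S.s x := by
    filter_upwards [hnull] with x hx
    by_cases hxM : x ∈ M
    · have h1 : x ∉ U := fun h => h.2 (hMW hxM)
      have h2 : x ∉ L := fun h => h.2 hxM
      rw [indicator_of_notMem h1, indicator_of_notMem h2]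
      by_cases hxE : x ∈ E
      · rw [indicator_of_mem hxE]
        ring
      · rw [indicator_of_notMem hxE]
        simp only [hM, mem_iUnion] at hxM
        obtain ⟨A, hA, hxA⟩ := hxM
        rw [S.s_of_notMem x fun hB => hx A hA (fun h => hxE (h ▸ hxA)) ⟨hxA, hB⟩]
        ring
    · have h3 : x ∉ E := fun h => hxM (hEM h)
      rw [indicator_of_notMem h3, h.s_eq x hxM]
      by_cases hxW : x ∈ W
      · rw [indicator_of_mem (show x ∈ L from ⟨hxW, hxM⟩), indicator_of_notMem fun h : x ∈ U => h.2 hxW]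
        ring
      · rw [indicator_of_notMem fun h : x ∈ L => hxW h.1]
        by_cases hxB : x ∈ S₀.B
        · rw [indicator_of_mem (show x ∈ U from ⟨hxB, hxW⟩)]
          ring
        · rw [indicator_of_notMem fun h : x ∈ U => hxB h.1, S₀.s_of_notMem x hxB]
          ring
  have i1 := S₀.integrable_s.indicator hUm
  have i2 := S₀.integrable_s.indicator hLm
  have i3 := S.integrable_s.indicator hEm
  have hsum : (∫ x in U, S₀.s x ∂μ) + (∫ x in L, S₀.s x ∂μ) + ∫ x in E, S.s x ∂μ = 0 := by
    rw [← S.integral_s, integral_congr_ae hdec]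
    have e1 := integral_add (i1.add i2) i3
    have e2 := integral_add i1 i2
    simp only [Pi.add_apply] at e1
    rw [e1, e2, integral_indicator hUm, integral_indicator hLm, integral_indicator hEm]
  have hUb : |∫ x in U, S₀.s x ∂μ| ≤ σ * μ.real U := by
    rw [← Real.norm_eq_abs]
    refine norm_setIntegral_le_of_norm_le_const_ae' (measure_lt_top _ _) ?_
    filter_upwards [hσ] with x hx _
    exact hx
  have hEb : |∫ x in E, S.s x ∂μ| ≤ C' * ω := by
    rw [← Real.norm_eq_abs, ← hEω]
    refine norm_setIntegral_le_of_norm_le_const_ae' (measure_lt_top _ _) ?_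
    filter_upwards [h.spread] with x hx hxE
    have h1 := hx hxE
    have h2 := abs_le.1 (le_refl |m|)
    rw [Real.norm_eq_abs, abs_le]
    constructor <;> linarith
  have hLA : ∀ x ∈ L, ∃ A ∈ Q, A ∉ u ∧ x ∈ A := by
    rintro x ⟨hx, hx'⟩
    simp only [hW, mem_iUnion] at hx
    obtain ⟨A, hA, hxA⟩ := hx
    exact ⟨A, hA, fun hAu => hx' (mem_biUnion hAu hxA), hxA⟩
  rcases hsign with hsg | hsg
  · have : ∫ x in L, |S₀.s x| ∂μ = ∫ x in L, S₀.s x ∂μ := by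
      refine setIntegral_congr_fun hLm fun x hx => ?_
      obtain ⟨A, hA, hAu, hxA⟩ := hLA x hx
      exact abs_of_pos (hsg A hA hAu x hxA)
    rw [this]
    rw [abs_le] at hUb hEb
    linarith
  · have : ∫ x in L, |S₀.s x| ∂μ = ∫ x in L, -S₀.s x ∂μ := by
      refine setIntegral_congr_fun hLm fun x hx => ?_
      obtain ⟨A, hA, hAu, hxA⟩ := hLA x hx
      exact abs_of_neg (hsg A hA hAu x hxA)
    rw [this, integral_neg]
    rw [abs_le] at hUb hEb
    linarith

/-- Joining cycles makes a given set `A` almost equidistributed over the cycles. -/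
theorem exists_mix [NullSingletonClass μ]
    (S₀ : TowerState μ f) {σ : ℝ} (hσ0 : 0 < σ) (hσ : ∀ᵐ x ∂μ, |S₀.s x| ≤ σ)
    (A : Set ℝ) {ε : ℝ} (hε0 : 0 < ε) (hε1 : ε ≤ 1) :
    ∃ S, Le S₀ S ∧ (∀ᵐ x ∂μ, |S.s x| ≤ 4 * σ) ∧ (∀ᵐ x ∂μ, |S.g x - S₀.g x| ≤ 4 * σ) ∧
      μ.real S.B ≤ ε ∧ ∀ J, MeasurableSet J → (∀ x, x ∈ J ↔ S.b x ∈ J) →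
        |μ.real (J ∩ A) - μ.real J * μ.real A| ≤ ε := by
  -- The densities `k` and `h` count the points of `A` and all points in a cycle. If a union of
  -- cycles meets the pieces in proportion `ρ`, its measure is close to `ρ` and its intersection
  -- with `A` has measure close to `ρ * μ.real A`.
  obtain ⟨k, hkm, hk0, hki, hkJ⟩ := S₀.exists_density A
  obtain ⟨h, hhm, hh0, hhi, hhJ⟩ := S₀.exists_density univ
  obtain ⟨δ₁, hδ₁, hkδ⟩ := exists_setIntegral_le_of_measureReal_le hki (ε := ε / 8) (by positivity)
  obtain ⟨δ₂, hδ₂, hhδ⟩ := exists_setIntegral_le_of_measureReal_le hhi (ε := ε / 8) (by positivity)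
  set δ₀ := min (min δ₁ δ₂) (ε / 2) with hδ₀
  have hδ₀0 : 0 < δ₀ := lt_min (lt_min hδ₁ hδ₂) (half_pos hε0)
  -- few cycles have a small non-zero sum
  obtain ⟨t, ht0, ht⟩ : ∃ t > 0, μ.real {x | 0 < |S₀.s x| ∧ |S₀.s x| < t} ≤ δ₀ / 3 := by
    have hlim : Tendsto (fun n : ℕ => μ.real {x | 0 < |S₀.s x| ∧ |S₀.s x| < 1 / ((n : ℝ) + 1)})
        atTop (𝓝 0) := by
      have h1 := tendsto_measure_iInter_atTop (μ := μ)
        (s := fun n : ℕ => {x | 0 < |S₀.s x| ∧ |S₀.s x| < 1 / ((n : ℝ) + 1)})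
        (fun n => ((measurableSet_lt measurable_const S₀.meas_s.abs).inter
          (measurableSet_lt S₀.meas_s.abs measurable_const)).nullMeasurableSet)
        (fun m n hmn x hx => ⟨hx.1, lt_of_lt_of_le hx.2 (by
          apply one_div_le_one_div_of_le (by positivity)
          have : (m : ℝ) ≤ n := by exact_mod_cast hmn
          linarith)⟩) ⟨0, measure_ne_top _ _⟩
      have he : (⋂ n : ℕ, {x | 0 < |S₀.s x| ∧ |S₀.s x| < 1 / ((n : ℝ) + 1)}) = ∅ := by
        ext x
        simp only [mem_iInter, mem_ofPred_eq, mem_empty_iff_false, iff_false, not_forall]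
        by_cases h0 : 0 < |S₀.s x|
        · obtain ⟨n, hn⟩ := exists_nat_one_div_lt h0
          exact ⟨n, fun h => by linarith [h.2]⟩
        · exact ⟨0, fun h => h0 h.1⟩
      rw [he, measure_empty] at h1
      have h2 := (ENNReal.tendsto_toReal ENNReal.zero_ne_top).comp h1
      rw [ENNReal.toReal_zero] at h2
      exact h2
    obtain ⟨n, hn⟩ := (hlim.eventually_lt_const (show 0 < δ₀ / 3 by positivity)).exists
    exact ⟨1 / ((n : ℝ) + 1), by positivity, hn.le⟩
  set η := min σ (ε / 16) with hη
  have hη0 : 0 < η := lt_min hσ0 (by positivity)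
  have hησ : η ≤ σ := min_le_left _ _
  have hηε : η ≤ ε / 16 := min_le_right _ _
  -- The leftover pieces carry at most `4 * σ * ω + σ * δ`, hence at most `5 * σ * δ`. The choice
  -- makes this at most `t * (δ₀ / 3)`, so Markov's inequality applies at the level `t`.
  set δ := min (δ₀ / 3) (t * δ₀ / (15 * σ)) with hδ
  have hδ0 : 0 < δ := lt_min (by positivity) (by positivity)
  have hδδ₀ : δ ≤ δ₀ / 3 := min_le_left _ _
  have hδt : 5 * σ * δ ≤ t * (δ₀ / 3) := by
    have h1 : δ ≤ t * δ₀ / (15 * σ) := min_le_right _ _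
    rw [le_div_iff₀ (by positivity)] at h1
    linarith
  -- Recording both floor and ceiling separates the sum zero from the others: a piece with a zero
  -- sum has `lo = hi = 0`, fits either sign and is never left over. The sums on leftover pieces are
  -- therefore strictly signed.
  set q : ℝ → (ℤ × ℤ) × ℤ × ℤ := fun x =>
    ((⌊S₀.s x / η⌋, ⌈S₀.s x / η⌉), ⌊k x / η⌋, ⌊h x / η⌋) with hq
  have hqm : Measurable q :=
    ((S₀.meas_s.div_const η).floor.prodMk (S₀.meas_s.div_const η).ceil).prodMk
      ((hkm.div_const η).floor.prodMk (hhm.div_const η).floor)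
  obtain ⟨ω, hω0, hωδ, Q, hQ, hQd, hQr⟩ := exists_pieces (μ := μ) (q := q)
    (fun i => hqm (measurableSet_singleton i)) S₀.measB hδ0
  choose! i hi using fun A hA => (hQ A hA).2.2.2
  have hQ' : ∀ A ∈ Q, MeasurableSet A ∧ A ⊆ S₀.B ∧ μ.real A = ω := fun A hA =>
    ⟨(hQ A hA).1, (hQ A hA).2.1, (hQ A hA).2.2.1⟩
  have hqi : ∀ A ∈ Q, ∀ x ∈ A, ⌊S₀.s x / η⌋ = (i A).1.1 ∧ ⌈S₀.s x / η⌉ = (i A).1.2 ∧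
      ⌊k x / η⌋ = (i A).2.1 ∧ ⌊h x / η⌋ = (i A).2.2 := by
    intro A hA x hx
    have h1 : q x = i A := hi A hA hx
    rw [← h1]
    exact ⟨rfl, rfl, rfl, rfl⟩
  have hfloor : ∀ v w : ℝ, ⌊v / η⌋ = ⌊w / η⌋ → |v - w| ≤ η := by
    intro v w hvw
    have h1 := Int.abs_sub_lt_one_of_floor_eq_floor hvw
    rw [← sub_div, abs_div, abs_of_pos hη0, div_lt_one hη0] at h1
    exact h1.le
  have hosck : ∀ A ∈ Q, ∀ x ∈ A, ∀ y ∈ A, |k x - k y| ≤ η := fun A hA x hx y hy =>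
    hfloor _ _ ((hqi A hA x hx).2.2.1.trans (hqi A hA y hy).2.2.1.symm)
  have hosch : ∀ A ∈ Q, ∀ x ∈ A, ∀ y ∈ A, |h x - h y| ≤ η := fun A hA x hx y hy =>
    hfloor _ _ ((hqi A hA x hx).2.2.2.trans (hqi A hA y hy).2.2.2.symm)
  set lo : Set ℝ → ℝ := fun A => (i A).1.1 * η with hlo
  set hi' : Set ℝ → ℝ := fun A => (i A).1.2 * η with hhi'
  have hs : ∀ A ∈ Q, ∀ x ∈ A, lo A ≤ S₀.s x ∧ S₀.s x ≤ hi' A := by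
    intro A hA x hx
    obtain ⟨h1, h2, -⟩ := hqi A hA x hx
    simp only [hlo, hhi', ← h1, ← h2]
    exact ⟨(le_div_iff₀ hη0).1 (Int.floor_le _), (div_le_iff₀ hη0).1 (Int.le_ceil _)⟩
  have hgood : ∀ A ∈ Q, ∃ x ∈ A, |S₀.s x| ≤ σ := by
    intro A hA
    by_contra hcon
    push Not at hcon
    have h1 : μ A = 0 := by
      refine measure_mono_null ?_ hσ
      exact fun x hx => not_le.2 (hcon x hx)
    have h2 := (hQ A hA).2.2.1
    rw [measureReal_def, h1] at h2
    simp at h2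
    linarith
  have hlohi : ∀ A ∈ Q, lo A ≤ hi' A ∧ hi' A ≤ lo A + η ∧ -(2 * σ) ≤ lo A ∧ hi' A ≤ 2 * σ ∧
      (0 ≤ lo A ∨ hi' A ≤ 0) := by
    intro A hA
    obtain ⟨x, hx, hxσ⟩ := hgood A hA
    obtain ⟨h1, h2, -⟩ := hqi A hA x hx
    obtain ⟨h3, h4⟩ := hs A hA x hx
    have h5 : hi' A ≤ lo A + η := by
      simp only [hlo, hhi']
      have : (i A).1.2 ≤ (i A).1.1 + 1 := by
        rw [← h1, ← h2]
        exact Int.ceil_le_floor_add_one _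
      have : ((i A).1.2 : ℝ) ≤ (i A).1.1 + 1 := by exact_mod_cast this
      nlinarith
    rw [abs_le] at hxσ
    refine ⟨h3.trans h4, h5, by linarith, by linarith, ?_⟩
    rcases le_or_gt 0 (i A).1.1 with h6 | h6
    · left
      have : (0 : ℝ) ≤ (i A).1.1 := by exact_mod_cast h6
      simp only [hlo]
      positivity
    · right
      have h7 : (i A).1.2 ≤ 0 := by
        have := Int.ceil_le_floor_add_one (S₀.s x / η)
        rw [h1, h2] at this
        omega
      have : ((i A).1.2 : ℝ) ≤ 0 := by exact_mod_cast h7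
      simp only [hhi']
      nlinarith
  have hBh : ∫ x in S₀.B, h x ∂μ = 1 := by
    have := hhJ univ MeasurableSet.univ (fun x => by simp)
    simpa using this.symm
  have hBk : ∫ x in S₀.B, k x ∂μ = μ.real A := by
    have := hkJ univ MeasurableSet.univ (fun x => by simp)
    simpa using this.symm
  have hQne : Q.Nonempty := by
    rw [Finset.nonempty_iff_ne_empty]
    rintro rfl
    simp only [Finset.notMem_empty, iUnion_of_empty, iUnion_empty, sdiff_empty] at hQr
    have := hhδ S₀.B (by
      have h1 : δ₀ ≤ δ₂ := (min_le_left _ _).trans (min_le_right _ _)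
      linarith)
    linarith
  obtain ⟨E, hE⟩ := hQne
  obtain ⟨u, huQ, hEu, S, m, hj, hm, hrem⟩ := S₀.exists_joined hη0.le hQ' hQd hlohi hs hE
  have hsign : (∀ A ∈ Q, A ∉ u → ∀ x ∈ A, 0 < S₀.s x) ∨
      ∀ A ∈ Q, A ∉ u → ∀ x ∈ A, S₀.s x < 0 := by
    refine hrem.imp (fun H A hA hAu x hx => ?_) fun H A hA hAu x hx => ?_
    · by_contra hcon
      refine H A hA hAu ?_
      have h1 : (i A).1.2 ≤ 0 := by
        rw [← (hqi A hA x hx).2.1, Int.ceil_le]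
        exact_mod_cast div_nonpos_of_nonpos_of_nonneg (not_lt.1 hcon) hη0.le
      have : ((i A).1.2 : ℝ) ≤ 0 := by exact_mod_cast h1
      simp only [hhi']
      nlinarith
    · by_contra hcon
      refine H A hA hAu ?_
      have h1 : 0 ≤ (i A).1.1 := by
        rw [← (hqi A hA x hx).1]
        exact Int.floor_nonneg.2 (div_nonneg (not_lt.1 hcon) hη0.le)
      have : (0 : ℝ) ≤ (i A).1.1 := by exact_mod_cast h1
      simp only [hlo]
      positivity
  have hL := hj.integral_abs_le hEu huQ hQ' hσ (C' := 4 * σ) (by linarith) hsign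
  set M := ⋃ A ∈ u, A with hM
  set W := ⋃ A ∈ Q, A with hW
  have hMm : MeasurableSet M := u.measurableSet_biUnion fun A hA => (hQ A (huQ hA)).1
  have hWm : MeasurableSet W := Q.measurableSet_biUnion fun A hA => (hQ A hA).1
  have hLint : ∫ x in W \ M, |S₀.s x| ∂μ ≤ t * (δ₀ / 3) := by
    have h1 : σ * μ.real (S₀.B \ W) ≤ σ * δ := by gcongr
    have h2 : 4 * σ * ω ≤ 4 * σ * δ := by gcongr
    linarith
  have hLbig : μ.real ((W \ M) ∩ {x | t ≤ |S₀.s x|}) ≤ δ₀ / 3 := by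
    have hm1 : MeasurableSet ((W \ M) ∩ {x | t ≤ |S₀.s x|}) :=
      (hWm.diff hMm).inter (measurableSet_le measurable_const S₀.meas_s.abs)
    have h1 : t * μ.real ((W \ M) ∩ {x | t ≤ |S₀.s x|}) ≤
        ∫ x in (W \ M) ∩ {x | t ≤ |S₀.s x|}, |S₀.s x| ∂μ := by
      have h2 : ∫ x in (W \ M) ∩ {x | t ≤ |S₀.s x|}, t ∂μ =
          t * μ.real ((W \ M) ∩ {x | t ≤ |S₀.s x|}) := by
        rw [setIntegral_const, smul_eq_mul, mul_comm]
      rw [← h2]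
      exact setIntegral_mono_on (integrable_const _).integrableOn S₀.integrable_s.abs.integrableOn
        hm1 fun x hx => hx.2
    have h3 : ∫ x in (W \ M) ∩ {x | t ≤ |S₀.s x|}, |S₀.s x| ∂μ ≤ ∫ x in W \ M, |S₀.s x| ∂μ :=
      setIntegral_mono_set S₀.integrable_s.abs.integrableOn
        (Eventually.of_forall fun x => abs_nonneg _) (Eventually.of_forall inter_subset_left)
    exact le_of_mul_le_mul_left (h1.trans (h3.trans hLint)) ht0
  -- The base outside the joined pieces consists of the uncut part, leftover small nonzero sums and
  -- leftover large sums, each of measure at most `δ₀ / 3`.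
  have hrest : μ.real (S₀.B \ M) ≤ δ₀ := by
    have hsub : S₀.B \ M ⊆ (S₀.B \ W) ∪ ({x | 0 < |S₀.s x| ∧ |S₀.s x| < t} ∪
        ((W \ M) ∩ {x | t ≤ |S₀.s x|})) := by
      rintro x ⟨hx, hxM⟩
      by_cases hxW : x ∈ W
      · right
        rcases lt_or_ge (|S₀.s x|) t with h1 | h1
        · left
          refine ⟨?_, h1⟩
          simp only [hW, mem_iUnion] at hxW
          obtain ⟨A', hA', hxA'⟩ := hxW
          have hAu : A' ∉ u := fun h => hxM (mem_biUnion h hxA')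
          rcases hsign with H | H
          · exact abs_pos.2 (H A' hA' hAu x hxA').ne'
          · exact abs_pos.2 (H A' hA' hAu x hxA').ne
        · exact Or.inr ⟨⟨hxW, hxM⟩, h1⟩
      · exact Or.inl ⟨hx, hxW⟩
    have h1 := measureReal_mono (μ := μ) hsub
    have h2 := measureReal_union_le (μ := μ) (S₀.B \ W) ({x | 0 < |S₀.s x| ∧ |S₀.s x| < t} ∪
        ((W \ M) ∩ {x | t ≤ |S₀.s x|}))
    have h3 := measureReal_union_le (μ := μ) {x | 0 < |S₀.s x| ∧ |S₀.s x| < t}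
        ((W \ M) ∩ {x | t ≤ |S₀.s x|})
    linarith
  have hrk : ∫ x in S₀.B \ M, k x ∂μ ≤ ε / 8 :=
    hkδ _ (hrest.trans ((min_le_left _ _).trans (min_le_left _ _)))
  have hrh : ∫ x in S₀.B \ M, h x ∂μ ≤ ε / 8 :=
    hhδ _ (hrest.trans ((min_le_left _ _).trans (min_le_right _ _)))
  have hEM : E ⊆ M := fun x hx => mem_biUnion hEu hx
  have hnull : ∀ᵐ x ∂μ, x ∈ M → x ∉ E → x ∉ S.B := by
    have : ∀ᵐ x ∂μ, ∀ A ∈ u, A ≠ E → x ∉ A ∩ S.B := by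
      rw [Finset.eventually_all]
      intro A hA
      by_cases hAE : A = E
      · exact Eventually.of_forall fun x hne => absurd hAE hne
      · filter_upwards [measure_eq_zero_iff_ae_notMem.1 (hj.null A hA hAE)] with x hx _
        exact hx
    filter_upwards [this] with x hx hxM hxE hxB
    simp only [hM, mem_iUnion] at hxM
    obtain ⟨A', hA', hxA'⟩ := hxM
    exact hx A' hA' (fun h => hxE (h ▸ hxA')) ⟨hxA', hxB⟩
  refine ⟨S, hj.le, ?_, ?_, ?_, ?_⟩
  · filter_upwards [hnull, hσ, hj.spread] with x hx hxσ hxs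
    by_cases hxM : x ∈ M
    · by_cases hxE : x ∈ E
      · have h1 := hxs hxE
        rw [abs_le] at hm ⊢
        constructor <;> linarith
      · rw [S.s_of_notMem x (hx hxM hxE), abs_zero]
        positivity
    · rw [hj.s_eq x hxM]
      linarith
  · refine hj.le.ae_abs_sub_le ?_
    filter_upwards [hj.shift] with x hx hxB
    linarith [hx hxB]
  · have hsub : S.B ≤ᵐ[μ] ((S₀.B \ M) ∪ E : Set ℝ) := by
      filter_upwards [hnull] with x hx hxB
      by_cases hxM : x ∈ M
      · right
        by_contra hxE
        exact hx hxM hxE hxB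
      · exact Or.inl ⟨hj.le.subset hxB, hxM⟩
    have h1 : μ.real S.B ≤ μ.real ((S₀.B \ M) ∪ E) :=
      ENNReal.toReal_mono (measure_ne_top _ _) (measure_mono_ae hsub)
    have h2 := measureReal_union_le (μ := μ) (S₀.B \ M) E
    have h3 : δ₀ ≤ ε / 2 := min_le_right _ _
    rw [(hQ' E hE).2.2] at h2
    linarith
  · intro J hJ hsat
    have hsat₀ := hj.le.saturated hsat
    set ρ := μ.real (J ∩ E) / ω with hρ
    have hρ0 : 0 ≤ ρ := div_nonneg measureReal_nonneg hω0.le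
    have hρ1 : ρ ≤ 1 := by
      rw [hρ, div_le_one hω0, ← (hQ' E hE).2.2]
      exact measureReal_mono inter_subset_right
    have hJA : ∀ A ∈ u, μ.real (J ∩ A) = ρ * ω := by
      intro A hA
      rw [hρ, div_mul_cancel₀ _ hω0.ne', measureReal_def, measureReal_def,
        hj.proportion J hJ hsat A hA]
    have hud : (u : Set (Set ℝ)).PairwiseDisjoint id := hQd.subset (Finset.coe_subset.2 huQ)
    have b1 := abs_setIntegral_inter_sub_le hki hk0 S₀.measB hJ hω0 hη0.le hρ0 hρ1
      (fun A hA => hQ' A (huQ hA)) hud (fun A hA => hosck A (huQ hA)) hJA hrk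
    have b2 := abs_setIntegral_inter_sub_le hhi hh0 S₀.measB hJ hω0 hη0.le hρ0 hρ1
      (fun A hA => hQ' A (huQ hA)) hud (fun A hA => hosch A (huQ hA)) hJA hrh
    rw [← hkJ J hJ hsat₀, hBk] at b1
    rw [← hhJ J hJ hsat₀, hBh, inter_univ, mul_one] at b2
    have e : μ.real (J ∩ A) - μ.real J * μ.real A =
      (μ.real (J ∩ A) - ρ * μ.real A) - (μ.real J - ρ) * μ.real A := by ring
    have h3 : |(μ.real J - ρ) * μ.real A| ≤ 2 * η + ε / 8 := by
      rw [abs_mul, abs_of_nonneg (measureReal_nonneg (μ := μ) (s := A))]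
      calc _ ≤ (2 * η + ε / 8) * 1 :=
            mul_le_mul b2 measureReal_le_one measureReal_nonneg (by positivity)
        _ = _ := mul_one _
    rw [e]
    calc _ ≤ |μ.real (J ∩ A) - ρ * μ.real A| + |(μ.real J - ρ) * μ.real A| := abs_sub _ _
      _ ≤ ε := by linarith

end TowerState

/-! ### Truncation and the loss of one in the exponent -/

/-- A nonzero function of mean zero is negative on a set of positive measure, which the slices
exhaust. The conclusion for all large `n` allows a common slice for `f` and `-f`. -/
theorem exists_forall_measure_between_pos {μ : Measure ℝ} {h : ℝ → ℝ} (hi : Integrable h μ)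
    (h0 : ∫ x, h x ∂μ = 0) (hne : ¬ h =ᵐ[μ] 0) :
    ∃ n₀ : ℕ, ∀ n ≥ n₀, 0 < μ {x | -((n : ℝ) + 1) ≤ h x ∧ h x < -(1 / ((n : ℝ) + 1))} := by
  set D : ℕ → Set ℝ := fun n => {x | -((n : ℝ) + 1) ≤ h x ∧ h x < -(1 / ((n : ℝ) + 1))} with hD
  have hmono : Monotone D := by
    intro m n hmn x hx
    have h1 : (m : ℝ) ≤ n := by exact_mod_cast hmn
    have h2 : 1 / ((n : ℝ) + 1) ≤ 1 / ((m : ℝ) + 1) :=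
      one_div_le_one_div_of_le (by positivity) (by linarith)
    exact ⟨by linarith [hx.1], by linarith [hx.2]⟩
  have hU : μ (⋃ n, D n) ≠ 0 := by
    intro hz
    apply hne
    have hnn : 0 ≤ᵐ[μ] h := by
      refine measure_mono_null ?_ hz
      intro x hx
      have hx : h x < 0 := not_le.mp hx
      obtain ⟨a, ha⟩ := exists_nat_gt (-h x)
      obtain ⟨m, hm⟩ := exists_nat_one_div_lt (neg_pos.mpr hx)
      refine mem_iUnion.mpr ⟨max a m, ?_, ?_⟩
      · have : (a : ℝ) ≤ (max a m : ℕ) := by exact_mod_cast le_max_left a m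
        linarith
      · have h1 : (m : ℝ) ≤ (max a m : ℕ) := by exact_mod_cast le_max_right a m
        have h2 : 1 / (((max a m : ℕ) : ℝ) + 1) ≤ 1 / ((m : ℝ) + 1) :=
          one_div_le_one_div_of_le (by positivity) (by linarith)
        linarith
    exact (integral_eq_zero_iff_of_nonneg_ae hnn hi).mp h0
  have : ∃ n, μ (D n) ≠ 0 := by
    by_contra! hc
    exact hU (measure_iUnion_null hc)
  obtain ⟨n₀, hn₀⟩ := this
  exact ⟨n₀, fun n hn => (pos_iff_ne_zero.mpr hn₀).trans_le (measure_mono (hmono hn))⟩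

/-- Markov's inequality makes the tail set small, and the integral is absolutely continuous. -/
theorem exists_setIntegral_abs_tail_le {μ : Measure ℝ} [IsFiniteMeasure μ] {h : ℝ → ℝ}
    (hi : Integrable h μ) {δ : ℝ} (hδ : 0 < δ) (a : ℝ) :
    ∃ t ≥ a, ∀ Z ⊆ {x | t ≤ |h x|}, ∫ x in Z, |h x| ∂μ ≤ δ := by
  obtain ⟨d, hd, hZ⟩ := exists_setIntegral_le_of_measureReal_le hi.abs hδ
  set I := ∫ x, |h x| ∂μ with hI
  refine ⟨max a (max 1 (I / d)), le_max_left _ _, fun Z hsub => hZ Z ?_⟩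
  set t := max a (max 1 (I / d)) with ht
  have ht1 : 1 ≤ t := (le_max_left _ _).trans (le_max_right _ _)
  have htI : I / d ≤ t := (le_max_right _ _).trans (le_max_right _ _)
  have h1 := mul_meas_ge_le_integral_of_nonneg (ae_of_all μ fun x => abs_nonneg (h x)) hi.abs t
  have h2 : μ.real Z ≤ μ.real {x | t ≤ |h x|} := measureReal_mono hsub
  have h3 : I ≤ t * d := (div_le_iff₀ hd).mp htI
  have h4 : t * μ.real {x | t ≤ |h x|} ≤ t * d := h1.trans h3
  exact h2.trans (le_of_mul_le_mul_left h4 (by linarith))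

namespace TowerState

variable {μ : Measure ℝ} {f : ℝ → ℝ}

/-- The factor `h x / c` bounds the number of points absorbed by `x`; it raises the exponent from
`q` to `q + 1`. -/
theorem lintegral_rpow_mul_le {q c : ℝ} (hq : 0 ≤ q) (hc : 0 < c) (h : ℝ → ℝ) (P : Set ℝ) :
    ∫⁻ x in P, ‖h x‖ₑ ^ q * ENNReal.ofReal (h x / c) ∂μ ≤
      (∫⁻ x, ‖h x‖ₑ ^ (q + 1) ∂μ) * ENNReal.ofReal (1 / c) := by
  rw [← lintegral_mul_const' _ _ ENNReal.ofReal_ne_top]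
  refine (setLIntegral_le_lintegral _ _).trans (lintegral_mono fun x => ?_)
  rw [ENNReal.rpow_add_of_nonneg _ _ hq zero_le_one, ENNReal.rpow_one, mul_assoc]
  gcongr
  rw [div_eq_mul_one_div, ENNReal.ofReal_mul' (by positivity)]
  gcongr
  rw [Real.enorm_eq_ofReal_abs]
  exact ENNReal.ofReal_le_ofReal (le_abs_self _)

variable [IsFiniteMeasure μ] [NullSingletonClass μ]

/-- An integrable function of mean zero can be replaced by an essentially bounded one, at the cost of a
transfer function that is controlled by the values of `f` above a level. -/
theorem exists_truncate (hf : Measurable f) (hi : Integrable f μ) (h0 : ∫ x, f x ∂μ = 0) :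
    ∃ (S : TowerState μ f) (σ : ℝ), 0 < σ ∧ (∀ᵐ x ∂μ, |S.s x| ≤ σ) ∧
      ∀ q : ℝ, 0 < q → ∫⁻ x, ‖f x‖ₑ ^ (q + 1) ∂μ < ⊤ → ∫⁻ x, ‖S.g x‖ₑ ^ q ∂μ < ⊤ := by
  by_cases hne : f =ᵐ[μ] 0
  · refine ⟨discrete hf hi h0, 1, one_pos, ?_, fun q hq _ => ?_⟩
    · filter_upwards [hne] with x hx
      change |f x| ≤ 1
      rw [hx]
      simp
    · change ∫⁻ x, ‖(0 : ℝ)‖ₑ ^ q ∂μ < ⊤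
      simp [hq]
  obtain ⟨n₁, hn₁⟩ := exists_forall_measure_between_pos hi h0 hne
  obtain ⟨n₂, hn₂⟩ := exists_forall_measure_between_pos hi.neg
    (by simp only [Pi.neg_apply, integral_neg, h0, neg_zero])
    (fun h => hne (by filter_upwards [h] with x hx; simpa using hx))
  set n := max n₁ n₂
  set β : ℝ := (n : ℝ) + 1 with hβ
  set c : ℝ := 1 / ((n : ℝ) + 1) with hc
  have hc0 : 0 < c := by positivity
  have hβ0 : 0 < β := by positivity
  have hN : 0 < μ {x | -β ≤ f x ∧ f x < -c} := hn₁ n (le_max_left _ _)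
  have hN' : 0 < μ {x | -β ≤ -f x ∧ -f x < -c} := hn₂ n (le_max_right _ _)
  have hpos : ∀ h : ℝ → ℝ, Measurable h → Integrable h μ → 0 < μ {x | -β ≤ h x ∧ h x < -c} →
      0 < ∫ x in {x | -β ≤ h x ∧ h x < -c}, -h x ∂μ := by
    intro h hm hi hN
    have hNm : MeasurableSet {x | -β ≤ h x ∧ h x < -c} :=
      (measurableSet_le measurable_const hm).inter (measurableSet_lt hm measurable_const)
    have h1 : c * μ.real {x | -β ≤ h x ∧ h x < -c} ≤
        ∫ x in {x | -β ≤ h x ∧ h x < -c}, -h x ∂μ := by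
      have := setIntegral_mono_on (μ := μ) (s := {x | -β ≤ h x ∧ h x < -c}) (f := fun _ => c)
        (g := fun x => -h x) (integrable_const _).integrableOn hi.neg.integrableOn hNm
        (fun x hx => by linarith [hx.2])
      rw [setIntegral_const, smul_eq_mul, mul_comm] at this
      exact this
    exact lt_of_lt_of_le (mul_pos hc0 (ENNReal.toReal_pos hN.ne' (measure_ne_top _ _))) h1
  have hd1 := hpos f hf hi hN
  have hd2 := hpos (fun x => -f x) hf.neg hi.neg hN'
  -- The tails beyond `t` must not exceed the available mass of moderate values of the opposite
  -- sign. The bound `t ≥ 2 * β + 1` keeps the sums left by one absorption out of the range used by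
  -- the other.
  obtain ⟨t, ht, htail⟩ := exists_setIntegral_abs_tail_le hi (lt_min hd1 hd2) (2 * β + 1)
  have hsetf : ∀ h : ℝ → ℝ, Measurable h → Integrable h μ → (∀ x, |h x| = |f x|) →
      ∫ x in {x | t < h x}, (h x - 0) ∂μ ≤ ∫ x in {x | t < h x}, |f x| ∂μ := by
    intro h hm hi' habs
    refine setIntegral_mono_on (by simpa using hi'.integrableOn) hi.abs.integrableOn
      (measurableSet_lt measurable_const hm) fun x _ => ?_
    rw [← habs, sub_zero]
    exact le_abs_self _
  obtain ⟨S₁, -, hs₁, hoff₁, hab₁, hbt₁, hb₁, hcount₁⟩ := (discrete hf hi h0).exists_absorb (c := c) (β := β)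
    (γ := 0) (t := t) hc0 hβ0 le_rfl (by linarith) (by
      refine (hsetf f hf hi fun _ => rfl).trans ((htail _ ?_).trans (min_le_left _ _))
      intro x (hx : t < f x)
      exact hx.le.trans (le_abs_self _))
  change ∀ x, ¬ t < f x → ¬ (-β ≤ f x ∧ f x < -c) → S₁.s x = f x at hoff₁
  change ∀ x, t < f x → t - β ≤ S₁.s x ∧ S₁.s x ≤ f x at hab₁
  change ∀ x, (-β ≤ f x ∧ f x < -c) → S₁.s x = f x ∨ S₁.s x = 0 at hbt₁
  replace hb₁ : ∀ x, (S₁.b x = x ∧ S₁.g x = 0) ∨ ((-β ≤ f x ∧ f x < -c) ∧ x ∉ S₁.B ∧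
    t < f (S₁.b x) ∧ |S₁.g x| ≤ f (S₁.b x)) := fun x => hb₁ x (mem_univ x)
  have hlow : ∀ x, t < -S₁.s x ↔ t < -f x := by
    intro x
    by_cases h1 : t < f x
    · have := hab₁ x h1
      exact ⟨fun h => by linarith, fun h => by linarith⟩
    by_cases h2 : -β ≤ f x ∧ f x < -c
    · rcases hbt₁ x h2 with h | h <;> rw [h]
      exact ⟨fun h => by linarith, fun h => by linarith⟩
    · rw [hoff₁ x h1 h2]
  have hmid : ∀ x, (-β ≤ -S₁.s x ∧ -S₁.s x < -c) ↔ (-β ≤ -f x ∧ -f x < -c) := by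
    intro x
    by_cases h1 : t < f x
    · have := hab₁ x h1
      exact ⟨fun h => by linarith, fun h => by linarith⟩
    by_cases h2 : -β ≤ f x ∧ f x < -c
    · rcases hbt₁ x h2 with h | h <;> rw [h]
      exact ⟨fun h => by linarith, fun h => by linarith⟩
    · rw [hoff₁ x h1 h2]
  have hab : S₁.neg.above t = {x | t < -f x} := by
    ext x
    exact hlow x
  have hbt : S₁.neg.between c β = {x | -β ≤ -f x ∧ -f x < -c} := by
    ext x
    exact hmid x
  have hsf : ∀ x, (t < -f x ∨ (-β ≤ -f x ∧ -f x < -c)) → S₁.neg.s x = -f x := by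
    intro x hx
    change -S₁.s x = -f x
    rw [hoff₁ x]
    · intro h
      rcases hx with h' | h' <;> linarith
    · intro h
      rcases hx with h' | h' <;> linarith
  obtain ⟨S₂, hle₂, hs₂, hoff₂, hab₂, hbt₂, hb₂, hcount₂⟩ := S₁.neg.exists_absorb (c := c) (β := β)
    (γ := 0) (t := t) hc0 hβ0 le_rfl (by linarith) (by
      rw [hab, hbt]
      rw [setIntegral_congr_fun (g := fun x => -f x - 0) (s := {x | t < -f x})
        (measurableSet_lt measurable_const hf.neg)
        (fun x hx => by rw [hsf x (Or.inl hx)]),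
        setIntegral_congr_fun (g := fun x => -(-f x)) (s := {x | -β ≤ -f x ∧ -f x < -c})
        ((measurableSet_le measurable_const hf.neg).inter
          (measurableSet_lt hf.neg measurable_const))
        (fun x hx => by rw [hsf x (Or.inr hx)])]
      refine (hsetf (fun x => -f x) hf.neg hi.neg fun _ => abs_neg _).trans
        ((htail _ ?_).trans (min_le_right _ _))
      intro x (hx : t < -f x)
      exact hx.le.trans (neg_le_abs _))
  simp only [hab, hbt] at hoff₂ hab₂ hbt₂ hb₂ hcount₂
  obtain ⟨S, hle, hB, hs, hb, hg⟩ := hle₂.neg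
  refine ⟨S, t, by linarith, ?_, fun q hq hfq => ?_⟩
  · filter_upwards [hs₁, hs₂] with x h1 h2
    rw [hs, Pi.neg_apply, abs_neg, abs_le]
    refine ⟨?_, h2⟩
    by_cases h3 : t < -f x
    · linarith [(hab₂ x h3).1]
    by_cases h4 : -β ≤ -f x ∧ -f x < -c
    · rcases hbt₂ x h4 with h | h
      · rw [h, hsf x (Or.inr h4)]
        linarith [h4.1]
      · rw [h]
        linarith
    · rw [hoff₂ x h3 h4]
      change -t ≤ -S₁.s x
      linarith
  · set N := {x | -β ≤ f x ∧ f x < -c}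
    set N' := {x | -β ≤ -f x ∧ -f x < -c}
    -- At each point at most one of the two absorptions shifts `g`: a base that absorbed in the
    -- first round has `f > t` and is not absorbed in the second.
    have hpt : ∀ x, ‖S.g x‖ₑ ^ q ≤ (N \ S₁.B).indicator (fun y => ‖f (S₁.b y)‖ₑ ^ q) x +
        (N' \ S₂.B).indicator (fun y => ‖f (S₂.b y)‖ₑ ^ q) x := by
      intro x
      have hgx : S.g x = S₁.g x - S₂.g (S₁.b x) := by
        have := hle.g_eq x
        rw [this, hg]
        rfl
      have hfin : ∀ y z : ℝ, |y| ≤ z → ‖y‖ₑ ^ q ≤ ‖z‖ₑ ^ q := fun y z h => by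
        gcongr
        rw [Real.enorm_eq_ofReal_abs, Real.enorm_eq_ofReal_abs]
        exact ENNReal.ofReal_le_ofReal (h.trans (le_abs_self _))
      rcases hb₁ x with ⟨h1, h2⟩ | ⟨h1, h2, h3, h4⟩
      · rw [hgx, h1, h2, zero_sub, enorm_neg]
        have hxB : x ∈ S₁.B := h1 ▸ S₁.b_mem x
        rcases hb₂ x hxB with ⟨-, h5⟩ | ⟨h5, h6, h7, h8⟩
        · rw [h5]
          simp [hq]
        · rw [indicator_of_mem (show x ∈ N' \ S₂.B from ⟨h5, h6⟩)]
          refine le_add_left (le_trans (hfin _ _ h8) ?_)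
          rw [hsf _ (Or.inl h7), enorm_neg]
      · have hz : S₂.g (S₁.b x) = 0 := by
          rcases hb₂ _ (S₁.b_mem x) with ⟨-, h5⟩ | ⟨h5, -⟩
          · exact h5
          · exact absurd h5 fun h5 => by
              have := h5.1
              linarith
        rw [hgx, hz, sub_zero, indicator_of_mem (show x ∈ N \ S₁.B from ⟨h1, h2⟩)]
        exact le_add_right (hfin _ _ h4)
    have hNm : MeasurableSet N :=
      (measurableSet_le measurable_const hf).inter (measurableSet_lt hf measurable_const)
    have hNm' : MeasurableSet N' :=
      (measurableSet_le measurable_const hf.neg).inter (measurableSet_lt hf.neg measurable_const)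
    have hu : Measurable fun x => ‖f x‖ₑ ^ q := hf.enorm.pow_const q
    have hc1 := hcount₁ _ hu
    have hc2 := hcount₂ _ hu
    change ∫⁻ x in N \ S₁.B, ‖f (S₁.b x)‖ₑ ^ q ∂μ ≤
      ∫⁻ x in {x | t < f x}, ‖f x‖ₑ ^ q * ENNReal.ofReal (f x / c) ∂μ at hc1
    have hc3 : ∫⁻ x in N' \ S₂.B, ‖f (S₂.b x)‖ₑ ^ q ∂μ ≤
        ∫⁻ x in {x | t < -f x}, ‖-f x‖ₑ ^ q * ENNReal.ofReal (-f x / c) ∂μ := by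
      refine hc2.trans_eq (setLIntegral_congr_fun (measurableSet_lt measurable_const hf.neg) ?_)
      intro x hx
      simp only
      rw [hsf x (Or.inl hx), enorm_neg]
    have hfin1 := ENNReal.mul_lt_top hfq (ENNReal.ofReal_lt_top (r := 1 / c))
    refine (lintegral_mono hpt).trans_lt ?_
    have hub : Measurable fun x => ‖f (S₁.b x)‖ₑ ^ q := hu.comp S₁.qmp.measurable
    rw [lintegral_add_left (hub.indicator (hNm.diff S₁.measB)),
      lintegral_indicator (hNm.diff S₁.measB), lintegral_indicator (hNm'.diff S₂.measB)]
    refine ENNReal.add_lt_top.mpr ⟨?_, ?_⟩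
    · exact (hc1.trans (lintegral_rpow_mul_le hq.le hc0 f _)).trans_lt hfin1
    · refine (hc3.trans (lintegral_rpow_mul_le hq.le hc0 (fun x => -f x) _)).trans_lt ?_
      simpa only [enorm_neg] using hfin1

/-- For `p = ⊤` single points already have bounded sums and `g = 0` works. For `p = 1` the exponent
`p - 1` is zero and only measurability is required. Otherwise the truncation estimate applies with
`q = p - 1`. -/
theorem exists_bounded {p : ENNReal} (hp : 1 ≤ p) (hf : Measurable f) (hfp : MemLp f p μ)
    (h0 : ∫ x, f x ∂μ = 0) :
    ∃ (S : TowerState μ f) (σ : ℝ), 0 < σ ∧ (∀ᵐ x ∂μ, |S.s x| ≤ σ) ∧ MemLp S.g (p - 1) μ := by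
  have hi : Integrable f μ := hfp.integrable hp
  rcases eq_or_ne p ⊤ with rfl | hpt
  · refine ⟨discrete hf hi h0, (eLpNorm f ⊤ μ).toReal + 1, by positivity, ?_, MemLp.zero⟩
    rw [eLpNorm_exponent_top]
    have hfin : eLpNormEssSup f μ < ⊤ := by
      rw [← eLpNorm_exponent_top]
      exact hfp.2
    filter_upwards [ae_le_eLpNormEssSup (f := f) (μ := μ)] with x hx
    have := ENNReal.toReal_mono hfin.ne hx
    rw [toReal_enorm, Real.norm_eq_abs] at this
    change |f x| ≤ _
    linarith
  · obtain ⟨S, σ, hσ, hs, hg⟩ := exists_truncate hf hi h0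
    refine ⟨S, σ, hσ, hs, ?_⟩
    rcases eq_or_lt_of_le hp with rfl | hp1
    · rw [tsub_self, memLp_zero_iff_aestronglyMeasurable]
      exact S.meas_g.aestronglyMeasurable
    · have hq0 : p - 1 ≠ 0 := (tsub_pos_of_lt hp1).ne'
      have hqt : p - 1 ≠ ⊤ := ENNReal.sub_ne_top hpt
      refine ⟨S.meas_g.aestronglyMeasurable,
        (eLpNorm_lt_top_iff_lintegral_rpow_enorm_lt_top hq0 hqt).mpr ?_⟩
      refine hg _ (ENNReal.toReal_pos hq0 hqt) ?_
      have h1 : (p - 1).toReal + 1 = p.toReal := by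
        rw [ENNReal.toReal_sub_of_le hp hpt]
        simp
      rw [h1]
      exact (eLpNorm_lt_top_iff_lintegral_rpow_enorm_lt_top (by positivity) hpt).mp hfp.2

end TowerState

/-! ### The chain of decompositions and its limit map -/

namespace TowerState

variable {μ : Measure ℝ} {f : ℝ → ℝ}

theorem le_of_le_nat {S : ℕ → TowerState μ f} (hle : ∀ n, Le (S n) (S (n + 1))) {m n : ℕ}
    (hmn : m ≤ n) : Le (S m) (S n) := by
  induction n, hmn using Nat.le_induction with
  | base => exact Le.refl _
  | succ n _ ih => exact ih.trans (hle n)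

section

variable [IsProbabilityMeasure μ] [NullSingletonClass μ]

/-- Mixing, followed by a reduction of the sums. -/
theorem exists_mix_reduce (S₀ : TowerState μ f) {σ : ℝ} (hσ0 : 0 < σ)
    (hσ : ∀ᵐ x ∂μ, |S₀.s x| ≤ σ) (A : Set ℝ) {ε : ℝ} (hε0 : 0 < ε) (hε1 : ε ≤ 1) :
    ∃ S, Le S₀ S ∧ (∀ᵐ x ∂μ, |S.s x| ≤ σ * (1 / 2)) ∧ (∀ᵐ x ∂μ, |S.g x - S₀.g x| ≤ 36 * σ) ∧
      μ.real S.B ≤ ε ∧ ∀ J, MeasurableSet J → (∀ x, x ∈ J ↔ S.b x ∈ J) →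
        |μ.real (J ∩ A) - μ.real J * μ.real A| ≤ ε := by
  obtain ⟨S₁, hle₁, hs₁, hg₁, hB₁, hJ₁⟩ := S₀.exists_mix hσ0 hσ A hε0 hε1
  -- Eight reductions suffice because `4 * (3 / 4) ^ 8 < 1 / 2`. Their total shift is below `8 * (4
  -- * σ) = 32 * σ`, and mixing contributes another `4 * σ`.
  obtain ⟨S₂, hle₂, hs₂, hg₂⟩ := S₁.exists_reduce_pow (show 0 < 4 * σ by positivity) hs₁ 8
  refine ⟨S₂, hle₁.trans hle₂, ?_, ?_, (measureReal_mono hle₂.subset).trans hB₁,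
    fun J hJ hJb => hJ₁ J hJ (hle₂.saturated hJb)⟩
  · filter_upwards [hs₂] with x hx
    refine hx.trans ?_
    norm_num
    linarith
  · filter_upwards [hg₁, hg₂] with x h1 h2
    have h3 := abs_sub_le (S₂.g x) (S₁.g x) (S₀.g x)
    have h4 : 8 * (4 * σ) * (1 - (3 / 4) ^ 8) ≤ 32 * σ := by
      norm_num
      linarith
    linarith

/-- A sequence of decompositions into longer and longer cycles, with sums tending to zero, whose
cycles become equidistributed with respect to the half-lines `Iic (q n)`. -/
theorem exists_chain (S₀ : TowerState μ f) {σ : ℝ} (hσ0 : 0 < σ) (hσ : ∀ᵐ x ∂μ, |S₀.s x| ≤ σ)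
    (q : ℕ → ℝ) :
    ∃ S : ℕ → TowerState μ f, S 0 = S₀ ∧ (∀ n, Le (S n) (S (n + 1))) ∧
      (∀ n, ∀ᵐ x ∂μ, |(S n).s x| ≤ σ * (1 / 2) ^ n) ∧
      (∀ n, ∀ᵐ x ∂μ, |(S (n + 1)).g x - (S n).g x| ≤ 36 * σ * (1 / 2) ^ n) ∧
      (∀ n : ℕ, μ.real (S (n + 1)).B ≤ 1 / ((n : ℝ) + 1)) ∧
      ∀ n : ℕ, ∀ J, MeasurableSet J → (∀ x, x ∈ J ↔ (S (n + 1)).b x ∈ J) →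
        |μ.real (J ∩ Iic (q n)) - μ.real J * μ.real (Iic (q n))| ≤ 1 / ((n : ℝ) + 1) := by
  have step : ∀ (n : ℕ) (S : {S : TowerState μ f // ∀ᵐ x ∂μ, |S.s x| ≤ σ * (1 / 2) ^ n}),
      ∃ S' : {S : TowerState μ f // ∀ᵐ x ∂μ, |S.s x| ≤ σ * (1 / 2) ^ (n + 1)},
        Le S.1 S'.1 ∧ (∀ᵐ x ∂μ, |S'.1.g x - S.1.g x| ≤ 36 * σ * (1 / 2) ^ n) ∧
        μ.real S'.1.B ≤ 1 / ((n : ℝ) + 1) ∧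
        ∀ J, MeasurableSet J → (∀ x, x ∈ J ↔ S'.1.b x ∈ J) →
        |μ.real (J ∩ Iic (q n)) - μ.real J * μ.real (Iic (q n))| ≤ 1 / ((n : ℝ) + 1) := by
    rintro n ⟨S, hS⟩
    obtain ⟨S', h1, h2, h3, h4⟩ := S.exists_mix_reduce (by positivity) hS (Iic (q n))
      (ε := 1 / ((n : ℝ) + 1)) (by positivity)
      (by rw [div_le_one (by positivity)]; linarith [n.cast_nonneg (α := ℝ)])
    refine ⟨⟨S', ?_⟩, h1, ?_, h4⟩
    · simpa only [pow_succ, ← mul_assoc] using h2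
    · simpa only [mul_assoc] using h3
  choose next hle hg hB hJ using step
  let F : (n : ℕ) → {S : TowerState μ f // ∀ᵐ x ∂μ, |S.s x| ≤ σ * (1 / 2) ^ n} :=
    fun n => Nat.rec ⟨S₀, by simpa using hσ⟩ (fun n S => next n S) n
  exact ⟨fun n => (F n).1, rfl, fun n => hle n (F n), fun n => (F n).2, fun n => hg n (F n),
    fun n => hB n (F n), fun n => hJ n (F n)⟩

end

/-- The maps of a chain of decompositions converge if the measure of the bases tends to zero. -/
theorem exists_limit_map [IsFiniteMeasure μ] {S : ℕ → TowerState μ f}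
    (hle : ∀ n, Le (S n) (S (n + 1))) (hB : Tendsto (fun n => μ (S n).B) atTop (𝓝 0)) :
    ∃ (G : Set ℝ) (L : ℝ ≃ᵐ ℝ), MeasurableSet G ∧ μ Gᶜ = 0 ∧ MeasurePreserving L μ μ ∧
      (∀ n x, (S n).T x ∈ G ↔ x ∈ G) ∧ (∀ x ∈ G, ∀ᶠ n in atTop, (S n).T x = L x) := by
  -- At points of `V` both the map and its inverse are frozen from some stage on. The exceptional
  -- points lie, at every stage, in the base or in its preimage, whose measures tend to zero.
  set V : Set ℝ := (⋃ n, (S n).T ⁻¹' (S n).Bᶜ) ∩ ⋃ n, (S n).Bᶜ with hV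
  have hVm : MeasurableSet V :=
    (MeasurableSet.iUnion fun n => (S n).T.measurable (S n).measB.compl).inter
      (MeasurableSet.iUnion fun n => (S n).measB.compl)
  have hnull : ∀ D : ℕ → Set ℝ, (∀ n, μ (D n) = μ (S n).B) → μ (⋃ n, (D n)ᶜ)ᶜ = 0 := by
    intro D hD
    refine le_antisymm (ge_of_tendsto' hB fun n => ?_) bot_le
    rw [← hD n]
    refine measure_mono fun x hx => ?_
    simp only [compl_iUnion, compl_compl, mem_iInter] at hx
    exact hx n
  obtain ⟨G, L, -, -, hGm, hG0, hL, hGT, hTL, -⟩ := exists_limit_equiv (fun n => (S n).T)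
    (fun n => (S n).mp) hVm
    (by
      rw [hV, compl_inter]
      refine measure_union_null ?_ (hnull _ fun _ => rfl)
      exact hnull (fun n => (S n).T ⁻¹' (S n).B) fun n =>
        (S n).mp.measure_preimage (S n).measB.nullMeasurableSet)
    (by
      rintro x ⟨hx, -⟩
      obtain ⟨n, hn⟩ := mem_iUnion.mp hx
      exact ⟨(S n).T x, eventually_atTop.mpr ⟨n, fun m hm => (le_of_le_nat hle hm).T_eq x hn⟩⟩)
    (by
      rintro x ⟨-, hx⟩
      obtain ⟨n, hn⟩ := mem_iUnion.mp hx
      exact ⟨(S n).T.symm x, eventually_atTop.mpr ⟨n, fun m hm => (le_of_le_nat hle hm).symm_eq hn⟩⟩)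
  exact ⟨G, L, hGm, hG0, hL, hGT, hTL⟩

end TowerState

/-! ### Ergodicity and the theorem on the line -/

/-- Rational half-lines form a π-system generating the Borel sets, so `J` is independent of every
Borel set and in particular of itself. -/
theorem measure_eq_zero_or_one_of_indep_Iic {μ : Measure ℝ} [IsProbabilityMeasure μ] {J : Set ℝ}
    (hJ : MeasurableSet J) (h : ∀ a : ℚ, μ.real (J ∩ Iic (a : ℝ)) = μ.real J * μ.real (Iic (a : ℝ))) :
    μ J = 0 ∨ μ J = 1 := by
  have heq : μ.restrict J = μ J • μ := by
    refine ext_of_generate_finite _ Real.borel_eq_generateFrom_Iic_rat Real.isPiSystem_Iic_rat ?_ ?_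
    · intro A hA
      simp only [mem_iUnion, mem_singleton_iff] at hA
      obtain ⟨a, rfl⟩ := hA
      rw [Measure.restrict_apply measurableSet_Iic, inter_comm, Measure.smul_apply, smul_eq_mul]
      have := h a
      rw [measureReal_def, measureReal_def, measureReal_def, ← ENNReal.toReal_mul,
        ENNReal.toReal_eq_toReal_iff' (measure_ne_top _ _)
          (ENNReal.mul_ne_top (measure_ne_top _ _) (measure_ne_top _ _))] at this
      exact this
    · simp
  have h2 := congrArg (fun ν : Measure ℝ => ν J) heq
  simp only [Measure.restrict_apply hJ, inter_self, Measure.smul_apply, smul_eq_mul] at h2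
  by_cases h0 : μ J = 0
  · exact Or.inl h0
  · right
    have h3 : μ J * μ J = μ J * 1 := by rw [← h2, mul_one]
    exact (ENNReal.mul_right_inj h0 (measure_ne_top _ _)).mp h3

/-- A function of mean zero in `L^p` of an atomless probability measure on the line is a coboundary of
an ergodic map, with transfer function in `L^(p-1)`. -/
theorem exists_ergodic_coboundary_real {μ : Measure ℝ} [IsProbabilityMeasure μ]
    [NullSingletonClass μ] {p : ENNReal} (hp : 1 ≤ p) {f : ℝ → ℝ} (hf : Measurable f)
    (hfp : MemLp f p μ) (h0 : ∫ x, f x ∂μ = 0) :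
    ∃ (T : ℝ ≃ᵐ ℝ) (g : ℝ → ℝ), Ergodic T μ ∧ Measurable g ∧ MemLp g (p - 1) μ ∧
      ∀ᵐ x ∂μ, f x = g x - g (T x) := by
  obtain ⟨S₀, σ, hσ0, hσ, hg₀⟩ := TowerState.exists_bounded hp hf hfp h0
  obtain ⟨r, hr⟩ := exists_surjective_nat ℚ
  -- Through the pairing function every rational is treated at infinitely many stages, so the error
  -- for a fixed half-line tends to zero.
  obtain ⟨S, hS0, hle, hs, hg, hB, hJ⟩ := S₀.exists_chain hσ0 hσ fun n => (r n.unpair.1 : ℝ)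
  have hBlim : Tendsto (fun n => μ (S n).B) atTop (𝓝 0) := by
    rw [← tendsto_add_atTop_iff_nat 1]
    have h1 : Tendsto (fun n => μ.real (S (n + 1)).B) atTop (𝓝 0) :=
      squeeze_zero (fun _ => measureReal_nonneg) hB tendsto_one_div_add_atTop_nhds_zero_nat
    have h2 := ENNReal.tendsto_ofReal h1
    simpa only [ofReal_measureReal (measure_ne_top μ _), ENNReal.ofReal_zero] using h2
  obtain ⟨G, L, hGm, hG0, hL, hGT, hTL⟩ := TowerState.exists_limit_map hle hBlim
  have hGae : ∀ᵐ x ∂μ, x ∈ G := by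
    rw [ae_iff]
    exact hG0
  have hgeo : ∀ᵐ x ∂μ, ∀ n, dist ((S n).g x) ((S (n + 1)).g x) ≤ 36 * σ * (1 / 2) ^ n := by
    rw [ae_all_iff]
    intro n
    filter_upwards [hg n] with x hx
    rwa [dist_comm, Real.dist_eq]
  obtain ⟨g, hgm, hglim⟩ := measurable_limit_of_tendsto_metrizable_ae (μ := μ) (L := atTop)
    (f := fun n => (S n).g)
    (fun n => (S n).meas_g.aemeasurable) (by
      filter_upwards [hgeo] with x hx
      exact cauchySeq_tendsto_of_complete
        (cauchySeq_of_le_geometric _ _ (by norm_num : (1 / 2 : ℝ) < 1) hx))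
  refine ⟨L, g, ⟨hL, ⟨fun J hJm hJL => ?_⟩⟩, hgm, ?_, ?_⟩
  -- A step of `S n` that does not enter its base is a step of `L` at points of `G`, so invariance
  -- under `L` makes `J ∩ G` a union of cycles at each stage.
  · have hsat : ∀ n x, x ∈ J ∩ G ↔ (S n).b x ∈ J ∩ G := by
      intro n
      refine (S n).saturated _ fun y hy => ?_
      by_cases hyG : y ∈ G
      · have h1 : (S n).T y = L y := by
          obtain ⟨m, hm, hnm⟩ := ((hTL y hyG).and (eventually_ge_atTop n)).exists
          rw [← hm, (TowerState.le_of_le_nat hle hnm).T_eq y hy]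
        have h2 : y ∈ J ↔ L y ∈ J := by
          nth_rewrite 1 [← hJL]
          rfl
        rw [mem_inter_iff, mem_inter_iff, hGT, h1, h2]
      · rw [mem_inter_iff, mem_inter_iff, hGT]
        simp [hyG]
    have hJG : (J ∩ G : Set ℝ) =ᵐ[μ] J := by
      filter_upwards [hGae] with x hx
      exact propext ⟨fun h => h.1, fun h => ⟨h, hx⟩⟩
    have hind : ∀ a : ℚ, μ.real (J ∩ Iic (a : ℝ)) = μ.real J * μ.real (Iic (a : ℝ)) := by
      intro a
      obtain ⟨i, rfl⟩ := hr a
      rw [← sub_eq_zero, ← abs_nonpos_iff]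
      refine ge_of_tendsto' tendsto_one_div_add_atTop_nhds_zero_nat fun j : ℕ => ?_
      have h1 := hJ (Nat.pair i j) (J ∩ G) (hJm.inter hGm) (hsat _)
      rw [Nat.unpair_pair, measureReal_congr hJG,
        measureReal_congr (hJG.inter (ae_eq_refl (Iic (r i : ℝ))))] at h1
      refine h1.trans (one_div_le_one_div_of_le (by positivity) ?_)
      have : (j : ℝ) ≤ Nat.pair i j := by exact_mod_cast Nat.right_le_pair i j
      linarith
    rw [eventuallyConst_set']
    rcases measure_eq_zero_or_one_of_indep_Iic hJm hind with h | h
    · left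
      exact ae_eq_empty.mpr h
    · right
      rw [ae_eq_univ, prob_compl_eq_zero_iff hJm]
      exact h
  -- The shifts sum to at most `72 * σ`, so `g` differs from the initial transfer function by an
  -- essentially bounded function, which lies in every `L^q` of a finite measure.
  · have hbd : ∀ᵐ x ∂μ, ‖(g - S₀.g) x‖ ≤ 36 * σ / (1 - 1 / 2) := by
      filter_upwards [hgeo, hglim] with x h1 h2
      have := dist_le_of_le_geometric_of_tendsto₀ _ _ (by norm_num : (1 / 2 : ℝ) < 1) h1 h2
      rwa [hS0, dist_comm, dist_eq_norm] at this
    have h2 : MemLp (g - S₀.g) (p - 1) μ :=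
      MemLp.of_bound (hgm.sub S₀.meas_g).aestronglyMeasurable _ hbd
    have h3 := h2.add hg₀
    rwa [sub_add_cancel] at h3
  · have hs' : ∀ᵐ x ∂μ, ∀ n, |(S n).s x| ≤ σ * (1 / 2) ^ n := ae_all_iff.mpr hs
    filter_upwards [hGae, hglim, hL.quasiMeasurePreserving.ae hglim,
      hL.quasiMeasurePreserving.ae hs'] with x hx h1 h2 h3
    have h4 : Tendsto (fun n => (S n).s (L x)) atTop (𝓝 0) := by
      refine squeeze_zero_norm h3 ?_
      simpa using (tendsto_pow_atTop_nhds_zero_of_lt_one (by norm_num : (0 : ℝ) ≤ 1 / 2)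
        (by norm_num)).const_mul σ
    have h5 : Tendsto (fun n => (S n).g x - (S n).g (L x) + (S n).s (L x)) atTop
        (𝓝 (g x - g (L x) + 0)) := (h1.sub h2).add h4
    rw [add_zero] at h5
    refine tendsto_nhds_unique (tendsto_const_nhds.congr' ?_) h5
    filter_upwards [hTL x hx] with n hn
    have := (S n).eq x
    rw [hn] at this
    linarith

/-! ### Transfer to standard probability spaces -/

/-- Every function of mean zero in `L^p` is a coboundary of an ergodic map, with transfer function in
`L^(p-1)`. -/
def HasErgodicCoboundaries {X : Type*} [MeasurableSpace X] (μ : Measure X) (p : ENNReal) : Prop :=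
  ∀ f : X → ℝ, MemLp f p μ → ∫ x, f x ∂μ = 0 →
    ∃ (T : X ≃ᵐ X) (g : X → ℝ), Ergodic T μ ∧ Measurable g ∧ MemLp g (p - 1) μ ∧
      ∀ᵐ x ∂μ, f x = g x - g (T x)

theorem hasErgodicCoboundaries_real {μ : Measure ℝ} [IsProbabilityMeasure μ]
    [NullSingletonClass μ] {p : ENNReal} (hp : 1 ≤ p) : HasErgodicCoboundaries μ p := by
  intro f hf h0
  obtain ⟨T, g, hT, hgm, hg, h⟩ := exists_ergodic_coboundary_real hp
    hf.1.stronglyMeasurable_mk.measurable (hf.ae_eq hf.1.ae_eq_mk)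
    (by rw [← integral_congr_ae hf.1.ae_eq_mk, h0])
  refine ⟨T, g, hT, hgm, hg, ?_⟩
  filter_upwards [h, hf.1.ae_eq_mk] with x h1 h2
  rw [h2, h1]

section Conjugation

variable {X Y : Type*} [MeasurableSpace X] [MeasurableSpace Y]

/-- A measurable conull set contains a measurable conull set that is invariant under a given measure
preserving automorphism. -/
theorem exists_invariant_subset {ν : Measure Y} (T : Y ≃ᵐ Y) (hT : MeasurePreserving T ν ν)
    {B : Set Y} (hB : MeasurableSet B) (hB0 : ν Bᶜ = 0) :
    ∃ C ⊆ B, MeasurableSet C ∧ ν Cᶜ = 0 ∧ ∀ y, T y ∈ C ↔ y ∈ C := by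
  have hT' : MeasurePreserving T.symm ν ν := hT.symm T
  refine ⟨⋂ n : ℕ, (T^[n] ⁻¹' B ∩ T.symm^[n] ⁻¹' B), ?_, ?_, ?_, ?_⟩
  · exact fun y hy => (mem_iInter.mp hy 0).1
  · exact MeasurableSet.iInter fun n =>
      ((T.measurable.iterate n) hB).inter ((T.symm.measurable.iterate n) hB)
  · rw [compl_iInter]
    refine measure_iUnion_null fun n => ?_
    rw [compl_inter]
    exact measure_union_null ((hT.iterate n).quasiMeasurePreserving.preimage_null hB0)
      ((hT'.iterate n).quasiMeasurePreserving.preimage_null hB0)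
  · intro y
    simp only [mem_iInter, mem_inter_iff, mem_preimage]
    have h1 : ∀ n, T^[n] (T y) = T^[n + 1] y := fun n => rfl
    have h2 : ∀ n, T.symm^[n + 1] (T y) = T.symm^[n] y := fun n => by
      rw [Function.iterate_succ_apply, MeasurableEquiv.symm_apply_apply]
    refine ⟨fun h n => ⟨?_, ?_⟩, fun h n => ⟨?_, ?_⟩⟩
    · cases n with
      | zero =>
        have := (h 1).2
        rw [h2 0] at this
        exact this
      | succ n => exact (h n).1
    · rw [← h2]
      exact (h (n + 1)).2
    · exact (h (n + 1)).1
    · cases n with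
      | zero => exact (h 1).1
      | succ n =>
        rw [h2]
        exact (h n).2

/-- The map is conjugated by `φ` and `ψ`, which are inverse to each other only off null sets. The
conjugate is therefore defined on the part over an invariant conull set `C`. -/
theorem HasErgodicCoboundaries.of_maps {μ : Measure X} {ν : Measure Y} {p : ENNReal}
    (hν : HasErgodicCoboundaries ν p) {φ : X → Y} {ψ : Y → X} (hφ : MeasurePreserving φ μ ν)
    (hψ : MeasurePreserving ψ ν μ) {A : Set X} {B : Set Y} (hA : MeasurableSet A)
    (hB : MeasurableSet B) (hA0 : μ Aᶜ = 0) (hB0 : ν Bᶜ = 0)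
    (hψφ : ∀ x ∈ A, ψ (φ x) = x) (hψA : ∀ y ∈ B, ψ y ∈ A) (hφψ : ∀ y ∈ B, φ (ψ y) = y) :
    HasErgodicCoboundaries μ p := by
  classical
  intro f hf h0
  obtain ⟨T', g', hT', hgm', hg', heq'⟩ := hν (f ∘ ψ) (hf.comp_measurePreserving hψ) (by
    have h1 : ∫ y, f (ψ y) ∂ν = ∫ x, f x ∂(ν.map ψ) :=
      (integral_map hψ.measurable.aemeasurable (by rw [hψ.map_eq]; exact hf.1)).symm
    change ∫ y, f (ψ y) ∂ν = 0
    rw [h1, hψ.map_eq, h0])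
  obtain ⟨C, hCB, hCm, hC0, hCT⟩ := exists_invariant_subset T' hT'.toMeasurePreserving hB hB0
  have hCT' : ∀ y, T'.symm y ∈ C ↔ y ∈ C := fun y => by
    rw [← hCT (T'.symm y), MeasurableEquiv.apply_symm_apply]
  set W : Set X := A ∩ φ ⁻¹' C with hW
  have hWm : MeasurableSet W := hA.inter (hφ.measurable hCm)
  have hWae : ∀ᵐ x ∂μ, x ∈ W := by
    rw [ae_iff]
    change μ Wᶜ = 0
    rw [hW, compl_inter]
    exact measure_union_null hA0 (hφ.quasiMeasurePreserving.preimage_null hC0)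
  have hφC : ∀ y ∈ C, ψ y ∈ W := fun y hy => ⟨hψA y (hCB hy), by
    rw [mem_preimage, hφψ y (hCB hy)]
    exact hy⟩
  -- Off `W` the identity is used, so that `F R` is a bijection of the whole space with inverse `F
  -- R.symm`.
  let F : (Y ≃ᵐ Y) → X → X := fun R x => if x ∈ W then ψ (R (φ x)) else x
  have hFW : ∀ R : Y ≃ᵐ Y, ∀ x ∈ W, F R x = ψ (R (φ x)) := fun R x hx => if_pos hx
  have hFm : ∀ R : Y ≃ᵐ Y, Measurable (F R) := fun R =>
    (hψ.measurable.comp (R.measurable.comp hφ.measurable)).ite hWm measurable_id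
  have hFinv : ∀ R : Y ≃ᵐ Y, (∀ y, R y ∈ C ↔ y ∈ C) → ∀ x, F R.symm (F R x) = x := by
    intro R hR x
    by_cases hx : x ∈ W
    · have h1 : R (φ x) ∈ C := (hR _).mpr hx.2
      rw [hFW R x hx, hFW _ _ (hφC _ h1), hφψ _ (hCB h1), MeasurableEquiv.symm_apply_apply,
        hψφ x hx.1]
    · have h1 : ∀ R, F R x = x := fun R => if_neg hx
      rw [h1, h1]
  let T : X ≃ᵐ X := ⟨⟨F T', F T'.symm, hFinv T' hCT, hFinv T'.symm hCT'⟩, hFm _, hFm _⟩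
  have hT : ∀ x ∈ W, T x = ψ (T' (φ x)) := hFW T'
  have hTae : ⇑T =ᵐ[μ] ψ ∘ T' ∘ φ := by
    filter_upwards [hWae] with x hx using hT x hx
  have hTmp : MeasurePreserving T μ μ := by
    refine ⟨T.measurable, ?_⟩
    rw [Measure.map_congr hTae]
    exact (hψ.comp (hT'.toMeasurePreserving.comp hφ)).map_eq
  refine ⟨T, g' ∘ φ, ⟨hTmp, ⟨fun J hJ hJT => ?_⟩⟩, hgm'.comp hφ.measurable,
    hg'.comp_measurePreserving hφ, ?_⟩
  · have hinv : T' ⁻¹' (ψ ⁻¹' J ∩ C) = ψ ⁻¹' J ∩ C := by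
      ext y
      rw [mem_preimage, mem_inter_iff, mem_inter_iff, hCT]
      refine and_congr_left fun hy => ?_
      have h1 : ψ (T' y) = T (ψ y) := by rw [hT _ (hφC y hy), hφψ y (hCB hy)]
      rw [mem_preimage, mem_preimage, h1, ← mem_preimage, hJT]
    have hc := hT'.toPreErgodic.aeconst_set ((hψ.measurable hJ).inter hCm) hinv
    rw [eventuallyConst_set] at hc ⊢
    rcases hc with hc | hc
    · left
      filter_upwards [hφ.quasiMeasurePreserving.ae hc, hWae] with x h1 h2
      rw [← hψφ x h2.1]
      exact h1.1
    · right
      filter_upwards [hφ.quasiMeasurePreserving.ae hc, hWae] with x h1 h2 h3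
      refine h1 ⟨?_, h2.2⟩
      rw [mem_preimage, hψφ x h2.1]
      exact h3
  · filter_upwards [hφ.quasiMeasurePreserving.ae heq', hWae] with x h1 h2
    simp only [Function.comp_apply] at h1 ⊢
    rw [hψφ x h2.1] at h1
    rw [hT x h2, hφψ _ (hCB ((hCT _).mpr h2.2)), h1]

theorem measurePreserving_of_subtype {μ : Measure X} {ν : Measure Y} {A : Set X} {B : Set Y}
    (hA : MeasurableSet A) (hB : MeasurableSet B) (hA0 : μ Aᶜ = 0) (hB0 : ν Bᶜ = 0) {e : A → B}
    (he : MeasurePreserving e (μ.comap Subtype.val) (ν.comap Subtype.val)) {φ : X → Y}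
    (hφ : Measurable φ) (h : ∀ x : A, φ x = e x) : MeasurePreserving φ μ ν := by
  refine ⟨hφ, Measure.ext fun D hD => ?_⟩
  rw [Measure.map_apply hφ hD, ← measure_inter_conull hA0, ← measure_inter_conull (s := D) hB0,
    inter_comm, inter_comm D, ← Subtype.image_preimage_coe, ← Subtype.image_preimage_coe,
    ← comap_subtype_coe_apply hA, ← comap_subtype_coe_apply hB,
    ← he.measure_preimage (measurable_subtype_coe hD).nullMeasurableSet]
  congr 1
  ext x
  simp only [mem_preimage, h]

theorem HasErgodicCoboundaries.of_isoModZero {μ : Measure X} {ν : Measure Y} {p : ENNReal}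
    [IsProbabilityMeasure ν] (h : IsoModZero μ ν) (hν : HasErgodicCoboundaries ν p) :
    HasErgodicCoboundaries μ p := by
  classical
  obtain ⟨A, B, e, hA, hB, hA0, hB0, he⟩ := h
  -- A point of `B` supplies the default values on the null complements of `A` and `B`.
  obtain ⟨y₀, hy₀⟩ : B.Nonempty := by
    rw [nonempty_iff_ne_empty]
    rintro rfl
    simp at hB0
  let φ : X → Y := fun x => if hx : x ∈ A then e ⟨x, hx⟩ else y₀
  let ψ : Y → X := fun y => if hy : y ∈ B then e.symm ⟨y, hy⟩ else e.symm ⟨y₀, hy₀⟩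
  have hφe : ∀ x : A, φ x = e x := fun x => dif_pos x.2
  have hψe : ∀ y : B, ψ y = e.symm y := fun y => dif_pos y.2
  have hφm : Measurable φ :=
    Measurable.dite (f := fun x : A => (e x : Y)) (g := fun _ => y₀)
      (measurable_subtype_coe.comp e.measurable) measurable_const hA
  have hψm : Measurable ψ :=
    Measurable.dite (f := fun y : B => (e.symm y : X)) (g := fun _ => (e.symm ⟨y₀, hy₀⟩ : X))
      (measurable_subtype_coe.comp e.symm.measurable) measurable_const hB
  refine hν.of_maps (measurePreserving_of_subtype hA hB hA0 hB0 he hφm hφe)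
    (measurePreserving_of_subtype hB hA hB0 hA0 (he.symm e) hψm hψe) hA hB hA0 hB0 ?_ ?_ ?_
  · intro x hx
    rw [hφe ⟨x, hx⟩, hψe, MeasurableEquiv.symm_apply_apply]
  · intro y hy
    rw [hψe ⟨y, hy⟩]
    exact (e.symm ⟨y, hy⟩).2
  · intro y hy
    rw [hψe ⟨y, hy⟩, hφe, MeasurableEquiv.apply_symm_apply]

theorem measurePreserving_completion (ν : Measure Y) :
    MeasurePreserving (α := NullMeasurableSpace Y ν) (β := Y) id ν.completion ν := by
  have hm : Measurable (α := NullMeasurableSpace Y ν) (β := Y) id := fun D hD =>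
    MeasurableSet.nullMeasurableSet (α := Y) (μ := ν) hD
  refine ⟨hm, Measure.ext fun D hD => ?_⟩
  rw [Measure.map_apply hm hD]
  rfl

/-- A function measurable for the completion is almost everywhere measurable for `ν`, so `T` and `g`
for `ν` can be reused. Quasi measure preserving maps pull null measurable sets back to null
measurable sets, and ergodicity extends to them. -/
theorem HasErgodicCoboundaries.completion {ν : Measure Y} {p : ENNReal}
    (hν : HasErgodicCoboundaries ν p) : HasErgodicCoboundaries ν.completion p := by
  intro f hf h0
  have hid := measurePreserving_completion ν
  have hfm : AEMeasurable (α := Y) f ν :=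
    NullMeasurable.aemeasurable (aemeasurable_iff_measurable.mp hf.1.aemeasurable)
  have hf' : MemLp (α := Y) f p ν := by
    have h1 := memLp_map_measure_iff (β := Y) (g := f) (p := p)
      (by rw [hid.map_eq]; exact hfm.aestronglyMeasurable) hid.measurable.aemeasurable
    rw [hid.map_eq] at h1
    exact h1.mpr hf
  obtain ⟨T, g, hT, hgm, hg, heq⟩ := hν f hf' (by
    have h1 := integral_map (β := Y) (f := f) hid.measurable.aemeasurable
      (by rw [hid.map_eq]; exact hfm.aestronglyMeasurable)
    rw [hid.map_eq] at h1
    exact h1.trans h0)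
  have hTs : MeasurePreserving T.symm ν ν := hT.toMeasurePreserving.symm T
  let T' : NullMeasurableSpace Y ν ≃ᵐ NullMeasurableSpace Y ν :=
    ⟨T.toEquiv, fun D hD => NullMeasurableSet.preimage (μa := ν) (μb := ν) hD
        hT.toMeasurePreserving.quasiMeasurePreserving,
      fun D hD => NullMeasurableSet.preimage (μa := ν) (μb := ν) hD hTs.quasiMeasurePreserving⟩
  refine ⟨T', g, ⟨⟨T'.measurable, Measure.ext fun D hD => ?_⟩, ⟨fun J hJ hJT => ?_⟩⟩,
    hgm.comp hid.measurable, hg.comp_measurePreserving hid, heq⟩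
  · rw [Measure.map_apply T'.measurable hD]
    exact hT.toMeasurePreserving.measure_preimage (s := D) hD
  · exact hT.quasiErgodic.aeconst_set₀ (s := J) hJ (Eq.eventuallyEq hJT)

end Conjugation

theorem hasErgodicCoboundaries_unitInterval {p : ENNReal} (hp : 1 ≤ p) :
    HasErgodicCoboundaries (volume : Measure (Icc (0 : ℝ) 1)) p := by
  have hprob : IsProbabilityMeasure (volume.restrict (Icc (0 : ℝ) 1)) := ⟨by simp⟩
  -- The interval embeds in the line with restricted Lebesgue measure; the projection onto the
  -- interval is a measurable left inverse defined everywhere.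
  have hφ : MeasurePreserving (Subtype.val : Icc (0 : ℝ) 1 → ℝ) volume
      (volume.restrict (Icc (0 : ℝ) 1)) := measurePreserving_subtype_coe measurableSet_Icc
  have hψm : Measurable (projIcc (0 : ℝ) 1 zero_le_one) := continuous_projIcc.measurable
  have hψ : MeasurePreserving (projIcc (0 : ℝ) 1 zero_le_one) (volume.restrict (Icc (0 : ℝ) 1))
      volume := by
    refine ⟨hψm, ?_⟩
    rw [← hφ.map_eq, Measure.map_map hψm hφ.measurable]
    have : projIcc (0 : ℝ) 1 zero_le_one ∘ Subtype.val = id := by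
      funext x
      simp
    rw [this, Measure.map_id]
  refine (hasErgodicCoboundaries_real hp).of_maps hφ hψ MeasurableSet.univ
    (measurableSet_Icc (a := (0 : ℝ)) (b := 1)) (by simp) ?_ ?_ ?_ ?_
  · rw [Measure.restrict_apply measurableSet_Icc.compl]
    simp
  · intro x _
    simp
  · exact fun _ _ => mem_univ _
  · intro y hy
    rw [projIcc_of_mem _ hy]

theorem theorem1 {X : Type*} [MeasurableSpace X] (μ : Measure X)
    (hμ : IsStandardProbabilitySpace μ)
    (p : ENNReal) (hp : 1 ≤ p)
    (f : X → ℝ) (hf : MemLp f p μ) (hf0 : ∫ x, f x ∂μ = 0) :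
    ∃ (T : X ≃ᵐ X) (g : X → ℝ),
      Ergodic T μ ∧ Measurable g ∧ MemLp g (p - 1) μ ∧
        ∀ᵐ x ∂μ, f x = g x - g (T x) := by
  have hI := hasErgodicCoboundaries_unitInterval hp
  rcases hμ with h | h
  · exact HasErgodicCoboundaries.of_isoModZero h hI f hf hf0
  · have : IsProbabilityMeasure (volume : Measure (Icc (0 : ℝ) 1)).completion :=
      ⟨measure_univ (μ := (volume : Measure (Icc (0 : ℝ) 1)))⟩
    exact HasErgodicCoboundaries.of_isoModZero h hI.completion f hf hf0
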